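/- Let $T$ be a finite set of labels and let $x\notin T$ be a further label. Fix a configuration of $T$, i.e. pairwise distinct points $z_t$ ($t\in T$) in the closed upper half plane; a label $t$ is called interior if $\operatorname{Im} z_t>0$ and real if $z_t\in\mathbb R$. We write $t$ also for the point $z_t$. Let $\mathbb D=\mathbb H\setminus\{z_t : t\in T\}$, where $\mathbb H$ is the open upper half plane; $x$ denotes a point moving in $\mathbb D$, and $x$ counts as an interior label. For $a\in\mathbb C$ put $\omega_a=\frac{1}{2\pi i}\frac{dt}{t-a}$. For labels $a,b$ and a word $w=s_1\cdots s_n$ in labels, let $$L(\bar a|w|\bar b)=\int_\gamma\omega_{s_1}\cdots\omega_{s_n}=\int_{0\le t_n\le\dots\le t_1\le1}(\gamma^*\omega_{s_1})(t_1)\cdots(\gamma^*\omega_{s_n})(t_n)$$ be the iterated integral along a path $\gamma$ from $\bar a$ to $\bar b$ whose interior lies in the open lower half plane; for $a=b$ the path is constant, so that $L(\bar a|w|\bar a)=0$ if $w$ is non-empty. It equals $1$ for the empty word. For $u,v\in T$ let $L(\bar a|(u-v)\cdot w|\infty)=\int_\gamma(\omega_u-\omega_v)\omega_{s_1}\cdots\omega_{s_n}$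 along a path from $\bar a$ to $\infty$ inside the open lower half plane. We call $L(\bar a|w|\bar b)$ nautical if ($a$ is interior or $a\neq s_n$) and ($b$ is interior or $b\ne s_1$); these conditions are void for empty $w$. Let $$\alpha_{x\to a}=\frac1{2\pi i}\,d\log\frac{x-a}{\bar x-a}.$$ Let $y,u,v\in T$ and let $w$ be a word in the labels $T\sqcup\{x\}$ such that $L(\bar y|w|\bar x)$ is nautical, i.e. $y$ is interior or $w$ does not end with $y$. Suppose that $y\ne u,v$, or $w$ is non-empty, or $y$ is interior; and suppose that $u\neq v$, or $u=v$ is interior. Write $w_{x\mapsto a}$ for the word obtained from $w$ by replacing every $x$ by $a$. Then the iterated integrals below converge, the fibre integral over $x\in\mathbb D$ (with the standard orientation $d\operatorname{Re}x\wedge d\operatorname{Im}x$) converges absolutely, and $$\int_{x\in\mathbb D} L(\bar y|w|\bar x)\,\alpha_{x\to u}\wedge\alpha_{x\to v}=L(\bar y|u\cdot w_{x\mapsto v}|\bar v)-L(\bar y|v\cdot w_{x\mapsto u}|\bar u)-\begin{cases}0&\text{if $x$ occurs in $w$},\\ L(\bar y|(u-v)\cdot w|\infty)&\text{otherwise.}\end{cases}$$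 -/

import Mathlib

open MeasureTheory Complex

namespace NauticalWedge

noncomputable section

/-- A configuration of the labels `S` : pairwise distinct marked points in the closed upper half
plane. The labels `s` with `0 < (z s).im` form the set `U` of interior labels, those with
`(z s).im = 0` form the set `R` of boundary labels, ordered by their positions. Letting `z` vary
over all configurations, all strata `S = U ⊔ R` (and all orderings of `R`) occur. -/
structure IsConfig {S : Type*} (z : S → ℂ) : Prop where
  injective : Function.Injective z
  im_nonneg : ∀ s, 0 ≤ (z s).im

/-- The label `s` lies in `U`, i.e. its marked point is in the open upper half plane. -/
def IsInterior {S : Type*} (z : S → ℂ) (s : S) : Prop := 0 < (z s).im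

/-- The fibre, over the configuration `z`, of the map that forgets the additional interior point:
the upper half plane punctured at the marked points. -/
def fibre {T : Type*} (z : T → ℂ) : Set ℂ := {p | 0 < p.im ∧ p ∉ Set.range z}

/-- The configuration of `T ⊔ {x}` obtained from `z` by placing `x` at the point `p`.
The label set `T ⊔ {x}` is `Option T`, with `x = none`. -/
def extend {T : Type*} (z : T → ℂ) (p : ℂ) : Option T → ℂ := fun s => s.elim p z

/-- The coefficient of the one-form `ω_a = (2πi)⁻¹ dt / (t - a)`. -/
def omega (a : ℂ) : ℂ → ℂ := fun t => (2 * (Real.pi : ℂ) * I)⁻¹ * (t - a)⁻¹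

/-- Chen's iterated integral `∫_γ f₁ ⋯ fₙ` of the one-forms `fᵢ(t) dt` along the part of the path
`γ : (0,1) → ℂ` up to the parameter `t`; the leftmost form is evaluated at the largest parameter.
-/
def iterInt (γ : ℝ → ℂ) : List (ℂ → ℂ) → ℝ → ℂ
  | [], _ => 1
  | f :: w, t => ∫ τ in (0 : ℝ)..t, f (γ τ) * deriv γ τ * iterInt γ w τ

/-- Convergence of the iterated integral `iterInt γ w t`: the outermost integrand is integrable
on `(0, t)`, and the inner iterated integrals converge at every parameter in `(0, t)`. -/
def IterConverges (γ : ℝ → ℂ) : List (ℂ → ℂ) → ℝ → Prop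
  | [], _ => True
  | f :: w, t =>
      (∀ s ∈ Set.Ioo 0 t, IterConverges γ w s) ∧
        IntervalIntegrable (fun τ => f (γ τ) * deriv γ τ * iterInt γ w τ) volume 0 t

/-- A path from `a` to `b` (points of the closed lower half plane) whose interior lies in the open
lower half plane if `a ≠ b`, and which is constant if `a = b`. All such paths are homotopic. -/
def path (a b : ℂ) : ℝ → ℂ := fun t => a + t * (b - a) - I * (‖b - a‖ * t * (1 - t) : ℝ)

/-- A path from the point `a` of the closed lower half plane to `∞`, inside the open lower
half plane. -/
def pathInf (a : ℂ) : ℝ → ℂ := fun t => a - I * (t / (1 - t) : ℝ)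

/-- The one-forms denoted by the letters of a word. -/
def forms {S : Type*} (z : S → ℂ) (w : List S) : List (ℂ → ℂ) := w.map fun s => omega (z s)

/-- The polylogarithm `L(a̅ | w | b̅)`. -/
def polylog {S : Type*} (z : S → ℂ) (a b : S) (w : List S) : ℂ :=
  iterInt (path (starRingEnd ℂ (z a)) (starRingEnd ℂ (z b))) (forms z w) 1

/-- The iterated integral that defines `L(a̅ | w | b̅)` converges. -/
def PolylogConverges {S : Type*} (z : S → ℂ) (a b : S) (w : List S) : Prop :=
  IterConverges (path (starRingEnd ℂ (z a)) (starRingEnd ℂ (z b))) (forms z w) 1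

/-- The list of one-forms `(ω_u - ω_v), ω_{s₁}, …, ω_{sₙ}` of `(u - v)·w`, for `w = s₁ ⋯ sₙ`. -/
def diffForms {S : Type*} (z : S → ℂ) (u v : S) (w : List S) : List (ℂ → ℂ) :=
  (fun t => omega (z u) t - omega (z v) t) :: forms z w

/-- The polylogarithm `L(a̅ | (u - v)·w | ∞)`. The integrals for `u·w` and `v·w` separately
diverge at `∞`, so the difference of the two forms is taken before integrating. -/
def polylogInf {S : Type*} (z : S → ℂ) (a u v : S) (w : List S) : ℂ :=
  iterInt (pathInf (starRingEnd ℂ (z a))) (diffForms z u v w) 1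

/-- The iterated integral that defines `L(a̅ | (u - v)·w | ∞)` converges. -/
def PolylogInfConverges {S : Type*} (z : S → ℂ) (a u v : S) (w : List S) : Prop :=
  IterConverges (pathInf (starRingEnd ℂ (z a))) (diffForms z u v w) 1

/-- `L(a̅ | w | b̅)` is nautical: `a` is interior or is not the last letter of `w`, and `b` is
interior or is not the first letter of `w`. -/
def IsNautical {S : Type*} (z : S → ℂ) (a b : S) (w : List S) : Prop :=
  (IsInterior z a ∨ w.getLast? ≠ some a) ∧ (IsInterior z b ∨ w.head? ≠ some b)

/-- The word `w_{x ↦ a}`. -/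
def subst {T : Type*} (w : List (Option T)) (a : T) : List T := w.map fun s => s.getD a

/-- The logarithmic derivative `d log f = df / f` of a function of the fibre coordinate, as a
complex-valued real one-form. -/
def dlog (f : ℂ → ℂ) (p : ℂ) : ℂ →L[ℝ] ℂ := (f p)⁻¹ • fderiv ℝ f p

/-- The restriction to the fibre with coordinate `x` of the logarithmic propagator
`α_{x → a} = (2πi)⁻¹ d log ((x - a) / (x̅ - a))`. -/
def propagator (a : ℂ) (p : ℂ) : ℂ →L[ℝ] ℂ :=
  (2 * (Real.pi : ℂ) * I)⁻¹ • dlog (fun x => (x - a) / (starRingEnd ℂ x - a)) p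

/-- The density of `α ∧ β` with respect to the area form `d Re x ∧ d Im x`. -/
def wedgeDensity (α β : ℂ →L[ℝ] ℂ) : ℂ := α 1 * β I - α I * β 1

/-- The density of `L(y̅ | w | x̅) α_{x → u} ∧ α_{x → v}` on the fibre at `x = p`. -/
def wedgeIntegrand {T : Type*} (z : T → ℂ) (y u v : T) (w : List (Option T)) (p : ℂ) : ℂ :=
  polylog (extend z p) (some y) none w *
    wedgeDensity (propagator (z u) p) (propagator (z v) p)

end

end NauticalWedge

namespace NauticalWedge

noncomputable section

open Set Filter Topology

/-! ### Iterated integrals of lists of kernels on the unit interval -/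

/-! The integral is computed by Stokes' theorem on the whole complex plane. Write `a` for the
conjugate of the point of `y`, and `F_W(p)` for the iterated integral of `W` from `a` to the
conjugate of `p`, with every letter `x` of `W` placed at `p`. Expanding the propagators gives
`α_{x→u} ∧ α_{x→v} = 2i (ω_v(p̄) ω_u(p) - ω_u(p̄) ω_v(p))` times the area form. The letters `x`
depend holomorphically on `p`, and only the end point `p̄` is antiholomorphic, so `∂F_{uW}/∂p̄ =
ω_u(p̄) F_W`. Hence `A = -F_{uW} ω_v + F_{vW} ω_u` is a primitive of the density for `∂/∂p̄`.

The decisive point is that `A` extends to the lower half plane without boundary terms. For `p` below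
the axis, take the end point to be `p` itself (this is `fold p`) and keep the letters `x` at `p`.
The extension is continuous across the real axis away from `u` and `v`. Below the axis it is
holomorphic except possibly at `a`, since both the end point and the letters now depend
holomorphically on `p`. So the integral of the density over the upper half plane is the integral of
`2 ∂A/∂p̄` over `ℂ`, and real and interior labels are treated alike. Only simple poles at `u` and
`v` and a `1/p` term at infinity contribute. The residue at `u` is `F_{vW}(u)/(2πi)`, that at `v` is
`-F_{uW}(v)/(2πi)`, and `p A(p)` tends to `-(F_{uW} - F_{vW})(∞)/(2πi)`. If `x` occurs in `W`, this
last limit is zero, because the form of the letter `x` tends to zero when `x` itself moves to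
infinity. See `hasDbar_primitive`, `integral_eq_residues` and `I_mul_integral_density`.

The analysis rests on one family of estimates. Along a path with parameter `τ`, every kernel is `O(1
/ (τ (1 - τ)))`, and the last one gains the weight `(τ / (1 - τ)) ^ δ`, which is reproduced by
integration against `dτ / (τ (1 - τ))` (`Tame.main`). The bounds are uniform in the end point for
the path `pth a b 1 1`, which stays away from the closed upper half plane and from letters placed at
`b` (`avoids_eta`). They yield continuity of `F`, its sublinear growth, absolute integrability and,
after a Möbius change of parameter, the limit at infinity. Path independence in a convex region
(`kerInt_eq_segInt`, `kerInt_deform`) identifies this path with the defining path, and with straight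
segments, for which holomorphy in the end point and in the letters is easy. -/

/-- The iterated integral of a list of kernels; the leftmost kernel is integrated last. -/
def kerInt : List (ℝ → ℂ) → ℝ → ℂ
  | [], _ => 1
  | k :: l, t => ∫ τ in (0 : ℝ)..t, k τ * kerInt l τ

/-- Convergence of the iterated integral `kerInt l t`. -/
def KerConverges : List (ℝ → ℂ) → ℝ → Prop
  | [], _ => True
  | k :: l, t => (∀ s ∈ Ioo 0 t, KerConverges l s) ∧
      IntervalIntegrable (fun τ => k τ * kerInt l τ) volume 0 t

/-- The pull-back of the one-form `f(t) dt` along a path. -/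
def pull (γ : ℝ → ℂ) (f : ℂ → ℂ) : ℝ → ℂ := fun τ => f (γ τ) * deriv γ τ

lemma iterInt_eq_kerInt (γ : ℝ → ℂ) (w : List (ℂ → ℂ)) (t : ℝ) :
    iterInt γ w t = kerInt (w.map (pull γ)) t := by
  induction w generalizing t with
  | nil => rfl
  | cons f w ih => simp only [iterInt, List.map_cons, kerInt, ih, pull]

lemma iterConverges_iff (γ : ℝ → ℂ) (w : List (ℂ → ℂ)) (t : ℝ) :
    IterConverges γ w t ↔ KerConverges (w.map (pull γ)) t := by
  induction w generalizing t with
  | nil => rfl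
  | cons f w ih =>
    simp only [IterConverges, List.map_cons, KerConverges, ih, iterInt_eq_kerInt, pull]

/-- The function `(τ / (1 - τ)) ^ δ`. -/
def ratioPow (δ τ : ℝ) : ℝ := (τ / (1 - τ)) ^ δ

lemma ratioPow_nonneg {δ τ : ℝ} (hτ : τ ∈ Ioo (0 : ℝ) 1) : 0 ≤ ratioPow δ τ :=
  Real.rpow_nonneg (div_nonneg hτ.1.le (by linarith [hτ.2])) _

/-- This differential equation is the reason for the weight: integration against `dτ / (τ (1 - τ))`
reproduces it up to the factor `1 / δ`, so a bound by it survives any number of integrations. -/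
lemma hasDerivAt_ratioPow (δ : ℝ) {τ : ℝ} (hτ : τ ∈ Ioo (0 : ℝ) 1) :
    HasDerivAt (ratioPow δ) (δ * (ratioPow δ τ / (τ * (1 - τ)))) τ := by
  have h0 : 0 < τ := hτ.1
  have h1 : 0 < 1 - τ := by linarith [hτ.2]
  have hd : HasDerivAt (fun s : ℝ => s / (1 - s)) ((1 * (1 - τ) - τ * (-1)) / (1 - τ) ^ 2) τ :=
    (hasDerivAt_id τ).div ((hasDerivAt_id τ).const_sub 1) h1.ne'
  have := hd.rpow_const (p := δ) (Or.inl (div_pos h0 h1).ne')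
  refine this.congr_deriv ?_
  rw [Real.rpow_sub_one (div_pos h0 h1).ne', ratioPow]
  field_simp
  ring

lemma continuousOn_ratioPow {δ : ℝ} (hδ : 0 < δ) : ContinuousOn (ratioPow δ) (Ico 0 1) := by
  intro τ hτ
  have h1 : (1 - τ) ≠ 0 := by linarith [hτ.2]
  have : ContinuousAt (fun s : ℝ => s / (1 - s)) τ := by fun_prop (disch := assumption)
  exact (this.rpow_const (Or.inr hδ.le)).continuousWithinAt

lemma ratioPow_zero {δ : ℝ} (hδ : 0 < δ) : ratioPow δ 0 = 0 := by
  simp [ratioPow, Real.zero_rpow hδ.ne']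

lemma tendsto_ratioPow_zero {δ : ℝ} (hδ : 0 < δ) :
    Tendsto (ratioPow δ) (𝓝[>] 0) (𝓝 0) := by
  have h := (continuousOn_ratioPow hδ) 0 ⟨le_rfl, one_pos⟩
  rw [ContinuousWithinAt, ratioPow_zero hδ] at h
  refine h.mono_left ?_
  rw [← nhdsWithin_Ioo_eq_nhdsGT (zero_lt_one' ℝ)]
  exact nhdsWithin_mono _ Ioo_subset_Ico_self

lemma integrableOn_ratioPow {δ : ℝ} (hδ : 0 < δ) {t : ℝ} (ht : t ∈ Ioo (0 : ℝ) 1) :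
    IntegrableOn (fun τ => ratioPow δ τ / (τ * (1 - τ))) (Ioc 0 t) ∧
      ∫ τ in (0 : ℝ)..t, ratioPow δ τ / (τ * (1 - τ)) = ratioPow δ t / δ := by
  have hsub : ∀ x ∈ Ioo 0 t, x ∈ Ioo (0 : ℝ) 1 := fun x hx => ⟨hx.1, hx.2.trans ht.2⟩
  have hc : ContinuousOn (fun τ => ratioPow δ τ / δ) (Icc 0 t) :=
    ((continuousOn_ratioPow hδ).mono fun x hx => ⟨hx.1, hx.2.trans_lt ht.2⟩).div_const _
  have hd : ∀ x ∈ Ioo 0 t, HasDerivAt (fun τ => ratioPow δ τ / δ)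
      (ratioPow δ x / (x * (1 - x))) x := fun x hx => by
    refine ((hasDerivAt_ratioPow δ (hsub x hx)).div_const δ).congr_deriv ?_
    field_simp
  have hi : IntegrableOn (fun τ => ratioPow δ τ / (τ * (1 - τ))) (Ioc 0 t) := by
    refine intervalIntegral.integrableOn_deriv_of_nonneg hc hd fun x hx => ?_
    exact div_nonneg (ratioPow_nonneg (hsub x hx))
      (mul_nonneg hx.1.le (by linarith [(hsub x hx).2]))
  refine ⟨hi, ?_⟩
  rw [intervalIntegral.integral_eq_sub_of_hasDerivAt_of_le ht.1.le hc hd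
    ((intervalIntegrable_iff_integrableOn_Ioc_of_le ht.1.le).2 hi)]
  simp [ratioPow_zero hδ]

lemma aestronglyMeasurable_of_continuousOn_Ioo {g : ℝ → ℂ} (hg : ContinuousOn g (Ioo 0 1))
    {t : ℝ} (ht : t ≤ 1) : AEStronglyMeasurable g (volume.restrict (Ioc 0 t)) := by
  refine AEStronglyMeasurable.mono_measure ?_ (Measure.restrict_mono (Ioc_subset_Ioc_right ht) le_rfl)
  rw [← restrict_Ioo_eq_restrict_Ioc]
  exact hg.aestronglyMeasurable measurableSet_Ioo

lemma intervalIntegral_of_ratioPow_bound {δ M : ℝ} (hδ : 0 < δ) {g : ℝ → ℂ}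
    (hg : ContinuousOn g (Ioo 0 1))
    (hb : ∀ τ ∈ Ioo (0 : ℝ) 1, ‖g τ‖ ≤ M * (ratioPow δ τ / (τ * (1 - τ))))
    {t : ℝ} (ht : t ∈ Ioo (0 : ℝ) 1) :
    IntervalIntegrable g volume 0 t ∧ ‖∫ τ in (0 : ℝ)..t, g τ‖ ≤ M * (ratioPow δ t / δ) ∧
      HasDerivAt (fun s => ∫ τ in (0 : ℝ)..s, g τ) (g t) t := by
  obtain ⟨hi, he⟩ := integrableOn_ratioPow hδ ht
  have hae : ∀ᵐ τ ∂volume.restrict (Ioc 0 t), ‖g τ‖ ≤ M * (ratioPow δ τ / (τ * (1 - τ))) :=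
    (ae_restrict_iff' measurableSet_Ioc).2
      (Eventually.of_forall fun τ hτ => hb τ ⟨hτ.1, hτ.2.trans_lt ht.2⟩)
  have h_int : IntervalIntegrable g volume 0 t := by
    rw [intervalIntegrable_iff_integrableOn_Ioc_of_le ht.1.le]
    exact (hi.const_mul M).mono' (aestronglyMeasurable_of_continuousOn_Ioo hg ht.2.le) hae
  refine ⟨h_int, ?_, ?_⟩
  · rw [← he, ← intervalIntegral.integral_const_mul]
    refine intervalIntegral.norm_integral_le_of_norm_le ht.1.le
      ((ae_restrict_iff' measurableSet_Ioc).1 hae) ?_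
    rw [intervalIntegrable_iff_integrableOn_Ioc_of_le ht.1.le]
    exact hi.const_mul M
  · exact intervalIntegral.integral_hasDerivAt_right h_int
      (hg.stronglyMeasurableAtFilter isOpen_Ioo t ht) (hg.continuousAt (isOpen_Ioo.mem_nhds ht))

/-- The size conditions on a list of kernels that make its iterated integral converge at every
parameter in `(0, 1)`. -/
structure Tame (δ C θ : ℝ) (l : List (ℝ → ℂ)) : Prop where
  cont : ∀ k ∈ l, ContinuousOn k (Ioo 0 1)
  bound : ∀ k ∈ l, ∀ τ ∈ Ioo (0 : ℝ) 1, ‖k τ‖ ≤ C / (τ * (1 - τ))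
  last : ∀ k ∈ l.getLast?, ∀ τ ∈ Ioo (0 : ℝ) 1,
    ‖k τ‖ ≤ C * θ * (ratioPow δ τ / (τ * (1 - τ)))

lemma Tame.tail {δ C θ : ℝ} {k : ℝ → ℂ} {l : List (ℝ → ℂ)} (h : Tame δ C θ (k :: l)) :
    Tame δ C θ l where
  cont k' hk := h.cont k' (List.mem_cons_of_mem _ hk)
  bound k' hk := h.bound k' (List.mem_cons_of_mem _ hk)
  last k' hk := by
    refine h.last k' ?_
    cases l with
    | nil => simp at hk
    | cons b l => simpa [List.getLast?_cons_cons] using hk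

/-- Exactly one factor carries the weight: the kernel itself if it is the last one, the inner
integral otherwise. -/
lemma Tame.mul_bound {δ C θ N : ℝ} (hC : 0 ≤ C) {k : ℝ → ℂ} {l : List (ℝ → ℂ)}
    (h : Tame δ C θ (k :: l)) {τ : ℝ} (hτ : τ ∈ Ioo (0 : ℝ) 1)
    (hl : l = [] → θ ≤ N) (hN : l ≠ [] → ‖kerInt l τ‖ ≤ N * ratioPow δ τ) :
    ‖k τ * kerInt l τ‖ ≤ C * N * (ratioPow δ τ / (τ * (1 - τ))) := by
  have hpos : 0 < τ * (1 - τ) := mul_pos hτ.1 (by linarith [hτ.2])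
  have hr := ratioPow_nonneg (δ := δ) hτ
  rw [norm_mul]
  rcases eq_or_ne l [] with rfl | hne
  · have := h.last k (by simp) τ hτ
    simp only [kerInt, norm_one, mul_one]
    refine this.trans ?_
    gcongr
    exact hl rfl
  · calc ‖k τ‖ * ‖kerInt l τ‖ ≤ C / (τ * (1 - τ)) * (N * ratioPow δ τ) :=
        mul_le_mul (h.bound k (by simp) τ hτ) (hN hne) (norm_nonneg _) (by positivity)
      _ = _ := by ring

/-- The last kernel brings in the weight `θ * ratioPow δ`; each integration then costs a factor `C /
δ`. Thus no kernel but the last needs any decay at the starting point. -/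
theorem Tame.main {δ C θ : ℝ} (hδ : 0 < δ) (hC : 0 ≤ C) (l : List (ℝ → ℂ))
    (h : Tame δ C θ l) (hl : l ≠ []) :
    (∀ τ ∈ Ioo (0 : ℝ) 1, KerConverges l τ ∧
      ‖kerInt l τ‖ ≤ (C / δ) ^ l.length * θ * ratioPow δ τ) ∧
      ContinuousOn (kerInt l) (Ioo 0 1) := by
  induction l with
  | nil => exact absurd rfl hl
  | cons k l ih =>
    have ih' := ih h.tail
    have hcl : ContinuousOn (kerInt l) (Ioo 0 1) := by
      rcases eq_or_ne l [] with rfl | hne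
      · exact continuousOn_const
      · exact (ih' hne).2
    have hcv : ∀ τ ∈ Ioo (0 : ℝ) 1, KerConverges l τ := by
      rcases eq_or_ne l [] with rfl | hne
      · exact fun _ _ => trivial
      · exact fun τ hτ => ((ih' hne).1 τ hτ).1
    have hg : ContinuousOn (fun τ => k τ * kerInt l τ) (Ioo 0 1) := (h.cont k (by simp)).mul hcl
    have hb : ∀ τ ∈ Ioo (0 : ℝ) 1, ‖k τ * kerInt l τ‖ ≤
        C * ((C / δ) ^ l.length * θ) * (ratioPow δ τ / (τ * (1 - τ))) := fun τ hτ => by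
      refine h.mul_bound hC hτ (fun hn => ?_) fun hne => ((ih' hne).1 τ hτ).2
      simp [hn]
    refine ⟨fun τ hτ => ?_, fun τ hτ => ?_⟩
    · obtain ⟨h1, h2, -⟩ := intervalIntegral_of_ratioPow_bound hδ hg hb hτ
      refine ⟨⟨fun s hs => hcv s ⟨hs.1, hs.2.trans hτ.2⟩, h1⟩, h2.trans (le_of_eq ?_)⟩
      simp only [List.length_cons, pow_succ]
      field_simp
    · exact (intervalIntegral_of_ratioPow_bound hδ hg hb hτ).2.2.continuousAt.continuousWithinAt

lemma Tame.continuousOn {δ C θ : ℝ} (hδ : 0 < δ) (hC : 0 ≤ C) {l : List (ℝ → ℂ)}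
    (h : Tame δ C θ l) : ContinuousOn (kerInt l) (Ioo 0 1) := by
  rcases eq_or_ne l [] with rfl | hne
  · exact continuousOn_const
  · exact (h.main hδ hC l hne).2

lemma Tame.kerConverges {δ C θ : ℝ} (hδ : 0 < δ) (hC : 0 ≤ C) {l : List (ℝ → ℂ)}
    (h : Tame δ C θ l) {τ : ℝ} (hτ : τ ∈ Ioo (0 : ℝ) 1) : KerConverges l τ := by
  rcases eq_or_ne l [] with rfl | hne
  · exact trivial
  · exact ((h.main hδ hC l hne).1 τ hτ).1

lemma Tame.norm_le {δ C θ : ℝ} (hδ : 0 < δ) (hC : 0 ≤ C) {l : List (ℝ → ℂ)}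
    (h : Tame δ C θ l) (hl : l ≠ []) {τ : ℝ} (hτ : τ ∈ Ioo (0 : ℝ) 1) :
    ‖kerInt l τ‖ ≤ (C / δ) ^ l.length * θ * ratioPow δ τ :=
  ((h.main hδ hC l hl).1 τ hτ).2

lemma Tame.integrand_continuousOn {δ C θ : ℝ} (hδ : 0 < δ) (hC : 0 ≤ C) {k : ℝ → ℂ}
    {l : List (ℝ → ℂ)} (h : Tame δ C θ (k :: l)) :
    ContinuousOn (fun τ => k τ * kerInt l τ) (Ioo 0 1) :=
  (h.cont k (by simp)).mul (h.tail.continuousOn hδ hC)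

lemma Tame.integrand_norm_le {δ C θ : ℝ} (hδ : 0 < δ) (hC : 0 ≤ C) {k : ℝ → ℂ}
    {l : List (ℝ → ℂ)} (h : Tame δ C θ (k :: l)) {τ : ℝ} (hτ : τ ∈ Ioo (0 : ℝ) 1) :
    ‖k τ * kerInt l τ‖ ≤ C * ((C / δ) ^ l.length * θ) * (ratioPow δ τ / (τ * (1 - τ))) :=
  h.mul_bound hC hτ (fun hn => by simp [hn]) fun hne => h.tail.norm_le hδ hC hne hτ

lemma Tame.hasDerivAt {δ C θ : ℝ} (hδ : 0 < δ) (hC : 0 ≤ C) {k : ℝ → ℂ} {l : List (ℝ → ℂ)}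
    (h : Tame δ C θ (k :: l)) {τ : ℝ} (hτ : τ ∈ Ioo (0 : ℝ) 1) :
    HasDerivAt (kerInt (k :: l)) (k τ * kerInt l τ) τ :=
  (intervalIntegral_of_ratioPow_bound hδ (h.integrand_continuousOn hδ hC)
    (fun _ hs => h.integrand_norm_le hδ hC hs) hτ).2.2

lemma Tame.tendsto_zero {δ C θ : ℝ} (hδ : 0 < δ) (hC : 0 ≤ C) {l : List (ℝ → ℂ)}
    (h : Tame δ C θ l) (hl : l ≠ []) : Tendsto (kerInt l) (𝓝[>] 0) (𝓝 0) := by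
  have h0 : Tendsto (fun τ => (C / δ) ^ l.length * θ * ratioPow δ τ) (𝓝[>] 0) (𝓝 0) := by
    simpa using (tendsto_ratioPow_zero hδ).const_mul ((C / δ) ^ l.length * θ)
  refine squeeze_zero_norm' ?_ h0
  filter_upwards [Ioo_mem_nhdsGT (zero_lt_one' ℝ)] with τ hτ using h.norm_le hδ hC hl hτ

/-- A primitive of the integrand that vanishes at `0` is the iterated integral. -/
lemma Tame.kerInt_unique {δ C θ : ℝ} (hδ : 0 < δ) (hC : 0 ≤ C) {k : ℝ → ℂ} {l : List (ℝ → ℂ)}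
    (h : Tame δ C θ (k :: l)) {f : ℝ → ℂ}
    (hf : ∀ τ ∈ Ioo (0 : ℝ) 1, HasDerivAt f (k τ * kerInt l τ) τ)
    (h0 : Tendsto f (𝓝[>] 0) (𝓝 0)) {τ : ℝ} (hτ : τ ∈ Ioo (0 : ℝ) 1) :
    f τ = kerInt (k :: l) τ := by
  have hd : ∀ s ∈ Ioo (0 : ℝ) 1, HasDerivAt (fun s => f s - kerInt (k :: l) s) 0 s := fun s hs => by
    have := (hf s hs).sub (h.hasDerivAt hδ hC hs)
    rwa [sub_self] at this
  have hconst : ∀ s ∈ Ioo (0 : ℝ) 1,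
      f s - kerInt (k :: l) s = f τ - kerInt (k :: l) τ := fun s hs =>
    isOpen_Ioo.is_const_of_deriv_eq_zero isPreconnected_Ioo
      (fun x hx => (hd x hx).differentiableAt.differentiableWithinAt)
      (fun x hx => (hd x hx).deriv) hs hτ
  have hlim : Tendsto (fun s => f s - kerInt (k :: l) s) (𝓝[>] 0) (𝓝 (0 - 0)) :=
    h0.sub (h.tendsto_zero hδ hC (by simp))
  have hlim' : Tendsto (fun s => f s - kerInt (k :: l) s) (𝓝[>] 0)
      (𝓝 (f τ - kerInt (k :: l) τ)) := by
    refine tendsto_const_nhds.congr' ?_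
    filter_upwards [Ioo_mem_nhdsGT (zero_lt_one' ℝ)] with s hs using (hconst s hs).symm
  have := tendsto_nhds_unique hlim' hlim
  rwa [sub_zero, sub_eq_zero] at this

/-! ### Integration up to the end of the interval, and passage to the limit -/

/-- The function `τ ^ (δ - 1) (1 - τ) ^ (δ - 1)`. -/
def betaKer (δ τ : ℝ) : ℝ := τ ^ (δ - 1) * (1 - τ) ^ (δ - 1)

lemma betaKer_nonneg {δ τ : ℝ} (hτ : τ ∈ Ioo (0 : ℝ) 1) : 0 ≤ betaKer δ τ :=
  mul_nonneg (Real.rpow_nonneg hτ.1.le _) (Real.rpow_nonneg (by linarith [hτ.2]) _)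

lemma integrableOn_betaKer {δ : ℝ} (hδ : 0 < δ) : IntegrableOn (betaKer δ) (Ioc 0 1) := by
  have h := Complex.betaIntegral_convergent (u := (δ : ℂ)) (v := (δ : ℂ)) (by simpa) (by simpa)
  rw [intervalIntegrable_iff_integrableOn_Ioc_of_le zero_le_one] at h
  refine IntegrableOn.congr_fun h.norm (fun τ hτ => ?_) measurableSet_Ioc
  have h1 : (0 : ℝ) ≤ 1 - τ := by linarith [hτ.2]
  have e1 : (τ : ℂ) ^ ((δ : ℂ) - 1) = ((τ ^ (δ - 1) : ℝ) : ℂ) := by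
    rw [Complex.ofReal_cpow hτ.1.le]; push_cast; rfl
  have e2 : (1 - (τ : ℂ)) ^ ((δ : ℂ) - 1) = (((1 - τ) ^ (δ - 1) : ℝ) : ℂ) := by
    rw [Complex.ofReal_cpow h1]; push_cast; rfl
  simp only [e1, e2, ← Complex.ofReal_mul, Complex.norm_real, betaKer]
  exact Real.norm_of_nonneg (mul_nonneg (Real.rpow_nonneg hτ.1.le _) (Real.rpow_nonneg h1 _))

lemma intervalIntegrable_betaKer {δ : ℝ} (hδ : 0 < δ) :
    IntervalIntegrable (betaKer δ) volume 0 1 :=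
  (intervalIntegrable_iff_integrableOn_Ioc_of_le zero_le_one).2 (integrableOn_betaKer hδ)

/-- The size condition on the outermost integrand that makes the iterated integral converge on
the whole of `(0, 1)`. -/
def ClosedBound (δ M : ℝ) : List (ℝ → ℂ) → Prop
  | [] => True
  | k :: l => ∀ τ ∈ Ioo (0 : ℝ) 1, ‖k τ * kerInt l τ‖ ≤ M * betaKer δ τ

lemma ae_of_Ioo {p : ℝ → Prop} (h : ∀ τ ∈ Ioo (0 : ℝ) 1, p τ) :
    ∀ᵐ τ ∂volume.restrict (Ioc (0 : ℝ) 1), p τ := by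
  rw [← restrict_Ioo_eq_restrict_Ioc]
  exact (ae_restrict_iff' measurableSet_Ioo).2 (Eventually.of_forall h)

lemma Tame.intervalIntegrable {δ C θ M : ℝ} (hδ : 0 < δ) (hC : 0 ≤ C) {k : ℝ → ℂ}
    {l : List (ℝ → ℂ)} (h : Tame δ C θ (k :: l)) (hM : ClosedBound δ M (k :: l)) :
    IntervalIntegrable (fun τ => k τ * kerInt l τ) volume 0 1 := by
  rw [intervalIntegrable_iff_integrableOn_Ioc_of_le zero_le_one]
  exact ((integrableOn_betaKer hδ).const_mul M).mono'
    (aestronglyMeasurable_of_continuousOn_Ioo (h.integrand_continuousOn hδ hC) le_rfl)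
    (ae_of_Ioo hM)

lemma Tame.kerConverges_one {δ C θ M : ℝ} (hδ : 0 < δ) (hC : 0 ≤ C) {l : List (ℝ → ℂ)}
    (h : Tame δ C θ l) (hM : ClosedBound δ M l) : KerConverges l 1 := by
  cases l with
  | nil => trivial
  | cons k l => exact ⟨fun s hs => h.tail.kerConverges hδ hC hs, h.intervalIntegrable hδ hC hM⟩

lemma norm_kerInt_one_le {δ M : ℝ} (hδ : 0 < δ) {k : ℝ → ℂ} {l : List (ℝ → ℂ)}
    (hM : ClosedBound δ M (k :: l)) :
    ‖kerInt (k :: l) 1‖ ≤ M * ∫ τ in (0 : ℝ)..1, betaKer δ τ := by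
  rw [← intervalIntegral.integral_const_mul]
  exact intervalIntegral.norm_integral_le_of_norm_le zero_le_one
    ((ae_restrict_iff' measurableSet_Ioc).1 (ae_of_Ioo hM))
    ((intervalIntegrable_betaKer hδ).const_mul M)

lemma Tame.tendsto_one {δ C θ M : ℝ} (hδ : 0 < δ) (hC : 0 ≤ C) {k : ℝ → ℂ}
    {l : List (ℝ → ℂ)} (h : Tame δ C θ (k :: l)) (hM : ClosedBound δ M (k :: l)) :
    Tendsto (kerInt (k :: l)) (𝓝[<] 1) (𝓝 (kerInt (k :: l) 1)) := by
  have hi := (intervalIntegrable_iff_integrableOn_Icc_of_le zero_le_one).1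
    (h.intervalIntegrable hδ hC hM)
  have hc : ContinuousOn (kerInt (k :: l)) (Icc 0 1) := by
    have := intervalIntegral.continuousOn_primitive_interval (a := (0 : ℝ)) (b := 1)
      (f := fun τ => k τ * kerInt l τ) (μ := volume) (by rwa [uIcc_of_le zero_le_one])
    rwa [uIcc_of_le zero_le_one] at this
  have := hc 1 ⟨zero_le_one, le_rfl⟩
  refine Tendsto.mono_left this ?_
  rw [← nhdsWithin_Ioo_eq_nhdsLT (zero_lt_one' ℝ)]
  exact nhdsWithin_mono _ Ioo_subset_Icc_self

/-- Dominated convergence for iterated integrals at an interior parameter. -/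
lemma tendsto_kerInt {ι : Type*} {F : Filter ι} [F.IsCountablyGenerated] {δ C θ : ℝ}
    (hδ : 0 < δ) (hC : 0 ≤ C) {α : Type*} (w : List α) (κ : ι → α → ℝ → ℂ) (κ₀ : α → ℝ → ℂ)
    (ht : ∀ᶠ i in F, Tame δ C θ (w.map (κ i)))
    (hlim : ∀ s ∈ w, ∀ τ ∈ Ioo (0 : ℝ) 1, Tendsto (fun i => κ i s τ) F (𝓝 (κ₀ s τ)))
    {τ : ℝ} (hτ : τ ∈ Ioo (0 : ℝ) 1) :
    Tendsto (fun i => kerInt (w.map (κ i)) τ) F (𝓝 (kerInt (w.map κ₀) τ)) := by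
  induction w generalizing τ with
  | nil => exact tendsto_const_nhds
  | cons s w ih =>
    have ih' : ∀ {t : ℝ}, t ∈ Ioo (0 : ℝ) 1 → _ :=
      @ih (ht.mono fun i hi => hi.tail) fun s' hs' => hlim s' (by simp [hs'])
    simp only [List.map_cons, kerInt] at ht ⊢
    refine intervalIntegral.tendsto_integral_filter_of_dominated_convergence
      (fun τ => C * ((C / δ) ^ w.length * θ) * (ratioPow δ τ / (τ * (1 - τ)))) ?_ ?_ ?_ ?_
    · filter_upwards [ht] with i hi
      rw [uIoc_of_le hτ.1.le]
      exact aestronglyMeasurable_of_continuousOn_Ioo (hi.integrand_continuousOn hδ hC) hτ.2.le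
    · filter_upwards [ht] with i hi
      refine Eventually.of_forall fun s hs => ?_
      rw [uIoc_of_le hτ.1.le] at hs
      simpa using hi.integrand_norm_le hδ hC (τ := s) ⟨hs.1, hs.2.trans_lt hτ.2⟩
    · rw [intervalIntegrable_iff_integrableOn_Ioc_of_le hτ.1.le]
      exact (integrableOn_ratioPow hδ hτ).1.const_mul _
    · refine Eventually.of_forall fun t htt => ?_
      rw [uIoc_of_le hτ.1.le] at htt
      have h1 : t ∈ Ioo (0 : ℝ) 1 := ⟨htt.1, htt.2.trans_lt hτ.2⟩
      exact (hlim s (by simp) t h1).mul (ih' h1)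

/-- Dominated convergence for iterated integrals on the whole of `(0, 1)`. -/
lemma tendsto_kerInt_one {ι : Type*} {F : Filter ι} [F.IsCountablyGenerated] {δ C θ M : ℝ}
    (hδ : 0 < δ) (hC : 0 ≤ C) {α : Type*} (w : List α) (κ : ι → α → ℝ → ℂ) (κ₀ : α → ℝ → ℂ)
    (ht : ∀ᶠ i in F, Tame δ C θ (w.map (κ i)))
    (hM : ∀ᶠ i in F, ClosedBound δ M (w.map (κ i)))
    (hlim : ∀ s ∈ w, ∀ τ ∈ Ioo (0 : ℝ) 1, Tendsto (fun i => κ i s τ) F (𝓝 (κ₀ s τ))) :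
    Tendsto (fun i => kerInt (w.map (κ i)) 1) F (𝓝 (kerInt (w.map κ₀) 1)) := by
  cases w with
  | nil => exact tendsto_const_nhds
  | cons s w =>
    simp only [List.map_cons, kerInt] at ht hM ⊢
    refine intervalIntegral.tendsto_integral_filter_of_dominated_convergence
      (fun τ => M * betaKer δ τ) ?_ ?_ ((intervalIntegrable_betaKer hδ).const_mul _) ?_
    · filter_upwards [ht] with i hi
      rw [uIoc_of_le zero_le_one]
      exact aestronglyMeasurable_of_continuousOn_Ioo (hi.integrand_continuousOn hδ hC) le_rfl
    · filter_upwards [hM] with i hi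
      rw [uIoc_of_le zero_le_one]
      exact (ae_restrict_iff' measurableSet_Ioc).1 (ae_of_Ioo hi)
    · rw [uIoc_of_le zero_le_one, ← ae_restrict_iff' measurableSet_Ioc]
      refine ae_of_Ioo fun τ hτ => ?_
      exact (hlim s (by simp) τ hτ).mul (tendsto_kerInt hδ hC w κ κ₀
        (ht.mono fun i hi => hi.tail) (fun s' hs' => hlim s' (by simp [hs'])) hτ)

/-! ### Holomorphic dependence on parameters -/

/-- A directional derivative is a pointwise limit of a sequence of difference quotients, and each of
these is measurable. -/
lemma aestronglyMeasurable_fderiv_apply {U : Set (ℂ × ℂ)} (hU : IsOpen U) {μ : Measure ℝ}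
    {F : ℂ × ℂ → ℝ → ℂ} (hm : ∀ q ∈ U, AEStronglyMeasurable (F q) μ)
    (hF : ∀ᵐ τ ∂μ, DifferentiableOn ℂ (F · τ) U) {q : ℂ × ℂ} (hq : q ∈ U) (v : ℂ × ℂ) :
    AEStronglyMeasurable (fun τ => fderiv ℂ (F · τ) q v) μ := by
  obtain ⟨r, hr, hrU⟩ := Metric.isOpen_iff.1 hU q hq
  -- Scaled so that the increment `(c n)⁻¹ • v` has length less than `r` already for `n = 0`; the `+
  -- 1` covers `v = 0`.
  set c : ℕ → ℂ := fun n => (((n : ℝ) + 1) * ((‖v‖ + 1) / r) : ℝ) with hc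
  have hv : 0 < (‖v‖ + 1) / r := by positivity
  have hcpos : ∀ n : ℕ, 0 < ((n : ℝ) + 1) * ((‖v‖ + 1) / r) := fun n => by positivity
  have hcn : ∀ n, ‖c n‖ = ((n : ℝ) + 1) * ((‖v‖ + 1) / r) := fun n => by
    simp only [hc]; rw [Complex.norm_real, Real.norm_of_nonneg (hcpos n).le]
  have hmem : ∀ n, q + (c n)⁻¹ • v ∈ U := fun n => hrU <| by
    rw [mem_ball_iff_norm, add_sub_cancel_left, norm_smul, norm_inv, hcn, inv_mul_lt_iff₀ (hcpos n)]
    have h1 : ‖v‖ < ‖v‖ + 1 := by linarith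
    have h2 : ‖v‖ + 1 ≤ ((n : ℝ) + 1) * (‖v‖ + 1) := by
      nlinarith [norm_nonneg v, (Nat.cast_nonneg n : (0 : ℝ) ≤ n)]
    calc ‖v‖ < ((n : ℝ) + 1) * (‖v‖ + 1) := h1.trans_le h2
      _ = _ := by field_simp
  refine aestronglyMeasurable_of_tendsto_ae atTop
    (f := fun n τ => c n • (F (q + (c n)⁻¹ • v) τ - F q τ)) (fun n => ?_) ?_
  · exact ((hm _ (hmem n)).sub (hm q hq)).const_smul (c n)
  · filter_upwards [hF] with τ hτ
    have hd := ((hτ q hq).differentiableAt (hU.mem_nhds hq)).hasFDerivAt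
    refine hd.lim v ?_
    simp only [hcn]
    exact (tendsto_atTop_add_const_right _ _ tendsto_natCast_atTop_atTop).atTop_mul_const hv

/-- For holomorphic integrands a local integrable bound on the function suffices, since it controls
the Lipschitz constants as well; no bound on the derivative has to be supplied. -/
lemma differentiableOn_intervalIntegral {U : Set (ℂ × ℂ)} (hU : IsOpen U)
    {F : ℂ × ℂ → ℝ → ℂ} {t : ℝ} (ht : 0 ≤ t)
    (hF : ∀ τ ∈ Ioo 0 t, DifferentiableOn ℂ (F · τ) U)
    (hc : ∀ q ∈ U, ContinuousOn (F q) (Ioo 0 t))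
    (hb : ∀ q₀ ∈ U, ∃ V ∈ 𝓝 q₀, ∃ b : ℝ → ℝ, IntegrableOn b (Ioc 0 t) ∧
      ∀ q ∈ V, ∀ τ ∈ Ioo 0 t, ‖F q τ‖ ≤ b τ) :
    DifferentiableOn ℂ (fun q => ∫ τ in (0 : ℝ)..t, F q τ) U := by
  intro q hq
  obtain ⟨V, hV, b, hbi, hbV⟩ := hb q hq
  obtain ⟨r, hr, hrU⟩ := Metric.mem_nhds_iff.1 (inter_mem hV (hU.mem_nhds hq))
  have hqr := Metric.mem_ball_self (x := q) hr
  simp only [intervalIntegral.integral_of_le ht, integral_Ioc_eq_integral_Ioo]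
  have hmem : ∀ᵐ τ ∂volume.restrict (Ioo 0 t), τ ∈ Ioo 0 t := ae_restrict_mem measurableSet_Ioo
  have hm : ∀ q ∈ U, AEStronglyMeasurable (F q) (volume.restrict (Ioo 0 t)) := fun q hq =>
    (hc q hq).aestronglyMeasurable measurableSet_Ioo
  have hdU : ∀ᵐ τ ∂volume.restrict (Ioo 0 t), DifferentiableOn ℂ (F · τ) U := hmem.mono hF
  have hbi' : IntegrableOn b (Ioo 0 t) := hbi.mono_set Ioo_subset_Ioc_self
  refine (hasFDerivAt_integral_of_dominated_loc_of_lip' (bound := fun τ => 2 * b τ / r)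
    (F' := fun τ => fderiv ℂ (F · τ) q) (Metric.ball_mem_nhds q hr)
    (fun x hx => hm x (hrU hx).2) ?_ ?_ ?_ ?_ ?_).2.differentiableAt.differentiableWithinAt
  · exact hbi'.mono' (hm q hq) (hmem.mono fun τ hτ => hbV q (hrU hqr).1 τ hτ)
  · have h1 := aestronglyMeasurable_fderiv_apply hU hm hdU hq (1, 0)
    have h2 := aestronglyMeasurable_fderiv_apply hU hm hdU hq (0, 1)
    have : (fun τ => fderiv ℂ (F · τ) q) = fun τ =>
        (fderiv ℂ (F · τ) q (1, 0)) • ContinuousLinearMap.fst ℂ ℂ ℂ +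
        (fderiv ℂ (F · τ) q (0, 1)) • ContinuousLinearMap.snd ℂ ℂ ℂ := by
      funext τ
      ext <;> simp
    rw [this]
    exact (h1.smul_const _).add (h2.smul_const _)
  · filter_upwards [hmem] with τ hτ x hx
    -- Schwarz lemma: the ball of radius `r` is mapped into the ball of radius `2 * b τ` around the
    -- value at its centre.
    have := Complex.dist_le_div_mul_dist_of_mapsTo_ball (f := (F · τ)) (c := q) (R₁ := r)
      (R₂ := 2 * b τ) ((hF τ hτ).mono fun y hy => (hrU hy).2) (fun y hy => ?_) hx
    · simpa [dist_eq_norm] using this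
    · rw [mem_closedBall_iff_norm]
      calc ‖F y τ - F q τ‖ ≤ ‖F y τ‖ + ‖F q τ‖ := norm_sub_le _ _
        _ ≤ b τ + b τ := add_le_add (hbV y (hrU hy).1 τ hτ) (hbV q (hrU hqr).1 τ hτ)
        _ = 2 * b τ := by ring
  · simpa [div_eq_mul_inv] using (hbi'.const_mul 2).mul_const r⁻¹
  · filter_upwards [hdU] with τ hτ
    exact ((hτ q hq).differentiableAt (hU.mem_nhds hq)).hasFDerivAt

/-- Iterated integrals of kernels depending holomorphically on parameters are holomorphic. -/
lemma differentiableOn_kerInt {δ : ℝ} (hδ : 0 < δ) {U : Set (ℂ × ℂ)} (hU : IsOpen U) {α : Type*}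
    (w : List α) (κ : ℂ × ℂ → α → ℝ → ℂ)
    (hd : ∀ s ∈ w, ∀ τ ∈ Ioo (0 : ℝ) 1, DifferentiableOn ℂ (fun q => κ q s τ) U)
    (ht : ∀ q₀ ∈ U, ∃ V ∈ 𝓝 q₀, ∃ C θ : ℝ, 0 ≤ C ∧ ∀ q ∈ V, Tame δ C θ (w.map (κ q)))
    {τ : ℝ} (hτ : τ ∈ Ioo (0 : ℝ) 1) :
    DifferentiableOn ℂ (fun q => kerInt (w.map (κ q)) τ) U := by
  induction w generalizing τ with
  | nil => exact differentiableOn_const _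
  | cons s w ih =>
    have ih' : ∀ {t : ℝ}, t ∈ Ioo (0 : ℝ) 1 → _ :=
      @ih (fun s' hs' => hd s' (by simp [hs'])) fun q₀ hq₀ => by
        obtain ⟨V, hV, C, θ, hC, h⟩ := ht q₀ hq₀
        exact ⟨V, hV, C, θ, hC, fun q hq => (h q hq).tail⟩
    have hsub : ∀ x ∈ Ioo 0 τ, x ∈ Ioo (0 : ℝ) 1 := fun x hx => ⟨hx.1, hx.2.trans hτ.2⟩
    refine differentiableOn_intervalIntegral hU hτ.1.le
      (fun x hx => (hd s (by simp) x (hsub x hx)).mul (ih' (hsub x hx))) (fun q hq => ?_) ?_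
    · obtain ⟨V, hV, C, θ, hC, h⟩ := ht q hq
      exact ((h q (mem_of_mem_nhds hV)).integrand_continuousOn hδ hC).mono hsub
    · intro q hq
      obtain ⟨V, hV, C, θ, hC, h⟩ := ht q hq
      refine ⟨V, hV, _, (integrableOn_ratioPow hδ hτ).1.const_mul (C * ((C / δ) ^ w.length * θ)),
        fun q' hq' x hx => ?_⟩
      simpa using (h q' hq').integrand_norm_le hδ hC (hsub x hx)

lemma differentiableOn_kerInt_one {δ : ℝ} (hδ : 0 < δ) {U : Set (ℂ × ℂ)} (hU : IsOpen U)
    {α : Type*} (w : List α) (κ : ℂ × ℂ → α → ℝ → ℂ)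
    (hd : ∀ s ∈ w, ∀ τ ∈ Ioo (0 : ℝ) 1, DifferentiableOn ℂ (fun q => κ q s τ) U)
    (ht : ∀ q₀ ∈ U, ∃ V ∈ 𝓝 q₀, ∃ C θ M : ℝ, 0 ≤ C ∧ ∀ q ∈ V, Tame δ C θ (w.map (κ q)) ∧
      ClosedBound δ M (w.map (κ q))) :
    DifferentiableOn ℂ (fun q => kerInt (w.map (κ q)) 1) U := by
  cases w with
  | nil => exact differentiableOn_const _
  | cons s w =>
    refine differentiableOn_intervalIntegral hU zero_le_one
      (fun x hx => (hd s (by simp) x hx).mul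
        (differentiableOn_kerInt hδ hU w κ (fun s' hs' => hd s' (by simp [hs'])) ?_ hx))
      (fun q hq => ?_) ?_
    · intro q hq
      obtain ⟨V, hV, C, θ, M, hC, h⟩ := ht q hq
      exact ⟨V, hV, C, θ, hC, fun q hq => (h q hq).1.tail⟩
    · obtain ⟨V, hV, C, θ, M, hC, h⟩ := ht q hq
      exact (h q (mem_of_mem_nhds hV)).1.integrand_continuousOn hδ hC
    · intro q hq
      obtain ⟨V, hV, C, θ, M, hC, h⟩ := ht q hq
      exact ⟨V, hV, _, (integrableOn_betaKer hδ).const_mul M, fun q' hq' x hx => (h q' hq').2 x hx⟩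

/-! ### Reparametrisation -/

/-- The Möbius reparametrisation of the unit interval that divides `τ / (1 - τ)` by `ρ`. -/
def mobius (ρ t : ℝ) : ℝ := t / (t + ρ * (1 - t))

/-- The kernel `k` in the parameter `t` with `τ = mobius ρ t`. -/
def reparam (ρ : ℝ) (k : ℝ → ℂ) : ℝ → ℂ :=
  fun t => k (mobius ρ t) * ((ρ / (t + ρ * (1 - t)) ^ 2 : ℝ) : ℂ)

lemma mobius_den_pos {ρ t : ℝ} (hρ : 0 < ρ) (ht : t ∈ Ioo (0 : ℝ) 1) : 0 < t + ρ * (1 - t) :=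
  add_pos ht.1 (mul_pos hρ (by linarith [ht.2]))

lemma one_sub_mobius {ρ t : ℝ} (hρ : 0 < ρ) (ht : t ∈ Ioo (0 : ℝ) 1) :
    1 - mobius ρ t = ρ * (1 - t) / (t + ρ * (1 - t)) := by
  have := mobius_den_pos hρ ht
  rw [mobius]; field_simp; ring

lemma mobius_mem {ρ t : ℝ} (hρ : 0 < ρ) (ht : t ∈ Ioo (0 : ℝ) 1) : mobius ρ t ∈ Ioo (0 : ℝ) 1 := by
  have hp := mobius_den_pos hρ ht
  have h1 : 0 < 1 - mobius ρ t := by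
    rw [one_sub_mobius hρ ht]
    exact div_pos (mul_pos hρ (by linarith [ht.2])) hp
  exact ⟨div_pos ht.1 hp, by linarith⟩

lemma mobius_deriv_eq {ρ t : ℝ} (hρ : 0 < ρ) (ht : t ∈ Ioo (0 : ℝ) 1) :
    ρ / (t + ρ * (1 - t)) ^ 2 = mobius ρ t * (1 - mobius ρ t) / (t * (1 - t)) := by
  have hp := mobius_den_pos hρ ht
  have h0 := ht.1
  have h1 : 0 < 1 - t := by linarith [ht.2]
  rw [one_sub_mobius hρ ht, mobius]; field_simp

lemma hasDerivAt_mobius {ρ t : ℝ} (hρ : 0 < ρ) (ht : t ∈ Ioo (0 : ℝ) 1) :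
    HasDerivAt (mobius ρ) (ρ / (t + ρ * (1 - t)) ^ 2) t := by
  have hp := mobius_den_pos hρ ht
  have hd : HasDerivAt (fun t : ℝ => t + ρ * (1 - t)) (1 + ρ * (-1)) t :=
    (hasDerivAt_id t).add (((hasDerivAt_id t).const_sub 1).const_mul ρ)
  refine ((hasDerivAt_id t).div hd hp.ne').congr_deriv ?_
  simp only [id]
  congr 1; ring

lemma ratioPow_mobius {δ ρ t : ℝ} (hρ : 0 < ρ) (ht : t ∈ Ioo (0 : ℝ) 1) :
    ratioPow δ (mobius ρ t) = ρ ^ (-δ) * ratioPow δ t := by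
  have hp := mobius_den_pos hρ ht
  have h1 : 0 < 1 - t := by linarith [ht.2]
  have h0 := ht.1
  have : mobius ρ t / (1 - mobius ρ t) = ρ⁻¹ * (t / (1 - t)) := by
    rw [one_sub_mobius hρ ht, mobius]; field_simp
  rw [ratioPow, this, Real.mul_rpow (by positivity) (by positivity), Real.inv_rpow hρ.le,
    ← Real.rpow_neg hρ.le, ratioPow]

lemma continuousOn_reparam {ρ : ℝ} (hρ : 0 < ρ) {k : ℝ → ℂ} (hk : ContinuousOn k (Ioo 0 1)) :
    ContinuousOn (reparam ρ k) (Ioo 0 1) := by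
  refine ContinuousOn.mul (hk.comp (fun t ht => ?_) fun t ht => mobius_mem hρ ht) ?_
  · exact (hasDerivAt_mobius hρ ht).continuousAt.continuousWithinAt
  · refine Complex.continuous_ofReal.comp_continuousOn ?_
    refine ContinuousOn.div (by fun_prop) (by fun_prop) fun t ht => ?_
    exact (pow_pos (mobius_den_pos hρ ht) 2).ne'

lemma norm_reparam {ρ t : ℝ} (hρ : 0 < ρ) (ht : t ∈ Ioo (0 : ℝ) 1) (k : ℝ → ℂ) :
    ‖reparam ρ k t‖ =
      ‖k (mobius ρ t)‖ * (mobius ρ t * (1 - mobius ρ t)) / (t * (1 - t)) := by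
  have hp := mobius_den_pos hρ ht
  rw [reparam, norm_mul, Complex.norm_real, Real.norm_of_nonneg (by positivity),
    mobius_deriv_eq hρ ht]
  ring

lemma norm_reparam_le {ρ t B : ℝ} (hρ : 0 < ρ) (ht : t ∈ Ioo (0 : ℝ) 1) {k : ℝ → ℂ}
    (h : ‖k (mobius ρ t)‖ ≤ B / (mobius ρ t * (1 - mobius ρ t))) :
    ‖reparam ρ k t‖ ≤ B / (t * (1 - t)) := by
  have hm := mobius_mem hρ ht
  have hpos : 0 < mobius ρ t * (1 - mobius ρ t) := mul_pos hm.1 (by linarith [hm.2])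
  have h1 : 0 < t * (1 - t) := mul_pos ht.1 (by linarith [ht.2])
  rw [norm_reparam hρ ht]
  gcongr
  rwa [le_div_iff₀ hpos] at h

/-- The form `dτ / (τ (1 - τ))` is invariant under these Möbius maps, so `C` is unchanged; the
weight only picks up `ρ ^ (-δ)`, which goes into `θ`. -/
lemma Tame.reparam {δ C θ ρ : ℝ} (hρ : 0 < ρ) {l : List (ℝ → ℂ)} (h : Tame δ C θ l) :
    Tame δ C (θ * ρ ^ (-δ)) (l.map (reparam ρ)) where
  cont k hk := by
    obtain ⟨k, hk', rfl⟩ := List.mem_map.1 hk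
    exact continuousOn_reparam hρ (h.cont k hk')
  bound k hk t ht := by
    obtain ⟨k, hk', rfl⟩ := List.mem_map.1 hk
    exact norm_reparam_le hρ ht (h.bound k hk' _ (mobius_mem hρ ht))
  last k hk t ht := by
    rw [List.getLast?_map] at hk
    obtain ⟨k, hk', rfl⟩ := Option.mem_map.1 hk
    have := h.last k hk' _ (mobius_mem hρ ht)
    rw [← mul_div_assoc] at this
    refine (norm_reparam_le hρ ht this).trans (le_of_eq ?_)
    rw [ratioPow_mobius hρ ht]
    ring

lemma kerInt_reparam {δ C θ ρ : ℝ} (hδ : 0 < δ) (hC : 0 ≤ C) (hρ : 0 < ρ) {l : List (ℝ → ℂ)}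
    (h : Tame δ C θ l) {t : ℝ} (ht : t ∈ Ioo (0 : ℝ) 1) :
    kerInt (l.map (reparam ρ)) t = kerInt l (mobius ρ t) := by
  induction l generalizing t with
  | nil => rfl
  | cons k l ih =>
    refine ((h.reparam hρ).kerInt_unique (f := fun t => kerInt (k :: l) (mobius ρ t)) hδ hC
      (fun s hs => ?_) ?_ ht).symm
    · have h1 := (h.hasDerivAt hδ hC (mobius_mem hρ hs)).scomp s (hasDerivAt_mobius hρ hs)
      refine h1.congr_deriv ?_
      rw [ih h.tail hs, reparam, Complex.real_smul]
      ring
    · refine (h.tendsto_zero hδ hC (by simp)).comp (tendsto_nhdsWithin_iff.2 ⟨?_, ?_⟩)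
      · have : ContinuousAt (mobius ρ) 0 := by
          unfold mobius
          refine ContinuousAt.div (by fun_prop) (by fun_prop) (by simpa using hρ.ne')
        have h0 : mobius ρ 0 = 0 := by simp [mobius]
        rw [ContinuousAt, h0] at this
        exact this.mono_left nhdsWithin_le_nhds
      · filter_upwards [Ioo_mem_nhdsGT (zero_lt_one' ℝ)] with s hs using (mobius_mem hρ hs).1

lemma kerInt_reparam_one {δ C θ ρ M M' : ℝ} (hδ : 0 < δ) (hC : 0 ≤ C) (hρ : 0 < ρ)
    {l : List (ℝ → ℂ)} (h : Tame δ C θ l) (hM : ClosedBound δ M l)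
    (hM' : ClosedBound δ M' (l.map (reparam ρ))) :
    kerInt (l.map (reparam ρ)) 1 = kerInt l 1 := by
  cases l with
  | nil => rfl
  | cons k l =>
    have h1 := (h.reparam hρ).tendsto_one hδ hC hM'
    have h2 : Tendsto (fun t => kerInt (k :: l) (mobius ρ t)) (𝓝[<] 1)
        (𝓝 (kerInt (k :: l) 1)) := by
      refine (h.tendsto_one hδ hC hM).comp (tendsto_nhdsWithin_iff.2 ⟨?_, ?_⟩)
      · have : ContinuousAt (mobius ρ) 1 := by
          unfold mobius
          refine ContinuousAt.div (by fun_prop) (by fun_prop) (by simp)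
        have h0 : mobius ρ 1 = 1 := by simp [mobius]
        rw [ContinuousAt, h0] at this
        exact this.mono_left nhdsWithin_le_nhds
      · filter_upwards [Ioo_mem_nhdsLT (zero_lt_one' ℝ)] with s hs using (mobius_mem hρ hs).2
    refine tendsto_nhds_unique h1 (h2.congr' ?_)
    filter_upwards [Ioo_mem_nhdsLT (zero_lt_one' ℝ)] with s hs
      using (kerInt_reparam hδ hC hρ h hs).symm

/-! ### Kernel estimates along paths -/

/-- The origin of the exponent `2 * δ` at the upper end: one `δ` pays for the growth of the weight
at `1`, the other one makes the product integrable there. -/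
lemma ratioPow_mul_rpow {δ τ : ℝ} (hτ : τ ∈ Ioo (0 : ℝ) 1) :
    ratioPow δ τ * ((1 - τ) ^ (2 * δ) / (τ * (1 - τ))) = betaKer δ τ := by
  have h0 := hτ.1
  have h1 : 0 < 1 - τ := by linarith [hτ.2]
  have h2 : (1 - τ) ^ (2 * δ) = (1 - τ) ^ δ * (1 - τ) ^ δ := by
    rw [← Real.rpow_add h1]; ring_nf
  have h3 : (1 - τ) ^ δ ≠ 0 := (Real.rpow_pos_of_pos h1 _).ne'
  rw [ratioPow, betaKer, Real.rpow_sub_one h0.ne', Real.rpow_sub_one h1.ne',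
    Real.div_rpow h0.le h1.le, h2]
  field_simp

lemma rpow_le_ratioPow {δ τ : ℝ} (hδ : 0 < δ) (hτ : τ ∈ Ioo (0 : ℝ) 1) : τ ^ δ ≤ ratioPow δ τ := by
  have h1 : 0 < 1 - τ := by linarith [hτ.2]
  refine Real.rpow_le_rpow hτ.1.le ?_ hδ.le
  rw [le_div_iff₀ h1]
  nlinarith [hτ.1]

/-- A one-letter word is listed separately because its only kernel has to be integrable at both ends
by itself. -/
lemma closedBound_cons {δ C θ B M : ℝ} (hδ : 0 < δ) (hC : 0 ≤ C) {k : ℝ → ℂ} {l : List (ℝ → ℂ)}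
    (h : Tame δ C θ (k :: l)) (hB : 0 ≤ B)
    (hh : ∀ τ ∈ Ioo (0 : ℝ) 1, ‖k τ‖ ≤ B * ((1 - τ) ^ (2 * δ) / (τ * (1 - τ))))
    (hs : l = [] → ∀ τ ∈ Ioo (0 : ℝ) 1, ‖k τ‖ ≤ M * betaKer δ τ)
    (hM : B * ((C / δ) ^ l.length * θ) ≤ M) : ClosedBound δ M (k :: l) := by
  intro τ hτ
  rw [norm_mul]
  rcases eq_or_ne l [] with rfl | hne
  · simpa [kerInt] using hs rfl τ hτ
  · have h1 := h.tail.norm_le hδ hC hne hτ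
    have h0 : 0 < τ * (1 - τ) := mul_pos hτ.1 (by linarith [hτ.2])
    have h2 : 0 ≤ (1 - τ) ^ (2 * δ) := Real.rpow_nonneg (by linarith [hτ.2]) _
    calc ‖k τ‖ * ‖kerInt l τ‖ ≤ (B * ((1 - τ) ^ (2 * δ) / (τ * (1 - τ)))) *
          ((C / δ) ^ l.length * θ * ratioPow δ τ) :=
        mul_le_mul (hh τ hτ) h1 (norm_nonneg _) (by positivity)
      _ = B * ((C / δ) ^ l.length * θ) * betaKer δ τ := by rw [← ratioPow_mul_rpow hτ]; ring
      _ ≤ M * betaKer δ τ := by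
        gcongr
        exact betaKer_nonneg hτ

lemma le_rpow_mul_rpow {m x y α β : ℝ} (h0 : 0 ≤ m) (h1 : m ≤ 1) (hx : m ≤ x) (hy : m ≤ y)
    (hα : 0 ≤ α) (hβ : 0 ≤ β) (hαβ : α + β ≤ 1) : m ≤ x ^ α * y ^ β := by
  rcases h0.eq_or_lt with rfl | hm
  · exact mul_nonneg (Real.rpow_nonneg hx _) (Real.rpow_nonneg hy _)
  calc m = m ^ (1 : ℝ) := (Real.rpow_one m).symm
    _ ≤ m ^ (α + β) := Real.rpow_le_rpow_of_exponent_ge hm h1 hαβ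
    _ = m ^ α * m ^ β := Real.rpow_add hm _ _
    _ ≤ x ^ α * y ^ β := by
      have := hm.le.trans hx
      gcongr

/-! ### Bounds for the kernels in terms of the distances of the letters from the ends of the path -/

/-- A path from `a` to `b` whose speed is controlled by the distance of its end points. -/
structure IsGoodPath (a b : ℂ) (γ : ℝ → ℂ) : Prop where
  diff : ∀ τ ∈ Ioo (0 : ℝ) 1, DifferentiableAt ℝ γ τ
  cont : ContinuousOn (deriv γ) (Ioo 0 1)
  speed : ∀ τ ∈ Ioo (0 : ℝ) 1, ‖deriv γ τ‖ ≤ 3 * ‖b - a‖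
  start : ∀ τ ∈ Ioo (0 : ℝ) 1, ‖γ τ - a‖ ≤ 3 * ‖b - a‖ * τ
  finish : ∀ τ ∈ Ioo (0 : ℝ) 1, ‖γ τ - b‖ ≤ 3 * ‖b - a‖ * (1 - τ)

/-- The path `γ` from `a` to `b` keeps a distance from the point `s`. -/
def Avoids (c : ℝ) (a b : ℂ) (γ : ℝ → ℂ) (s : ℂ) : Prop :=
  ∀ τ ∈ Ioo (0 : ℝ) 1, c * ‖b - a‖ * (τ * (1 - τ)) ≤ ‖γ τ - s‖

lemma norm_omega (s t : ℂ) : ‖omega s t‖ = (2 * Real.pi)⁻¹ * ‖t - s‖⁻¹ := by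
  simp [omega, abs_of_pos Real.pi_pos]

lemma norm_omega_le (s t : ℂ) : ‖omega s t‖ ≤ (1 / 6) * ‖t - s‖⁻¹ := by
  rw [norm_omega]
  gcongr
  rw [inv_le_comm₀ (by positivity) (by norm_num)]
  linarith [Real.pi_gt_three]

/-- The quotient `ρ / ‖γ τ - s‖` that controls the kernel of `s`, bounded in terms of the
distances of `s` from both ends of the path. -/
lemma Avoids.quot_le {c : ℝ} {a b s : ℂ} {γ : ℝ → ℂ} (hc : 0 < c) (hc1 : c ≤ 1)
    (hγ : IsGoodPath a b γ) (hs : Avoids c a b γ s) {d₁ d₂ α β : ℝ} (hd₁ : 0 < d₁)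
    (hd₂ : 0 < d₂) (h₁ : α ≠ 0 → d₁ ≤ ‖a - s‖) (h₂ : β ≠ 0 → d₂ ≤ ‖b - s‖)
    (hα : 0 ≤ α) (hβ : 0 ≤ β)
    (hαβ : α + β ≤ 1) {τ : ℝ} (hτ : τ ∈ Ioo (0 : ℝ) 1) :
    ‖b - a‖ * ‖γ τ - s‖⁻¹ ≤ 4 / c * ((‖b - a‖ * τ / d₁) ^ α * (‖b - a‖ * (1 - τ) / d₂) ^ β /
      (τ * (1 - τ))) := by
  have h0 := hτ.1
  have h1 : 0 < 1 - τ := by linarith [hτ.2]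
  have hpos : 0 < τ * (1 - τ) := mul_pos h0 h1
  set ρ := ‖b - a‖ with hρ
  have hρ0 : 0 ≤ ρ := norm_nonneg _
  rcases hρ0.eq_or_lt with hz | hρpos
  · rw [← hz]; simp only [zero_mul]; positivity
  set N := ‖γ τ - s‖ with hN
  have hNle : c * ρ * (τ * (1 - τ)) ≤ N := hs τ hτ
  have hNpos : 0 < N := lt_of_lt_of_le (by positivity) hNle
  have key : ρ * (τ * (1 - τ)) ≤ N / c := by
    rw [le_div_iff₀ hc]; linarith
  have hNc : N ≤ N / c := by rw [le_div_iff₀ hc]; nlinarith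
  -- With this normalisation `m` is at most `1`, at most `ρ * τ / d₁` and at most `ρ * (1 - τ) /
  -- d₂`; the claim is the geometric interpolation between the three bounds.
  set m := c / 4 * (ρ * N⁻¹ * (τ * (1 - τ))) with hm
  have hm0 : 0 ≤ m := by positivity
  have hm1 : m ≤ 1 := by
    have : ρ * N⁻¹ * (τ * (1 - τ)) ≤ 1 / c := by
      rw [show ρ * N⁻¹ * (τ * (1 - τ)) = (ρ * (τ * (1 - τ))) / N by ring, div_le_iff₀ hNpos]
      calc _ ≤ N / c := key
        _ = 1 / c * N := by ring
    calc m ≤ c / 4 * (1 / c) := mul_le_mul_of_nonneg_left this (by positivity)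
      _ = 1 / 4 := by field_simp
      _ ≤ 1 := by norm_num
  have hma : α ≠ 0 → m ≤ ρ * τ / d₁ := fun hα => by
    have t1 : d₁ ≤ N + 3 * ρ * τ := by
      calc d₁ ≤ ‖a - s‖ := h₁ hα
        _ = ‖(γ τ - s) - (γ τ - a)‖ := by congr 1; ring
        _ ≤ N + ‖γ τ - a‖ := norm_sub_le _ _
        _ ≤ _ := by gcongr; exact hγ.start τ hτ
    have t2 : d₁ * (1 - τ) ≤ 4 * (N / c) := by
      have : d₁ * (1 - τ) ≤ (N + 3 * ρ * τ) * (1 - τ) := by gcongr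
      nlinarith
    rw [le_div_iff₀ hd₁]
    calc m * d₁ = c / 4 * (ρ * N⁻¹ * τ) * (d₁ * (1 - τ)) := by rw [hm]; ring
      _ ≤ c / 4 * (ρ * N⁻¹ * τ) * (4 * (N / c)) := by gcongr
      _ = ρ * τ := by field_simp
  have hmb : β ≠ 0 → m ≤ ρ * (1 - τ) / d₂ := fun hβ => by
    have t1 : d₂ ≤ N + 3 * ρ * (1 - τ) := by
      calc d₂ ≤ ‖b - s‖ := h₂ hβ
        _ = ‖(γ τ - s) - (γ τ - b)‖ := by congr 1; ring
        _ ≤ N + ‖γ τ - b‖ := norm_sub_le _ _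
        _ ≤ _ := by gcongr; exact hγ.finish τ hτ
    have t2 : d₂ * τ ≤ 4 * (N / c) := by
      have : d₂ * τ ≤ (N + 3 * ρ * (1 - τ)) * τ := by gcongr
      nlinarith
    rw [le_div_iff₀ hd₂]
    calc m * d₂ = c / 4 * (ρ * N⁻¹ * (1 - τ)) * (d₂ * τ) := by rw [hm]; ring
      _ ≤ c / 4 * (ρ * N⁻¹ * (1 - τ)) * (4 * (N / c)) := by gcongr
      _ = ρ * (1 - τ) := by field_simp
  have hfin : m ≤ (ρ * τ / d₁) ^ α * (ρ * (1 - τ) / d₂) ^ β := by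
    rcases eq_or_ne α 0 with rfl | hα'
    · rcases eq_or_ne β 0 with rfl | hβ'
      · simpa using hm1
      · have := le_rpow_mul_rpow hm0 hm1 hm1 (hmb hβ') hα hβ hαβ
        simpa using this
    · rcases eq_or_ne β 0 with rfl | hβ'
      · have := le_rpow_mul_rpow hm0 hm1 (hma hα') hm1 hα hβ hαβ
        simpa using this
      · exact le_rpow_mul_rpow hm0 hm1 (hma hα') (hmb hβ') hα hβ hαβ
  calc ρ * N⁻¹ = 4 / c * (m / (τ * (1 - τ))) := by rw [hm]; field_simp
    _ ≤ _ := by gcongr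

/-- The factor `1 / (2π) ≤ 1 / 6` of the form absorbs the factor `3` in the speed of the path. -/
lemma Avoids.norm_pull_le {a b s : ℂ} {γ : ℝ → ℂ} (hγ : IsGoodPath a b γ) {τ : ℝ}
    (hτ : τ ∈ Ioo (0 : ℝ) 1) : ‖pull γ (omega s) τ‖ ≤ ‖b - a‖ * ‖γ τ - s‖⁻¹ := by
  rw [pull, norm_mul]
  calc ‖omega s (γ τ)‖ * ‖deriv γ τ‖ ≤ (1 / 6 * ‖γ τ - s‖⁻¹) * (3 * ‖b - a‖) :=
        mul_le_mul (norm_omega_le _ _) (hγ.speed τ hτ) (norm_nonneg _) (by positivity)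
    _ = 1 / 2 * (‖b - a‖ * ‖γ τ - s‖⁻¹) := by ring
    _ ≤ _ := by
      have : 0 ≤ ‖b - a‖ * ‖γ τ - s‖⁻¹ := by positivity
      linarith

lemma Avoids.continuousOn_pull {c : ℝ} {a b s : ℂ} {γ : ℝ → ℂ} (hc : 0 < c)
    (hγ : IsGoodPath a b γ) (hs : Avoids c a b γ s) :
    ContinuousOn (pull γ (omega s)) (Ioo 0 1) := by
  rcases eq_or_ne (‖b - a‖) 0 with hz | hne
  · refine (continuousOn_const (c := (0 : ℂ))).congr fun τ hτ => ?_
    have := hγ.speed τ hτ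
    rw [hz, mul_zero, norm_le_zero_iff] at this
    simp [pull, this]
  have hpos : 0 < ‖b - a‖ := lt_of_le_of_ne (norm_nonneg _) hne.symm
  refine ContinuousOn.mul ?_ hγ.cont
  have hcγ : ContinuousOn γ (Ioo 0 1) :=
    fun τ hτ => (hγ.diff τ hτ).continuousAt.continuousWithinAt
  refine ContinuousOn.mul continuousOn_const ((hcγ.sub continuousOn_const).inv₀ fun τ hτ => ?_)
  have h1 : 0 < 1 - τ := by linarith [hτ.2]
  have h0 := hτ.1
  exact norm_pos_iff.1 (lt_of_lt_of_le (by positivity) (hs τ hτ))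

/-- The kernels of the letters of a word along a path. -/
def wordKer (γ : ℝ → ℂ) (l : List ℂ) : List (ℝ → ℂ) := l.map fun s => pull γ (omega s)

/-- A general letter is estimated with exponents `(0, 0)` in `Avoids.quot_le`, the last one with
`(δ, 0)`: its distance `d₁` from the starting point is what produces the weight and `θ`. -/
lemma tame_wordKer {c δ d₁ : ℝ} {a b : ℂ} {γ : ℝ → ℂ} {l : List ℂ} (hδ : 0 < δ) (hδ1 : δ ≤ 1)
    (hc : 0 < c) (hc1 : c ≤ 1) (hγ : IsGoodPath a b γ) (hl : ∀ s ∈ l, Avoids c a b γ s)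
    (hd₁ : 0 < d₁) (h₁ : ∀ s ∈ l.getLast?, d₁ ≤ ‖a - s‖) :
    Tame δ (4 / c) ((‖b - a‖ / d₁) ^ δ) (wordKer γ l) where
  cont k hk := by
    obtain ⟨s, hs, rfl⟩ := List.mem_map.1 hk
    exact (hl s hs).continuousOn_pull hc hγ
  bound k hk τ hτ := by
    obtain ⟨s, hs, rfl⟩ := List.mem_map.1 hk
    have := (hl s hs).quot_le hc hc1 hγ one_pos one_pos (α := 0) (β := 0) (by simp) (by simp)
      le_rfl le_rfl (by simp) hτ
    simp only [Real.rpow_zero, mul_one] at this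
    exact (Avoids.norm_pull_le hγ hτ).trans (this.trans_eq (by ring))
  last k hk τ hτ := by
    rw [wordKer, List.getLast?_map] at hk
    obtain ⟨s, hs, rfl⟩ := Option.mem_map.1 hk
    have h0 := hτ.1
    have hpos : 0 < 1 - τ := by linarith [hτ.2]
    have hsl : s ∈ l := List.mem_of_mem_getLast? hs
    have := (hl s hsl).quot_le hc hc1 hγ hd₁ one_pos (α := δ) (β := 0) (fun _ => h₁ s hs) (by simp)
      hδ.le le_rfl (by simpa) hτ
    refine (Avoids.norm_pull_le hγ hτ).trans (this.trans ?_)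
    rw [Real.rpow_zero, mul_one, show ‖b - a‖ * τ / d₁ = ‖b - a‖ / d₁ * τ by ring,
      Real.mul_rpow (by positivity) h0.le]
    have hr := rpow_le_ratioPow hδ hτ
    have h00 : 0 < τ * (1 - τ) := mul_pos h0 hpos
    calc 4 / c * ((‖b - a‖ / d₁) ^ δ * τ ^ δ / (τ * (1 - τ)))
        = 4 / c * (‖b - a‖ / d₁) ^ δ * (τ ^ δ / (τ * (1 - τ))) := by ring
      _ ≤ _ := by gcongr

/-- The first letter is estimated with exponents `(0, 2 * δ)`, and with `(δ, 2 * δ)` if it is also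
the last; the interpolation needs exponents of sum at most one, whence `3 * δ ≤ 1`. -/
lemma closedBound_wordKer {c δ d₁ d₂ : ℝ} {a b : ℂ} {γ : ℝ → ℂ} {s : ℂ} {l : List ℂ} (hδ : 0 < δ)
    (hδ1 : 3 * δ ≤ 1) (hc : 0 < c) (hc1 : c ≤ 1) (hγ : IsGoodPath a b γ)
    (hl : ∀ s' ∈ s :: l, Avoids c a b γ s') (hd₁ : 0 < d₁)
    (h₁ : ∀ s' ∈ (s :: l).getLast?, d₁ ≤ ‖a - s'‖) (hd₂ : 0 < d₂) (h₂ : d₂ ≤ ‖b - s‖) :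
    ClosedBound δ (4 / c * (4 / c / δ) ^ l.length *
      ((‖b - a‖ / d₁) ^ δ * (‖b - a‖ / d₂) ^ (2 * δ))) (wordKer γ (s :: l)) := by
  have ht := tame_wordKer (δ := δ) hδ (by linarith) hc hc1 hγ hl hd₁ h₁
  have hs := hl s (by simp)
  refine closedBound_cons (B := 4 / c * (‖b - a‖ / d₂) ^ (2 * δ)) hδ (by positivity) ht
    (by positivity) (fun τ hτ => ?_) (fun hn τ hτ => ?_) (le_of_eq ?_)
  · have hpos : 0 < 1 - τ := by linarith [hτ.2]
    have := hs.quot_le hc hc1 hγ one_pos hd₂ (α := 0) (β := 2 * δ) (by simp) (fun _ => h₂)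
      le_rfl (by positivity) (by linarith) hτ
    refine (Avoids.norm_pull_le hγ hτ).trans (this.trans (le_of_eq ?_))
    rw [Real.rpow_zero, one_mul, show ‖b - a‖ * (1 - τ) / d₂ = ‖b - a‖ / d₂ * (1 - τ) by ring,
      Real.mul_rpow (by positivity) hpos.le]
    ring
  · have h0 := hτ.1
    have hpos : 0 < 1 - τ := by linarith [hτ.2]
    have hl0 : l = [] := by simpa using hn
    subst hl0
    have := hs.quot_le hc hc1 hγ hd₁ hd₂ (α := δ) (β := 2 * δ) (fun _ => h₁ s (by simp))
      (fun _ => h₂) hδ.le (by positivity) (by linarith) hτ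
    refine (Avoids.norm_pull_le hγ hτ).trans (this.trans ?_)
    rw [show ‖b - a‖ * (1 - τ) / d₂ = ‖b - a‖ / d₂ * (1 - τ) by ring,
      show ‖b - a‖ * τ / d₁ = ‖b - a‖ / d₁ * τ by ring,
      Real.mul_rpow (by positivity) hpos.le, Real.mul_rpow (by positivity) h0.le,
      ← ratioPow_mul_rpow hτ]
    simp only [List.length_nil, pow_zero, mul_one]
    have hr := rpow_le_ratioPow hδ hτ
    have h00 : 0 < τ * (1 - τ) := mul_pos h0 hpos
    calc 4 / c * ((‖b - a‖ / d₁) ^ δ * τ ^ δ * ((‖b - a‖ / d₂) ^ (2 * δ) * (1 - τ) ^ (2 * δ)) /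
          (τ * (1 - τ))) = 4 / c * ((‖b - a‖ / d₁) ^ δ * (‖b - a‖ / d₂) ^ (2 * δ)) *
          (τ ^ δ * ((1 - τ) ^ (2 * δ) / (τ * (1 - τ)))) := by ring
      _ ≤ _ := by gcongr
  · have : (List.map (fun s => pull γ (omega s)) l).length = l.length := by simp
    rw [this]
    ring

lemma Tame.mono {δ C θ θ' : ℝ} (hC : 0 ≤ C) {l : List (ℝ → ℂ)} (h : Tame δ C θ l) (hθ : θ ≤ θ') :
    Tame δ C θ' l where
  cont := h.cont
  bound := h.bound
  last k hk τ hτ := by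
    have h0 : 0 < τ * (1 - τ) := mul_pos hτ.1 (by linarith [hτ.2])
    have hr := ratioPow_nonneg (δ := δ) hτ
    refine (h.last k hk τ hτ).trans ?_
    gcongr

lemma ClosedBound.mono {δ M M' : ℝ} {l : List (ℝ → ℂ)} (h : ClosedBound δ M l) (hM : M ≤ M') :
    ClosedBound δ M' l := by
  cases l with
  | nil => trivial
  | cons k l =>
    intro τ hτ
    exact (h τ hτ).trans (mul_le_mul_of_nonneg_right hM (betaKer_nonneg hτ))

/-! ### A family of paths -/

/-- A family of paths from `a` to `b` that contains the straight segment. -/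
def pth (a b : ℂ) (lam mu : ℝ) : ℝ → ℂ := fun τ =>
  a + (((1 - lam) * τ + lam * τ ^ 2 : ℝ) : ℂ) * (b - a) - I * ((mu * ‖b - a‖ * (τ * (1 - τ)) : ℝ) : ℂ)

lemma path_eq_pth (a b : ℂ) : path a b = pth a b 0 1 := by
  funext τ
  simp only [path, pth]
  push_cast
  ring

lemma hasDerivAt_pth (a b : ℂ) (lam mu τ : ℝ) :
    HasDerivAt (pth a b lam mu) (((1 - lam + 2 * lam * τ : ℝ) : ℂ) * (b - a) -
      I * ((mu * ‖b - a‖ * (1 - 2 * τ) : ℝ) : ℂ)) τ := by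
  have h1 : HasDerivAt (fun τ : ℝ => (1 - lam) * τ + lam * τ ^ 2) (1 - lam + 2 * lam * τ) τ := by
    have := ((hasDerivAt_id τ).const_mul (1 - lam)).add (((hasDerivAt_id τ).pow 2).const_mul lam)
    refine this.congr_deriv ?_
    simp; ring
  have h2 : HasDerivAt (fun τ : ℝ => mu * ‖b - a‖ * (τ * (1 - τ)))
      (mu * ‖b - a‖ * (1 - 2 * τ)) τ := by
    have := ((hasDerivAt_id τ).mul ((hasDerivAt_id τ).const_sub 1)).const_mul (mu * ‖b - a‖)
    refine this.congr_deriv ?_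
    simp only [id]; ring
  exact ((h1.ofReal_comp.mul_const (b - a)).const_add a).sub (h2.ofReal_comp.const_mul I)

lemma deriv_pth (a b : ℂ) (lam mu τ : ℝ) :
    deriv (pth a b lam mu) τ = ((1 - lam + 2 * lam * τ : ℝ) : ℂ) * (b - a) -
      I * ((mu * ‖b - a‖ * (1 - 2 * τ) : ℝ) : ℂ) := (hasDerivAt_pth a b lam mu τ).deriv

lemma norm_mul_sub_le {x y A B ρ : ℝ} {v : ℂ} (hv : ‖v‖ = ρ) (hx : |x| ≤ A) (hy : |y| ≤ B) :
    ‖(x : ℂ) * v - I * (y : ℂ)‖ ≤ A * ρ + B := by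
  refine (norm_sub_le _ _).trans (add_le_add ?_ ?_)
  · rw [norm_mul, hv, Complex.norm_real, Real.norm_eq_abs]
    exact mul_le_mul_of_nonneg_right hx (hv ▸ norm_nonneg _)
  · simpa using hy

lemma isGoodPath_pth (a b : ℂ) {lam mu : ℝ} (hl : lam ∈ Icc (0 : ℝ) 1) (hm : mu ∈ Icc (0 : ℝ) 1) :
    IsGoodPath a b (pth a b lam mu) := by
  have hρ := norm_nonneg (b - a)
  obtain ⟨hl0, hl1⟩ := hl
  obtain ⟨hm0, hm1⟩ := hm
  refine ⟨fun τ _ => (hasDerivAt_pth a b lam mu τ).differentiableAt, ?_, ?_, ?_, ?_⟩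
  · have : deriv (pth a b lam mu) = _ := funext (deriv_pth a b lam mu)
    rw [this]
    fun_prop
  · intro τ hτ
    obtain ⟨h0, h1⟩ := hτ
    rw [deriv_pth]
    refine (norm_mul_sub_le (A := 2) (B := ‖b - a‖) rfl ?_ ?_).trans (by linarith)
    · rw [abs_le]; constructor <;> nlinarith
    · rw [abs_mul, abs_of_nonneg (by positivity)]
      have : |1 - 2 * τ| ≤ 1 := by rw [abs_le]; constructor <;> linarith
      calc mu * ‖b - a‖ * |1 - 2 * τ| ≤ 1 * ‖b - a‖ * 1 := by gcongr
        _ = _ := by ring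
  · intro τ hτ
    obtain ⟨h0, h1⟩ := hτ
    rw [show pth a b lam mu τ - a = (((1 - lam) * τ + lam * τ ^ 2 : ℝ) : ℂ) * (b - a) -
      I * ((mu * ‖b - a‖ * (τ * (1 - τ)) : ℝ) : ℂ) by rw [pth]; ring]
    have h2 : 0 ≤ τ * (1 - τ) := mul_nonneg h0.le (by linarith)
    refine (norm_mul_sub_le (A := τ) (B := ‖b - a‖ * τ) rfl ?_ ?_).trans ?_
    · rw [abs_of_nonneg (by nlinarith)]; nlinarith
    · rw [abs_of_nonneg (by positivity)]
      calc mu * ‖b - a‖ * (τ * (1 - τ)) ≤ 1 * ‖b - a‖ * (τ * 1) := by gcongr; linarith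
        _ = _ := by ring
    · nlinarith
  · intro τ hτ
    obtain ⟨h0, h1⟩ := hτ
    rw [show pth a b lam mu τ - b = ((-((1 - τ) * (1 + lam * τ)) : ℝ) : ℂ) * (b - a) -
      I * ((mu * ‖b - a‖ * (τ * (1 - τ)) : ℝ) : ℂ) by rw [pth]; push_cast; ring]
    have h3 : 0 ≤ 1 - τ := by linarith
    have h4 : lam * τ ≤ 1 := by nlinarith
    refine (norm_mul_sub_le (A := (1 - τ) * 2) (B := ‖b - a‖ * (1 - τ)) rfl ?_ ?_).trans ?_
    · rw [abs_neg, abs_of_nonneg (by positivity)]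
      gcongr; linarith
    · rw [abs_of_nonneg (by positivity)]
      calc mu * ‖b - a‖ * (τ * (1 - τ)) ≤ 1 * ‖b - a‖ * (1 * (1 - τ)) := by gcongr
        _ = _ := by ring
    · nlinarith

/-! ### Iterated integrals along straight segments -/

/-- The iterated integral of the word `l` along the straight segment from `a` to `t`. -/
def segInt (a : ℂ) (l : List ℂ) (t : ℂ) : ℂ := kerInt (wordKer (pth a t 0 0) l) 1

lemma pth_seg (a t : ℂ) (τ : ℝ) : pth a t 0 0 τ = a + τ * (t - a) := by simp [pth]

lemma pull_seg (a t s : ℂ) (τ : ℝ) :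
    pull (pth a t 0 0) (omega s) τ = omega s (a + τ * (t - a)) * (t - a) := by
  rw [pull, pth_seg, deriv_pth]; simp

/-- By homothety, moving the end point along a ray from `a` is the same as stopping earlier on one
fixed segment. -/
lemma kerInt_seg_scale (a t : ℂ) (l : List ℂ) (σ τ : ℝ) :
    kerInt (wordKer (pth a (a + σ * (t - a)) 0 0) l) τ =
      kerInt (wordKer (pth a t 0 0) l) (σ * τ) := by
  induction l generalizing τ with
  | nil => rfl
  | cons s l ih =>
    simp only [wordKer, List.map_cons, kerInt] at ih ⊢
    have := intervalIntegral.smul_integral_comp_mul_left (a := 0) (b := τ)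
      (fun x : ℝ => pull (pth a t 0 0) (omega s) x *
        kerInt (l.map fun s => pull (pth a t 0 0) (omega s)) x) σ
    rw [mul_zero] at this
    rw [← this, ← intervalIntegral.integral_smul]
    refine intervalIntegral.integral_congr fun x _ => ?_
    simp only [ih, pull_seg, Complex.real_smul]
    push_cast
    rw [show a + (x : ℂ) * (a + σ * (t - a) - a) = a + σ * x * (t - a) by ring]
    ring

/-- The segment is prolonged beyond `t` by the factor `1 + e`, so that `t` sits at an interior
parameter, where the fundamental theorem of calculus gives the radial derivative. Complex
differentiability being known, the radial derivative determines the complex one. -/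
lemma hasDerivAt_segInt {δ C θ e : ℝ} {a s t : ℂ} {l : List ℂ} (hδ : 0 < δ) (hC : 0 ≤ C)
    (he : 0 < e) (hd : DifferentiableAt ℂ (segInt a (s :: l)) t) (hta : t ≠ a)
    (ht : Tame δ C θ (wordKer (pth a (a + (1 + e : ℝ) * (t - a)) 0 0) (s :: l))) :
    HasDerivAt (segInt a (s :: l)) (omega s t * segInt a l t) t := by
  set t₁ := a + (1 + e : ℝ) * (t - a) with ht₁
  set σ : ℝ := (1 + e)⁻¹ with hσ
  have hσ0 : 0 < σ := by positivity
  have hσ1 : σ < 1 := inv_lt_one_of_one_lt₀ (by linarith)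
  have hσe : (σ : ℂ) * (1 + e : ℝ) = 1 := by
    rw [hσ, ← Complex.ofReal_mul, inv_mul_cancel₀ (by positivity), Complex.ofReal_one]
  have htσ : a + σ * (t₁ - a) = t := by
    rw [ht₁, add_sub_cancel_left, ← mul_assoc, hσe]; ring
  have hlin : HasDerivAt (fun x : ℝ => a + (x : ℂ) * (t₁ - a)) (t₁ - a) σ := by
    simpa using ((hasDerivAt_id σ).ofReal_comp.mul_const (t₁ - a)).const_add a
  have h1 : HasDerivAt (segInt a (s :: l) ∘ fun x : ℝ => a + (x : ℂ) * (t₁ - a))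
      ((t₁ - a) • deriv (segInt a (s :: l)) t) σ := by
    refine HasDerivAt.scomp σ ?_ hlin
    rw [htσ]; exact hd.hasDerivAt
  have hE : ∀ (l : List ℂ) (x : ℝ), segInt a l (a + (x : ℂ) * (t₁ - a)) =
      kerInt (wordKer (pth a t₁ 0 0) l) x := fun l x => by
    rw [segInt, kerInt_seg_scale, mul_one]
  have h2 : HasDerivAt (kerInt (wordKer (pth a t₁ 0 0) (s :: l)))
      (pull (pth a t₁ 0 0) (omega s) σ * kerInt (wordKer (pth a t₁ 0 0) l) σ) σ :=
    ht.hasDerivAt hδ hC ⟨hσ0, hσ1⟩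
  rw [show segInt a (s :: l) ∘ (fun x : ℝ => a + (x : ℂ) * (t₁ - a)) =
    kerInt (wordKer (pth a t₁ 0 0) (s :: l)) from funext fun x => hE _ x] at h1
  have h3 := h1.unique h2
  rw [pull_seg, ← hE, htσ, smul_eq_mul] at h3
  have hne : t₁ - a ≠ 0 := by
    rw [ht₁, add_sub_cancel_left]
    exact mul_ne_zero (by exact_mod_cast (by positivity : (1 + e) ≠ 0)) (sub_ne_zero.2 hta)
  have h4 : deriv (segInt a (s :: l)) t = omega s t * segInt a l t :=
    mul_left_cancel₀ hne (h3.trans (by ring))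
  rw [← h4]
  exact hd.hasDerivAt

/-- Iterated integrals along segments are holomorphic in the end point and in the letters. -/
lemma differentiableOn_segInt {δ : ℝ} (hδ : 0 < δ) (hδ1 : 3 * δ ≤ 1) {U : Set (ℂ × ℂ)}
    (hU : IsOpen U) (a : ℂ) (w : List (ℂ × ℂ → ℂ)) (e : ℂ × ℂ → ℂ)
    (he : DifferentiableOn ℂ e U) (hw : ∀ s ∈ w, DifferentiableOn ℂ s U)
    (hea : ∀ q ∈ U, ∀ s ∈ w, ∀ τ ∈ Ioo (0 : ℝ) 1, a + τ * (e q - a) ≠ s q)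
    (hloc : ∀ q₀ ∈ U, ∃ V ∈ 𝓝 q₀, ∃ c d₁ d₂ : ℝ, 0 < c ∧ c ≤ 1 ∧ 0 < d₁ ∧ 0 < d₂ ∧
      ∀ q ∈ V, (∀ s ∈ w, Avoids c a (e q) (pth a (e q) 0 0) (s q)) ∧
        (∀ s ∈ w.getLast?, d₁ ≤ ‖a - s q‖) ∧ ∀ s ∈ w.head?, d₂ ≤ ‖e q - s q‖) :
    DifferentiableOn ℂ (fun q => segInt a (w.map fun s => s q) (e q)) U := by
  have hmap : ∀ q, wordKer (pth a (e q) 0 0) (w.map fun s => s q) =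
      w.map fun s => pull (pth a (e q) 0 0) (omega (s q)) := fun q => by
    simp [wordKer, Function.comp_def]
  simp only [segInt, hmap]
  have good : ∀ b, IsGoodPath a b (pth a b 0 0) := fun b => isGoodPath_pth a b (by simp) (by simp)
  refine differentiableOn_kerInt_one hδ hU w
    (fun q s => pull (pth a (e q) 0 0) (omega (s q))) ?_ ?_
  · intro s hs τ hτ q hq
    have hne : a + τ * (e q - a) - s q ≠ 0 := sub_ne_zero.2 (hea q hq s hs τ hτ)
    simp only [pull_seg, omega]
    have h1 := he q hq
    have h2 := hw s hs q hq
    exact ((((((h1.sub_const a).const_mul _).const_add a).sub h2).inv hne).const_mul _).mul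
      (h1.sub_const a)
  · intro q₀ hq₀
    obtain ⟨V, hV, c, d₁, d₂, hc, hc1, hd₁, hd₂, h⟩ := hloc q₀ hq₀
    have hcont : ContinuousAt (fun q => ‖e q - a‖) q₀ :=
      ((he.continuousOn.continuousAt (hU.mem_nhds hq₀)).sub continuousAt_const).norm
    set R := ‖e q₀ - a‖ + 1
    have hR : ∀ᶠ q in 𝓝 q₀, ‖e q - a‖ ≤ R :=
      (hcont.eventually (gt_mem_nhds (lt_add_one ‖e q₀ - a‖))).mono fun q hq => hq.le
    refine ⟨_, inter_mem hV hR, 4 / c, (R / d₁) ^ δ, 4 / c * (4 / c / δ) ^ w.tail.length *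
      ((R / d₁) ^ δ * (R / d₂) ^ (2 * δ)), by positivity, fun q hq => ⟨?_, ?_⟩⟩
    · rw [← hmap]
      have hq2 : ‖e q - a‖ ≤ R := hq.2
      refine (tame_wordKer hδ (by linarith) hc hc1 (good _) (fun s hs => ?_) hd₁
        (fun s hs => ?_)).mono (by positivity) (by gcongr)
      · obtain ⟨s, hs', rfl⟩ := List.mem_map.1 hs
        exact (h q hq.1).1 s hs'
      · rw [List.getLast?_map] at hs
        obtain ⟨s, hs', rfl⟩ := Option.mem_map.1 hs
        exact (h q hq.1).2.1 s hs'
    · rw [← hmap]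
      cases w with
      | nil => trivial
      | cons s₀ w =>
        have hq2 : ‖e q - a‖ ≤ R := hq.2
        refine (closedBound_wordKer (l := w.map fun s => s q) hδ hδ1 hc hc1 (good _)
          (fun s hs => ?_) hd₁ (fun s hs => ?_) hd₂ ?_).mono ?_
        · rw [← List.map_cons (f := fun s : ℂ × ℂ → ℂ => s q)] at hs
          obtain ⟨s, hs', rfl⟩ := List.mem_map.1 hs
          exact (h q hq.1).1 s hs'
        · rw [← List.map_cons (f := fun s : ℂ × ℂ → ℂ => s q), List.getLast?_map] at hs
          obtain ⟨s, hs', rfl⟩ := Option.mem_map.1 hs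
          exact (h q hq.1).2.1 s hs'
        · exact (h q hq.1).2.2 s₀ (by simp)
        · simp only [List.length_map, List.tail_cons]
          gcongr

/-! ### Path independence in convex sets -/

/-- The homothety with centre `a` and ratio `σ` maps the ball around `t` into `Ω`, because `Ω` is
convex and `a` lies in its closure. Hence a ball of radius `σ * r` around the point of the segment
misses `s`. -/
lemma seg_dist_le {Ω : Set ℂ} (hΩ : Convex ℝ Ω) {a t s : ℂ} (ha : a ∈ closure Ω) {r σ : ℝ}
    (hr : Metric.ball t r ⊆ Ω) (hs : s ∉ Ω) (hσ : σ ∈ Ioo (0 : ℝ) 1) :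
    σ * r ≤ ‖pth a t 0 0 σ - s‖ := by
  by_contra hlt
  push Not at hlt
  rw [pth_seg] at hlt
  have hσc : (σ : ℂ) ≠ 0 := by exact_mod_cast hσ.1.ne'
  -- The point such that `s` lies on the segment from `a` to `t'` at the parameter `σ`.
  set t' := t + (σ : ℂ)⁻¹ * (s - (a + σ * (t - a))) with ht'
  have hmem : t' ∈ interior Ω := by
    refine interior_mono hr ?_
    rw [Metric.isOpen_ball.interior_eq, mem_ball_iff_norm, ht', add_sub_cancel_left, norm_mul,
      norm_inv, Complex.norm_real, Real.norm_of_nonneg hσ.1.le, inv_mul_lt_iff₀ hσ.1,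
      norm_sub_rev]
    exact hlt
  have := hΩ.combo_closure_interior_mem_interior ha hmem
    (a := 1 - σ) (b := σ) (by linarith [hσ.2]) hσ.1 (by ring)
  refine hs (interior_subset ?_)
  convert this using 1
  rw [ht', Complex.real_smul, Complex.real_smul]
  push_cast
  field_simp
  ring

lemma avoids_seg {Ω : Set ℂ} (hΩ : Convex ℝ Ω) {a t s : ℂ} (ha : a ∈ closure Ω) {r c : ℝ}
    (hr0 : 0 ≤ r) (hr : Metric.ball t r ⊆ Ω) (hs : s ∉ Ω) (hc : c * ‖t - a‖ ≤ r) :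
    Avoids c a t (pth a t 0 0) s := fun σ hσ => by
  have h1 : 0 < 1 - σ := by linarith [hσ.2]
  have h0 := hσ.1
  calc c * ‖t - a‖ * (σ * (1 - σ)) ≤ r * (σ * (1 - σ)) := by gcongr
    _ ≤ r * (σ * 1) := by gcongr; linarith
    _ = σ * r := by ring
    _ ≤ _ := seg_dist_le hΩ ha hr hs hσ

lemma dist_le_of_ball {Ω : Set ℂ} {t s : ℂ} {r : ℝ} (hr : Metric.ball t r ⊆ Ω) (hs : s ∉ Ω) :
    r ≤ ‖t - s‖ := by
  by_contra h
  push Not at h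
  exact hs (hr (by rwa [mem_ball_iff_norm, norm_sub_rev]))

lemma exists_last_dist (a : ℂ) (l : List ℂ) (h : ∀ s ∈ l.getLast?, s ≠ a) :
    ∃ d : ℝ, 0 < d ∧ ∀ s ∈ l.getLast?, d ≤ ‖a - s‖ := by
  cases hl : l.getLast? with
  | none => exact ⟨1, one_pos, by simp⟩
  | some s =>
    refine ⟨‖a - s‖, norm_pos_iff.2 (sub_ne_zero.2 (h s (by simp [hl])).symm), ?_⟩
    simp

lemma differentiableOn_segInt_of_convex {Ω : Set ℂ} (hΩ : Convex ℝ Ω) (hΩo : IsOpen Ω) {a s : ℂ}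
    {l : List ℂ} (ha : a ∈ closure Ω) (hl : ∀ s' ∈ s :: l, s' ∉ Ω)
    (hlast : ∀ s' ∈ (s :: l).getLast?, s' ≠ a) :
    DifferentiableOn ℂ (segInt a (s :: l)) Ω := by
  obtain ⟨d₁, hd₁, hd⟩ := exists_last_dist a (s :: l) hlast
  -- Only the end point varies here; the first coordinate of the parameter space is a dummy.
  set U : Set (ℂ × ℂ) := Prod.snd ⁻¹' Ω with hU
  have hUo : IsOpen U := hΩo.preimage continuous_snd
  have hdiff : DifferentiableOn ℂ (fun q : ℂ × ℂ => segInt a (s :: l) q.2) U := by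
    have := differentiableOn_segInt (δ := 1 / 4) (by norm_num) (by norm_num) hUo a
      ((s :: l).map fun s => fun _ : ℂ × ℂ => s) Prod.snd differentiableOn_snd ?_
      (fun q hq f hf τ hτ => ?_) ?_
    · simpa [Function.comp_def] using this
    · intro f hf
      obtain ⟨s', -, rfl⟩ := List.mem_map.1 hf
      exact differentiableOn_const _
    · obtain ⟨s', hs', rfl⟩ := List.mem_map.1 hf
      obtain ⟨r, hr, hrΩ⟩ := Metric.isOpen_iff.1 hΩo q.2 hq
      have := seg_dist_le hΩ ha hrΩ (hl s' hs') hτ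
      rw [pth_seg] at this
      exact sub_ne_zero.1 (norm_pos_iff.1 (lt_of_lt_of_le (mul_pos hτ.1 hr) this))
    · intro q hq
      obtain ⟨r, hr, hrΩ⟩ := Metric.isOpen_iff.1 hΩo q.2 hq
      set R := ‖q.2 - a‖ + r
      have hR : 0 < R := by positivity
      have hball : ∀ t' ∈ Metric.ball q.2 (r / 2), Metric.ball t' (r / 2) ⊆ Ω := fun t' ht' x hx => by
        refine hrΩ ?_
        have := dist_triangle x t' q.2
        rw [Metric.mem_ball] at *
        linarith
      refine ⟨Prod.snd ⁻¹' Metric.ball q.2 (r / 2), continuous_snd.continuousAt.preimage_mem_nhds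
        (Metric.ball_mem_nhds _ (by positivity)), min 1 (r / 2 / R), d₁, r / 2, by positivity,
        min_le_left _ _, hd₁, by positivity, fun q' hq' => ⟨?_, ?_, ?_⟩⟩
      · intro f hf
        obtain ⟨s', hs', rfl⟩ := List.mem_map.1 hf
        refine avoids_seg hΩ ha (r := r / 2) (by positivity) (hball _ hq') (hl s' hs') ?_
        have h1 : ‖q'.2 - a‖ ≤ R := by
          have h2 : ‖q'.2 - q.2‖ < r / 2 := by simpa [dist_eq_norm] using hq'
          calc ‖q'.2 - a‖ = ‖(q.2 - a) + (q'.2 - q.2)‖ := by congr 1; ring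
            _ ≤ ‖q.2 - a‖ + ‖q'.2 - q.2‖ := norm_add_le _ _
            _ ≤ R := by simp only [R]; linarith
        calc min 1 (r / 2 / R) * ‖q'.2 - a‖ ≤ r / 2 / R * R := by
              gcongr
              exact min_le_right _ _
          _ = r / 2 := by field_simp
      · intro f hf
        rw [List.getLast?_map] at hf
        obtain ⟨s', hs', rfl⟩ := Option.mem_map.1 hf
        exact hd s' hs'
      · intro f hf
        simp only [List.map_cons, List.head?_cons, Option.mem_some_iff] at hf
        subst hf
        exact dist_le_of_ball (hball _ hq') (hl s (by simp))
  intro t ht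
  have h1 := (hdiff (0, t) ht).differentiableAt (hUo.mem_nhds ht)
  exact (h1.comp t ((differentiableAt_const (0 : ℂ)).prodMk differentiableAt_id)
    ).differentiableWithinAt

lemma hasDerivAt_segInt_of_ne {Ω : Set ℂ} (hΩ : Convex ℝ Ω) (hΩo : IsOpen Ω) {a s t : ℂ}
    {l : List ℂ} (ha : a ∈ closure Ω) (ht : t ∈ Ω) (hta : t ≠ a) (hl : ∀ s' ∈ s :: l, s' ∉ Ω)
    (hlast : ∀ s' ∈ (s :: l).getLast?, s' ≠ a) :
    HasDerivAt (segInt a (s :: l)) (omega s t * segInt a l t) t := by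
  obtain ⟨d₁, hd₁, hd⟩ := exists_last_dist a (s :: l) hlast
  have good : ∀ b, IsGoodPath a b (pth a b 0 0) := fun b => isGoodPath_pth a b (by simp) (by simp)
  have hdt := (differentiableOn_segInt_of_convex hΩ hΩo ha hl hlast).differentiableAt
    (hΩo.mem_nhds ht)
  obtain ⟨e, he, hmem⟩ : ∃ e : ℝ, 0 < e ∧ a + (1 + e : ℝ) * (t - a) ∈ Ω := by
    have hc : Continuous fun e : ℝ => a + ((1 + e : ℝ) : ℂ) * (t - a) := by fun_prop
    have h0 : ∀ᶠ e : ℝ in 𝓝[>] 0, a + ((1 + e : ℝ) : ℂ) * (t - a) ∈ Ω := by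
      refine nhdsWithin_le_nhds (hc.continuousAt.preimage_mem_nhds (hΩo.mem_nhds ?_))
      simpa using ht
    obtain ⟨e, h1, h2⟩ := (h0.and self_mem_nhdsWithin).exists
    exact ⟨e, h2, h1⟩
  set t₁ := a + (1 + e : ℝ) * (t - a)
  obtain ⟨r, hr, hrΩ⟩ := Metric.isOpen_iff.1 hΩo t₁ hmem
  refine hasDerivAt_segInt (δ := 1 / 4) (C := 4 / min 1 (r / (‖t₁ - a‖ + 1))) (by norm_num)
    (by positivity) he hdt hta
    (tame_wordKer (by norm_num) (by norm_num) (by positivity) (min_le_left _ _) (good _)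
      (fun s' hs' => avoids_seg hΩ ha hr.le hrΩ (hl s' hs') ?_) hd₁ hd)
  calc min 1 (r / (‖t₁ - a‖ + 1)) * ‖t₁ - a‖ ≤ r / (‖t₁ - a‖ + 1) * (‖t₁ - a‖ + 1) := by
        gcongr
        · exact min_le_right _ _
        · linarith
    _ = r := by field_simp

lemma getLast?_tail_ne {a s : ℂ} {l : List ℂ} (h : ∀ s' ∈ (s :: l).getLast?, s' ≠ a) :
    ∀ s' ∈ l.getLast?, s' ≠ a := fun s' hs' => by
  refine h s' ?_
  cases l with
  | nil => simp at hs'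
  | cons b l => simpa [List.getLast?_cons_cons] using hs'

/-- The radial argument says nothing at the starting point `t = a`; there the formula follows from
its validity nearby, as both sides are continuous. -/
lemma hasDerivAt_segInt_of_mem {Ω : Set ℂ} (hΩ : Convex ℝ Ω) (hΩo : IsOpen Ω) {a s t : ℂ}
    {l : List ℂ} (ha : a ∈ closure Ω) (ht : t ∈ Ω) (hl : ∀ s' ∈ s :: l, s' ∉ Ω)
    (hlast : ∀ s' ∈ (s :: l).getLast?, s' ≠ a) :
    HasDerivAt (segInt a (s :: l)) (omega s t * segInt a l t) t := by
  have hd := differentiableOn_segInt_of_convex hΩ hΩo ha hl hlast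
  rcases ne_or_eq t a with hta | rfl
  · exact hasDerivAt_segInt_of_ne hΩ hΩo ha ht hta hl hlast
  have h1 : Tendsto (deriv (segInt t (s :: l))) (𝓝[≠] t) (𝓝 (deriv (segInt t (s :: l)) t)) :=
    ((hd.deriv hΩo).continuousOn.continuousAt (hΩo.mem_nhds ht)).tendsto.mono_left
      nhdsWithin_le_nhds
  have h2 : ContinuousAt (segInt t l) t := by
    cases l with
    | nil => exact continuousAt_const
    | cons s' l =>
      exact (differentiableOn_segInt_of_convex hΩ hΩo ha (fun x hx => hl x (by simp [hx]))
        (getLast?_tail_ne hlast)).continuousOn.continuousAt (hΩo.mem_nhds ht)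
  have hts : t - s ≠ 0 := sub_ne_zero.2 fun h => hl s (by simp) (h ▸ ht)
  have h3 : ContinuousAt (omega s) t := by
    unfold omega
    exact continuousAt_const.mul ((continuousAt_id.sub continuousAt_const).inv₀ hts)
  have h4 : Tendsto (deriv (segInt t (s :: l))) (𝓝[≠] t) (𝓝 (omega s t * segInt t l t)) := by
    refine Tendsto.congr' ?_ ((h3.mul h2).tendsto.mono_left nhdsWithin_le_nhds)
    filter_upwards [self_mem_nhdsWithin, nhdsWithin_le_nhds (hΩo.mem_nhds ht)] with x hx hxΩ
    exact (hasDerivAt_segInt_of_ne hΩ hΩo ha hxΩ hx hl hlast).deriv.symm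
  rw [← tendsto_nhds_unique h1 h4]
  exact (hd.differentiableAt (hΩo.mem_nhds ht)).hasDerivAt

lemma segInt_self (a s : ℂ) (l : List ℂ) : segInt a (s :: l) a = 0 := by
  simp [segInt, wordKer, kerInt, pull_seg]

/-- The iterated integral along a path in a convex set depends only on the end point. -/
lemma kerInt_eq_segInt {Ω : Set ℂ} (hΩ : Convex ℝ Ω) (hΩo : IsOpen Ω) {a b : ℂ} {γ : ℝ → ℂ}
    {c c' : ℝ} (ha : a ∈ closure Ω) (hγ : IsGoodPath a b γ) (hmem : ∀ τ ∈ Ioo (0 : ℝ) 1, γ τ ∈ Ω)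
    (hc' : 0 < c')
    (hcone : ∀ᶠ τ in 𝓝[>] 0, Metric.ball (γ τ) (c' * ‖γ τ - a‖) ⊆ Ω)
    (hc : 0 < c) (hc1 : c ≤ 1) (l : List ℂ) (hl : ∀ s ∈ l, s ∉ Ω) (hav : ∀ s ∈ l, Avoids c a b γ s)
    (hlast : ∀ s ∈ l.getLast?, s ≠ a) {τ : ℝ} (hτ : τ ∈ Ioo (0 : ℝ) 1) :
    kerInt (wordKer γ l) τ = segInt a l (γ τ) := by
  induction l generalizing τ with
  | nil => rfl
  | cons s l ih =>
    have ih' : ∀ {τ : ℝ}, τ ∈ Ioo (0 : ℝ) 1 → _ :=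
      @ih (fun s' hs' => hl s' (by simp [hs'])) (fun s' hs' => hav s' (by simp [hs']))
        (getLast?_tail_ne hlast)
    obtain ⟨d₁, hd₁, hd⟩ := exists_last_dist a (s :: l) hlast
    have ht := tame_wordKer (δ := 1 / 4) (by norm_num) (by norm_num) hc hc1 hγ hav hd₁ hd
    refine (ht.kerInt_unique (f := fun τ => segInt a (s :: l) (γ τ)) (by norm_num) (by positivity)
      (fun x hx => ?_) ?_ hτ).symm
    · have h1 := hasDerivAt_segInt_of_mem hΩ hΩo ha (hmem x hx) hl hlast
      have h2 := HasDerivAt.scomp x h1 (hγ.diff x hx).hasDerivAt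
      refine h2.congr_deriv ?_
      change _ = pull γ (omega s) x * kerInt (wordKer γ l) x
      rw [ih' hx, pull, smul_eq_mul]
      ring
    -- The primitive must vanish at the start of the path. The cone condition keeps every letter at
    -- distance at least `c₀ * ‖γ x - a‖` from `γ x`, so the quotient for the first letter stays
    -- bounded by `1 / c₀`, and the factor `(‖γ x - a‖ / d₁) ^ (1 / 4)` tends to zero.
    · set c₀ := min 1 c' with hc₀
      have hc₀0 : 0 < c₀ := by positivity
      set K := 4 / c₀ * (4 / c₀ / (1 / 4)) ^ l.length with hK
      set B := ∫ τ in (0 : ℝ)..1, betaKer (1 / 4) τ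
      have hlim : Tendsto (fun τ => K * ((‖γ τ - a‖ / d₁) ^ (1 / 4 : ℝ) *
          (1 / c₀) ^ (2 * (1 / 4) : ℝ)) * B) (𝓝[>] 0) (𝓝 0) := by
        have h1 : Tendsto (fun τ => ‖γ τ - a‖) (𝓝[>] 0) (𝓝 0) := by
          have h2 : Tendsto (fun τ : ℝ => 3 * ‖b - a‖ * τ) (𝓝[>] 0) (𝓝 0) := by
            have : Continuous fun τ : ℝ => 3 * ‖b - a‖ * τ := by fun_prop
            simpa using (this.tendsto 0).mono_left nhdsWithin_le_nhds
          refine squeeze_zero' (Eventually.of_forall fun _ => norm_nonneg _) ?_ h2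
          filter_upwards [Ioo_mem_nhdsGT (zero_lt_one' ℝ)] with x hx using hγ.start x hx
        have h2 : Tendsto (fun τ => (‖γ τ - a‖ / d₁) ^ (1 / 4 : ℝ)) (𝓝[>] 0) (𝓝 0) := by
          have := (h1.div_const d₁).rpow_const (p := (1 / 4 : ℝ)) (Or.inr (by norm_num))
          simpa using this
        have := ((h2.mul_const ((1 / c₀) ^ (2 * (1 / 4) : ℝ))).const_mul K).mul_const B
        simpa using this
      refine squeeze_zero_norm' ?_ hlim
      filter_upwards [hcone, Ioo_mem_nhdsGT (zero_lt_one' ℝ)] with x hx hx1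
      rcases eq_or_ne (γ x) a with hxa | hxa
      · simp [hxa, segInt_self]
      have hpos : 0 < ‖γ x - a‖ := norm_pos_iff.2 (sub_ne_zero.2 hxa)
      have hcc : c₀ * ‖γ x - a‖ ≤ c' * ‖γ x - a‖ := by
        gcongr; exact min_le_right _ _
      have h2 := closedBound_wordKer (δ := 1 / 4) (b := γ x) (d₂ := c₀ * ‖γ x - a‖) (s := s) (l := l)
        (by norm_num) (by norm_num)
        hc₀0 (min_le_left _ _) (isGoodPath_pth a (γ x) (lam := 0) (mu := 0) (by simp) (by simp))
        (fun s' hs' => avoids_seg hΩ ha (by positivity) hx (hl s' hs') hcc) hd₁ hd (by positivity)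
        (hcc.trans (dist_le_of_ball hx (hl s (by simp))))
      have h3 := norm_kerInt_one_le (by norm_num) h2
      refine h3.trans (le_of_eq ?_)
      rw [show ‖γ x - a‖ / (c₀ * ‖γ x - a‖) = 1 / c₀ by field_simp]

/-! ### Deformation of paths with fixed end points -/

lemma mem_closure_of_goodPath {Ω : Set ℂ} {a b : ℂ} {γ : ℝ → ℂ} (hγ : IsGoodPath a b γ)
    (hmem : ∀ τ ∈ Ioo (0 : ℝ) 1, γ τ ∈ Ω) : a ∈ closure Ω := by
  have h1 : Tendsto (fun τ => γ τ - a) (𝓝[>] 0) (𝓝 0) := by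
    have h2 : Tendsto (fun τ : ℝ => 3 * ‖b - a‖ * τ) (𝓝[>] 0) (𝓝 0) := by
      have : Continuous fun τ : ℝ => 3 * ‖b - a‖ * τ := by fun_prop
      simpa using (this.tendsto 0).mono_left nhdsWithin_le_nhds
    refine squeeze_zero_norm' ?_ h2
    filter_upwards [Ioo_mem_nhdsGT (zero_lt_one' ℝ)] with x hx using hγ.start x hx
  have h3 : Tendsto γ (𝓝[>] 0) (𝓝 a) := by simpa using h1.add_const a
  refine mem_closure_of_tendsto h3 ?_
  filter_upwards [Ioo_mem_nhdsGT (zero_lt_one' ℝ)] with x hx using hmem x hx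

/-- The end point `b` may lie on the boundary of `Ω`, where the primitive `segInt` is not available.
So the values of the primitive at `γ 0 τ` and `γ 1 τ` are compared by the mean value inequality in
`r`, and their difference is shown to vanish as `τ` tends to `1`. -/
lemma kerInt_deform {Ω : Set ℂ} (hΩ : Convex ℝ Ω) (hΩo : IsOpen Ω) {a b : ℂ} {γ D : ℝ → ℝ → ℂ}
    {c : ℝ} (hγ : ∀ r ∈ Icc (0 : ℝ) 1, IsGoodPath a b (γ r))
    (hmem : ∀ r ∈ Icc (0 : ℝ) 1, ∀ τ ∈ Ioo (0 : ℝ) 1, γ r τ ∈ Ω)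
    (hcone : ∀ r ∈ Icc (0 : ℝ) 1, ∃ c' > 0, ∀ᶠ τ in 𝓝[>] 0,
      Metric.ball (γ r τ) (c' * ‖γ r τ - a‖) ⊆ Ω)
    (hc : 0 < c) (hc1 : c ≤ 1) {s : ℂ} {l : List ℂ} (hl : ∀ s' ∈ s :: l, s' ∉ Ω)
    (hav : ∀ r ∈ Icc (0 : ℝ) 1, ∀ s' ∈ s :: l, Avoids c a b (γ r) s')
    (hlast : ∀ s' ∈ (s :: l).getLast?, s' ≠ a) (hb : s ≠ b)
    (hD : ∀ r ∈ Icc (0 : ℝ) 1, ∀ τ ∈ Ioo (0 : ℝ) 1, HasDerivAt (fun r => γ r τ) (D r τ) r ∧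
      ‖D r τ‖ ≤ 2 * ‖b - a‖ * (τ * (1 - τ))) :
    kerInt (wordKer (γ 0) (s :: l)) 1 = kerInt (wordKer (γ 1) (s :: l)) 1 := by
  have i0 : (0 : ℝ) ∈ Icc (0 : ℝ) 1 := by simp
  have i1 : (1 : ℝ) ∈ Icc (0 : ℝ) 1 := by simp
  obtain ⟨d₁, hd₁, hd⟩ := exists_last_dist a (s :: l) hlast
  have hd₂ : 0 < ‖b - s‖ := norm_pos_iff.2 (sub_ne_zero.2 hb.symm)
  have ha := mem_closure_of_goodPath (hγ 0 i0) (hmem 0 i0)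
  have tame := fun r hr => tame_wordKer (δ := 1 / 4) (by norm_num) (by norm_num) hc hc1 (hγ r hr)
    (hav r hr) hd₁ hd
  have closed := fun r hr => closedBound_wordKer (δ := 1 / 4) (by norm_num) (by norm_num) hc hc1
    (hγ r hr) (hav r hr) hd₁ hd hd₂ le_rfl
  have hlim := fun r hr => (tame r hr).tendsto_one (by norm_num) (by positivity) (closed r hr)
  have hseg : ∀ r ∈ Icc (0 : ℝ) 1, ∀ τ ∈ Ioo (0 : ℝ) 1,
      kerInt (wordKer (γ r) (s :: l)) τ = segInt a (s :: l) (γ r τ) ∧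
      kerInt (wordKer (γ r) l) τ = segInt a l (γ r τ) := fun r hr τ hτ => by
    obtain ⟨c', hc', hcone⟩ := hcone r hr
    exact ⟨kerInt_eq_segInt hΩ hΩo ha (hγ r hr) (hmem r hr) hc' hcone hc hc1 _ hl
      (hav r hr) hlast hτ, kerInt_eq_segInt hΩ hΩo ha (hγ r hr) (hmem r hr) hc' hcone
      hc hc1 _ (fun s' hs' => hl s' (by simp [hs'])) (fun s' hs' => hav r hr s' (by simp [hs']))
      (getLast?_tail_ne hlast) hτ⟩
  set ρ := ‖b - a‖ with hρ
  set C := 4 / c with hC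
  have hC0 : 0 ≤ C := by positivity
  set N := max 1 ((C / (1 / 4)) ^ l.length * (ρ / d₁) ^ (1 / 4 : ℝ)) with hN
  have hN1 : 1 ≤ N := le_max_left _ _
  set K := C * (ρ / ‖b - s‖) ^ (1 / 2 : ℝ) * N with hK
  have hK0 : 0 ≤ K := by positivity
  have hinner : ∀ r ∈ Icc (0 : ℝ) 1, ∀ τ ∈ Ioo (0 : ℝ) 1,
      ‖segInt a l (γ r τ)‖ * (1 - τ) ^ (1 / 4 : ℝ) ≤ N := fun r hr τ hτ => by
    have h1 : 0 < 1 - τ := by linarith [hτ.2]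
    rw [← (hseg r hr τ hτ).2]
    rcases eq_or_ne l [] with rfl | hne
    · have : (1 - τ) ^ (1 / 4 : ℝ) ≤ 1 :=
        Real.rpow_le_one h1.le (by linarith [hτ.1]) (by norm_num)
      simpa [wordKer, kerInt] using this.trans hN1
    · have h2 := (tame r hr).tail.norm_le (by norm_num) (by positivity) (by simpa using hne) hτ
      have h3 : ratioPow (1 / 4) τ * (1 - τ) ^ (1 / 4 : ℝ) ≤ 1 := by
        rw [ratioPow, ← Real.mul_rpow (div_nonneg hτ.1.le h1.le) h1.le, div_mul_cancel₀ _ h1.ne']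
        exact Real.rpow_le_one hτ.1.le hτ.2.le (by norm_num)
      have h4 : 0 ≤ (1 - τ) ^ (1 / 4 : ℝ) := by positivity
      have hlen : (List.map (fun s => pull (γ r) (omega s)) l).length = l.length := by simp
      rw [hlen] at h2
      calc _ ≤ ((C / (1 / 4)) ^ l.length * (ρ / d₁) ^ (1 / 4 : ℝ) * ratioPow (1 / 4) τ) *
            (1 - τ) ^ (1 / 4 : ℝ) := mul_le_mul_of_nonneg_right h2 h4
        _ = (C / (1 / 4)) ^ l.length * (ρ / d₁) ^ (1 / 4 : ℝ) *
            (ratioPow (1 / 4) τ * (1 - τ) ^ (1 / 4 : ℝ)) := by ring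
        _ ≤ (C / (1 / 4)) ^ l.length * (ρ / d₁) ^ (1 / 4 : ℝ) * 1 := by gcongr
        _ ≤ N := by rw [mul_one]; exact le_max_right _ _
  have hdiff : ∀ τ ∈ Ioo (0 : ℝ) 1, ‖segInt a (s :: l) (γ 1 τ) - segInt a (s :: l) (γ 0 τ)‖ ≤
      K * (1 - τ) ^ (1 / 4 : ℝ) := fun τ hτ => by
    have h1 : 0 < 1 - τ := by linarith [hτ.2]
    have h0 := hτ.1
    have hpos : 0 < τ * (1 - τ) := by positivity
    refine norm_image_sub_le_of_norm_deriv_le_segment_01'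
      (f := fun r => segInt a (s :: l) (γ r τ))
      (f' := fun r => D r τ • (omega s (γ r τ) * segInt a l (γ r τ))) (fun r hr => ?_)
      fun r hr => ?_
    · have e1 := hasDerivAt_segInt_of_mem hΩ hΩo ha (hmem r hr τ hτ) hl hlast
      exact (HasDerivAt.scomp r e1 (hD r hr τ hτ).1).hasDerivWithinAt
    · have hr' : r ∈ Icc (0 : ℝ) 1 := ⟨hr.1, hr.2.le⟩
      -- The factor `τ * (1 - τ)` in the bound for `D` cancels the singularity of the kernel bound
      -- and leaves `(1 - τ) ^ (1 / 2)`. One quarter power absorbs the growth of the inner integral,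
      -- the other gives the decay in `hdiff`.
      have q := (hav r hr' s (by simp)).quot_le hc hc1 (hγ r hr') one_pos hd₂ (α := 0)
        (β := 1 / 2) (by simp) (fun _ => le_rfl) le_rfl (by norm_num) (by norm_num) hτ
      rw [Real.rpow_zero, one_mul] at q
      have q2 : ρ * ‖γ r τ - s‖⁻¹ * (τ * (1 - τ)) ≤
          C * (ρ / ‖b - s‖) ^ (1 / 2 : ℝ) * ((1 - τ) ^ (1 / 4 : ℝ) * (1 - τ) ^ (1 / 4 : ℝ)) := by
        rw [← Real.rpow_add h1, show (1 / 4 + 1 / 4 : ℝ) = 1 / 2 by norm_num, mul_assoc C,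
          ← Real.mul_rpow (by positivity) h1.le,
          show ρ / ‖b - s‖ * (1 - τ) = ρ * (1 - τ) / ‖b - s‖ by ring]
        calc _ ≤ 4 / c * ((‖b - a‖ * (1 - τ) / ‖b - s‖) ^ (1 / 2 : ℝ) / (τ * (1 - τ))) *
              (τ * (1 - τ)) := by gcongr
          _ = _ := by rw [hC, hρ]; field_simp
      rw [norm_smul, norm_mul]
      have e2 : ‖D r τ‖ * ‖omega s (γ r τ)‖ ≤ ρ * ‖γ r τ - s‖⁻¹ * (τ * (1 - τ)) := by
        calc _ ≤ (2 * ρ * (τ * (1 - τ))) * (1 / 6 * ‖γ r τ - s‖⁻¹) :=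
              mul_le_mul (hD r hr' τ hτ).2 (norm_omega_le _ _) (norm_nonneg _) (by positivity)
          _ = 1 / 3 * (ρ * ‖γ r τ - s‖⁻¹ * (τ * (1 - τ))) := by ring
          _ ≤ _ := by
            have : 0 ≤ ρ * ‖γ r τ - s‖⁻¹ * (τ * (1 - τ)) := by positivity
            linarith
      calc ‖D r τ‖ * (‖omega s (γ r τ)‖ * ‖segInt a l (γ r τ)‖)
          = ‖D r τ‖ * ‖omega s (γ r τ)‖ * ‖segInt a l (γ r τ)‖ := by ring
        _ ≤ C * (ρ / ‖b - s‖) ^ (1 / 2 : ℝ) * ((1 - τ) ^ (1 / 4 : ℝ) * (1 - τ) ^ (1 / 4 : ℝ)) *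
            ‖segInt a l (γ r τ)‖ := mul_le_mul_of_nonneg_right (e2.trans q2) (norm_nonneg _)
        _ = C * (ρ / ‖b - s‖) ^ (1 / 2 : ℝ) * (‖segInt a l (γ r τ)‖ * (1 - τ) ^ (1 / 4 : ℝ)) *
            (1 - τ) ^ (1 / 4 : ℝ) := by ring
        _ ≤ C * (ρ / ‖b - s‖) ^ (1 / 2 : ℝ) * N * (1 - τ) ^ (1 / 4 : ℝ) := by
            gcongr; exact hinner r hr' τ hτ
  have hz : Tendsto (fun τ : ℝ => K * (1 - τ) ^ (1 / 4 : ℝ)) (𝓝[<] 1) (𝓝 0) := by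
    have : ContinuousAt (fun τ : ℝ => K * (1 - τ) ^ (1 / 4 : ℝ)) 1 :=
      continuousAt_const.mul (ContinuousAt.rpow_const (by fun_prop) (Or.inr (by norm_num)))
    have h2 := this.tendsto
    simp only [sub_self, Real.zero_rpow (by norm_num : (1 / 4 : ℝ) ≠ 0), mul_zero] at h2
    exact h2.mono_left nhdsWithin_le_nhds
  have hsub := (hlim 1 i1).sub (hlim 0 i0)
  have hsub0 : Tendsto (fun τ => kerInt (wordKer (γ 1) (s :: l)) τ -
      kerInt (wordKer (γ 0) (s :: l)) τ) (𝓝[<] 1) (𝓝 0) := by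
    refine squeeze_zero_norm' ?_ hz
    filter_upwards [Ioo_mem_nhdsLT (zero_lt_one' ℝ)] with τ hτ
    rw [(hseg 1 i1 τ hτ).1, (hseg 0 i0 τ hτ).1]
    exact hdiff τ hτ
  exact (sub_eq_zero.1 (tendsto_nhds_unique hsub hsub0)).symm

/-! ### A convex region containing the paths and avoiding all letters -/

/-- The part of the lower half plane on the side of `a` of the line through `b` that is
orthogonal to `b - a`. -/
def lens (a b : ℂ) : Set ℂ := {t | t.im < 0 ∧ ((t - b) * (starRingEnd ℂ) (b - a)).re < 0}

lemma isOpen_lens (a b : ℂ) : IsOpen (lens a b) :=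
  (isOpen_lt Complex.continuous_im continuous_const).inter
    (isOpen_lt (Complex.continuous_re.comp ((continuous_id.sub continuous_const).mul
      continuous_const)) continuous_const)

lemma convex_lens (a b : ℂ) : Convex ℝ (lens a b) := by
  intro x hx y hy p q hp hq hpq
  obtain ⟨hx1, hx2⟩ := hx
  obtain ⟨hy1, hy2⟩ := hy
  have key : ∀ X Y : ℝ, X < 0 → Y < 0 → p * X + q * Y < 0 := fun X Y hX hY => by
    rcases hp.eq_or_lt with rfl | hp'
    · have : q = 1 := by linarith
      simpa [this] using hY
    · nlinarith
  have hr : p + q = 1 := hpq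
  constructor
  · have := key _ _ hx1 hy1
    simpa using this
  · have h := key _ _ hx2 hy2
    simp only [Complex.add_re, Complex.mul_re, Complex.sub_re, Complex.conj_re, Complex.sub_im,
      Complex.conj_im, Complex.add_im, Complex.smul_re, Complex.smul_im, smul_eq_mul] at h ⊢
    have hb1 : b.re = p * b.re + q * b.re := by rw [← add_mul, hr, one_mul]
    have hb2 : b.im = p * b.im + q * b.im := by rw [← add_mul, hr, one_mul]
    refine lt_of_eq_of_lt ?_ h
    linear_combination (b.re - a.re) * hb1 * (-1) - (b.im - a.im) * hb2

/-- The lower half plane is cut along a line through `b` precisely to exclude `b`: below the real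
axis the moving letter sits at the end point. -/
lemma not_mem_lens {a b s : ℂ} (h : 0 ≤ s.im ∨ s = b) : s ∉ lens a b := by
  rintro ⟨h1, h2⟩
  rcases h with h | rfl
  · linarith
  · simp at h2

lemma pth_sub_end (a b : ℂ) (lam mu τ : ℝ) :
    pth a b lam mu τ - b = -(((1 - τ) * (1 + lam * τ) : ℝ) : ℂ) * (b - a) -
      I * ((mu * ‖b - a‖ * (τ * (1 - τ)) : ℝ) : ℂ) := by
  rw [pth]; push_cast; ring

/-- The downward bulge can push the path towards the cutting line only when `b` lies below `a`, and
then by at most `τ (1 - τ) ‖b - a‖²`; the chord contributes at least `(1 - τ) ‖b - a‖²`. -/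
lemma pth_lens_re_le (a b : ℂ) {lam mu τ : ℝ} (hl : 0 ≤ lam) (hm : mu ∈ Icc (0 : ℝ) 1)
    (hτ : τ ∈ Ioo (0 : ℝ) 1) :
    ((pth a b lam mu τ - b) * (starRingEnd ℂ) (b - a)).re ≤ -((1 - τ) ^ 2 * ‖b - a‖ ^ 2) := by
  set v := b - a with hv
  set ρ := ‖v‖ with hρ
  have hn : ρ ^ 2 = v.re ^ 2 + v.im ^ 2 := by
    rw [hρ, ← Complex.normSq_eq_norm_sq, Complex.normSq_apply]; ring
  have hρ0 : 0 ≤ ρ := norm_nonneg _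
  have him : -ρ ≤ v.im := (abs_le.1 (Complex.abs_im_le_norm v)).1
  obtain ⟨h0, h1⟩ := hτ
  have h1' : 0 < 1 - τ := by linarith
  have e : ((pth a b lam mu τ - b) * (starRingEnd ℂ) v).re =
      -((1 - τ) * ((1 + lam * τ) * ρ ^ 2 + mu * ρ * τ * v.im)) := by
    rw [pth_sub_end, hn, ← hv, ← hρ]
    simp
    ring
  rw [e]
  have h2 : mu * ρ * τ * (-ρ) ≤ mu * ρ * τ * v.im := by
    have := hm.1
    gcongr
  have h3 : (1 - τ) * ρ ^ 2 ≤ (1 + lam * τ) * ρ ^ 2 + mu * ρ * τ * v.im := by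
    have h4 : 0 ≤ lam * τ * ρ ^ 2 := by positivity
    have h5 : mu * τ * ρ ^ 2 ≤ 1 * τ * ρ ^ 2 := by
      have := hm.2
      gcongr
    nlinarith
  have := mul_le_mul_of_nonneg_left h3 h1'.le
  nlinarith

lemma pth_mem_lens {a b : ℂ} (hab : a ≠ b) {lam mu τ : ℝ} (hl : 0 ≤ lam)
    (hm : mu ∈ Icc (0 : ℝ) 1) (hτ : τ ∈ Ioo (0 : ℝ) 1) (him : (pth a b lam mu τ).im < 0) :
    pth a b lam mu τ ∈ lens a b := by
  refine ⟨him, (pth_lens_re_le a b hl hm hτ).trans_lt ?_⟩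
  have h1 : 0 < 1 - τ := by linarith [hτ.2]
  have : 0 < ‖b - a‖ := norm_pos_iff.2 (sub_ne_zero.2 hab.symm)
  have : 0 < (1 - τ) ^ 2 * ‖b - a‖ ^ 2 := by positivity
  linarith

/-- Near the start the depth below the axis is at least linear in `τ`, as is the bound on the
distance from `a`, while the cutting line is still far away; hence a cone around the path fits into
the lens. -/
lemma pth_cone {a b : ℂ} (hab : a ≠ b) {lam mu m : ℝ} (hl : lam ∈ Icc (0 : ℝ) 1)
    (hm : mu ∈ Icc (0 : ℝ) 1) (hm0 : 0 < m)
    (him : ∀ τ ∈ Ioo (0 : ℝ) 1, m * (τ * (1 - τ)) ≤ -(pth a b lam mu τ).im) :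
    ∃ c' > 0, ∀ᶠ τ in 𝓝[>] 0,
      Metric.ball (pth a b lam mu τ) (c' * ‖pth a b lam mu τ - a‖) ⊆ lens a b := by
  set ρ := ‖b - a‖ with hρ
  have hρ0 : 0 < ρ := norm_pos_iff.2 (sub_ne_zero.2 hab.symm)
  refine ⟨min (1 / 6) (m / (6 * ρ)), by positivity, ?_⟩
  filter_upwards [Ioo_mem_nhdsGT (by norm_num : (0 : ℝ) < 1 / 2)] with τ hτ x hx
  have hτ1 : τ ∈ Ioo (0 : ℝ) 1 := ⟨hτ.1, hτ.2.trans (by norm_num)⟩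
  have h0 := hτ.1
  have hs := (isGoodPath_pth a b hl hm).start τ hτ1
  set g := pth a b lam mu τ with hg
  rw [mem_ball_iff_norm] at hx
  have hx1 : ‖x - g‖ < m * τ / 2 := by
    calc ‖x - g‖ < min (1 / 6) (m / (6 * ρ)) * ‖g - a‖ := hx
      _ ≤ m / (6 * ρ) * (3 * ρ * τ) := by gcongr; exact min_le_right _ _
      _ = m * τ / 2 := by field_simp; norm_num
  have hx2 : ‖x - g‖ < ρ / 4 := by
    calc ‖x - g‖ < min (1 / 6) (m / (6 * ρ)) * ‖g - a‖ := hx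
      _ ≤ 1 / 6 * (3 * ρ * τ) := by gcongr; exact min_le_left _ _
      _ ≤ ρ / 4 := by nlinarith [hτ.2]
  constructor
  · have h1 := him τ hτ1
    have h2 := (abs_le.1 (Complex.abs_im_le_norm (x - g))).2
    rw [Complex.sub_im] at h2
    nlinarith [hτ.2, mul_pos hm0 h0]
  · have h1 := pth_lens_re_le a b hl.1 hm hτ1
    rw [← hg, ← hρ] at h1
    have h2 : ((x - g) * (starRingEnd ℂ) (b - a)).re ≤ ‖x - g‖ * ρ := by
      refine (Complex.re_le_norm _).trans (le_of_eq ?_)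
      rw [norm_mul, Complex.norm_conj]
    have h3 : ((x - b) * (starRingEnd ℂ) (b - a)).re = ((x - g) * (starRingEnd ℂ) (b - a)).re +
        ((g - b) * (starRingEnd ℂ) (b - a)).re := by
      rw [← Complex.add_re]; congr 1; ring
    have h4 : ‖x - g‖ * ρ < ρ / 4 * ρ := by gcongr
    have h5 : (1 / 4 : ℝ) ≤ (1 - τ) ^ 2 := by nlinarith [hτ.2]
    have h6 : 1 / 4 * ρ ^ 2 ≤ (1 - τ) ^ 2 * ρ ^ 2 := by gcongr
    nlinarith

lemma kerInt_pth_self (a s : ℂ) (l : List ℂ) (lam mu : ℝ) :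
    kerInt (wordKer (pth a a lam mu) (s :: l)) 1 = 0 := by
  simp [wordKer, kerInt, pull, deriv_pth]

/-- Two cases are used: `mu₀ = 1` joins the defining path to the standard one, `mu₀ = 0` joins the
straight segment to it. -/
lemma kerInt_pth_deform {a b : ℂ} {mu₀ m c : ℝ} (hmu : mu₀ ∈ Icc (0 : ℝ) 1) (hm0 : 0 < m)
    (him : ∀ r ∈ Icc (0 : ℝ) 1, ∀ τ ∈ Ioo (0 : ℝ) 1,
      m * (τ * (1 - τ)) ≤ -(pth a b r (mu₀ + (1 - mu₀) * r) τ).im)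
    (hc : 0 < c) (hc1 : c ≤ 1) {s : ℂ} {l : List ℂ} (hl : ∀ s' ∈ s :: l, 0 ≤ s'.im ∨ s' = b)
    (hav : ∀ r ∈ Icc (0 : ℝ) 1, ∀ s' ∈ s :: l,
      Avoids c a b (pth a b r (mu₀ + (1 - mu₀) * r)) s')
    (hlast : ∀ s' ∈ (s :: l).getLast?, s' ≠ a) (hb : s ≠ b) :
    kerInt (wordKer (pth a b 0 mu₀) (s :: l)) 1 = kerInt (wordKer (pth a b 1 1) (s :: l)) 1 := by
  rcases eq_or_ne a b with rfl | hab
  · rw [kerInt_pth_self, kerInt_pth_self]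
  have hmr : ∀ r ∈ Icc (0 : ℝ) 1, mu₀ + (1 - mu₀) * r ∈ Icc (0 : ℝ) 1 := fun r hr =>
    ⟨by nlinarith [hr.1, hmu.1, hmu.2], by nlinarith [hr.2, hmu.1, hmu.2]⟩
  have := kerInt_deform (convex_lens a b) (isOpen_lens a b)
    (γ := fun r => pth a b r (mu₀ + (1 - mu₀) * r))
    (D := fun r τ => ((-(τ * (1 - τ)) : ℝ) : ℂ) * (b - a) -
      I * (((1 - mu₀) * ‖b - a‖ * (τ * (1 - τ)) : ℝ) : ℂ))
    (fun r hr => isGoodPath_pth a b hr (hmr r hr))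
    (fun r hr τ hτ => pth_mem_lens hab hr.1 (hmr r hr) hτ ?_)
    (fun r hr => pth_cone hab hr (hmr r hr) hm0 (him r hr)) hc hc1
    (fun s' hs' => not_mem_lens (hl s' hs')) hav hlast hb (fun r hr τ hτ => ⟨?_, ?_⟩)
  · simpa using this
  · have h1 : 0 < 1 - τ := by linarith [hτ.2]
    have h0 := hτ.1
    have : 0 < m * (τ * (1 - τ)) := by positivity
    linarith [him r hr τ hτ]
  · have e1 : HasDerivAt (fun r : ℝ => (1 - r) * τ + r * τ ^ 2) (-(τ * (1 - τ))) r := by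
      have := (((hasDerivAt_id r).const_sub 1).mul_const τ).add
        ((hasDerivAt_id r).mul_const (τ ^ 2))
      refine this.congr_deriv ?_
      ring
    have e2 : HasDerivAt (fun r : ℝ => (mu₀ + (1 - mu₀) * r) * ‖b - a‖ * (τ * (1 - τ)))
        ((1 - mu₀) * ‖b - a‖ * (τ * (1 - τ))) r := by
      have := ((((hasDerivAt_id r).const_mul (1 - mu₀)).const_add mu₀).mul_const
        ‖b - a‖).mul_const (τ * (1 - τ))
      refine this.congr_deriv ?_
      ring
    exact ((e1.ofReal_comp.mul_const (b - a)).const_add a).sub (e2.ofReal_comp.const_mul I)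
  · have h1 : 0 < 1 - τ := by linarith [hτ.2]
    have h0 := hτ.1
    refine (norm_mul_sub_le (A := τ * (1 - τ)) (B := ‖b - a‖ * (τ * (1 - τ))) rfl ?_ ?_).trans ?_
    · rw [abs_neg, abs_of_nonneg (by positivity)]
    · have h2 : 0 ≤ 1 - mu₀ := by linarith [hmu.2]
      rw [abs_of_nonneg (by positivity)]
      have h3 : 1 - mu₀ ≤ 1 := by linarith [hmu.1]
      calc _ ≤ 1 * ‖b - a‖ * (τ * (1 - τ)) := by gcongr
        _ = _ := by ring
    · exact le_of_eq (by ring)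

/-! ### The standard path -/

/-- The iterated integral of the word `l` from `a` to `b` along a path that starts vertically
downwards and approaches `b` from below. -/
def etaInt (a : ℂ) (l : List ℂ) (b : ℂ) : ℂ := kerInt (wordKer (pth a b 1 1) l) 1

lemma pth_im (a b : ℂ) (lam mu τ : ℝ) : (pth a b lam mu τ).im =
    (1 - ((1 - lam) * τ + lam * τ ^ 2)) * a.im + ((1 - lam) * τ + lam * τ ^ 2) * b.im -
      mu * ‖b - a‖ * (τ * (1 - τ)) := by
  simp only [pth, Complex.sub_im, Complex.add_im, Complex.mul_im, Complex.ofReal_re,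
    Complex.ofReal_im, Complex.I_re, Complex.I_im]
  ring

lemma pth_coef {lam τ : ℝ} (hl : lam ∈ Icc (0 : ℝ) 1) (hτ : τ ∈ Ioo (0 : ℝ) 1) :
    (1 - lam) * τ ≤ (1 - lam) * τ + lam * τ ^ 2 ∧ (1 - lam) * τ + lam * τ ^ 2 ≤ τ := by
  have := hτ.1
  have := hl.1
  have h3 : 0 ≤ lam * τ ^ 2 := by positivity
  refine ⟨by linarith, ?_⟩
  nlinarith [mul_nonneg (mul_nonneg hl.1 hτ.1.le) (by linarith [hτ.2] : (0 : ℝ) ≤ 1 - τ)]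

lemma pth_im_le {a b : ℂ} (ha : a.im ≤ 0) (hb : b.im ≤ 0) {lam mu τ : ℝ}
    (hl : lam ∈ Icc (0 : ℝ) 1) (hτ : τ ∈ Ioo (0 : ℝ) 1) :
    mu * ‖b - a‖ * (τ * (1 - τ)) + (1 - lam) * τ * (-b.im) ≤ -(pth a b lam mu τ).im := by
  obtain ⟨h1, h2⟩ := pth_coef hl hτ
  rw [pth_im]
  nlinarith [mul_nonneg (by linarith [hτ.2] : 0 ≤ 1 - ((1 - lam) * τ + lam * τ ^ 2))
    (neg_nonneg.2 ha), mul_nonneg (sub_nonneg.2 h1) (neg_nonneg.2 hb)]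

lemma avoids_of_im {a b : ℂ} {c : ℝ} {γ : ℝ → ℂ} {s : ℂ} (hs : 0 ≤ s.im)
    (h : ∀ τ ∈ Ioo (0 : ℝ) 1, c * ‖b - a‖ * (τ * (1 - τ)) ≤ -(γ τ).im) : Avoids c a b γ s :=
  fun τ hτ => by
    have h1 := (abs_le.1 (Complex.abs_im_le_norm (γ τ - s))).1
    rw [Complex.sub_im] at h1
    linarith [h τ hτ]

/-- The quadratic term makes the path approach `b` at speed `(1 + lam)‖b - a‖`, which outweighs the
bulge when `mu ≤ lam`. For `lam = 0`, `mu = 1` this fails: if `b` is vertically below `a`, the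
distance from `b` is only quadratic in `1 - τ`. This is one reason for the choice `lam = mu = 1`. -/
lemma avoids_end {a b : ℂ} {lam mu : ℝ} (hl : 0 ≤ lam) (hm : mu ≤ lam) (hm0 : 0 ≤ mu) :
    Avoids 1 a b (pth a b lam mu) b := fun τ hτ => by
  have h0 := hτ.1
  have h1 : 0 < 1 - τ := by linarith [hτ.2]
  have hρ := norm_nonneg (b - a)
  rw [pth_sub_end]
  have e1 : ‖-(((1 - τ) * (1 + lam * τ) : ℝ) : ℂ) * (b - a)‖ = (1 - τ) * (1 + lam * τ) * ‖b - a‖ := by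
    rw [norm_mul, norm_neg, Complex.norm_real, Real.norm_of_nonneg (by positivity)]
  have e2 : ‖I * ((mu * ‖b - a‖ * (τ * (1 - τ)) : ℝ) : ℂ)‖ = mu * ‖b - a‖ * (τ * (1 - τ)) := by
    rw [norm_mul, Complex.norm_I, one_mul, Complex.norm_real, Real.norm_of_nonneg (by positivity)]
  have h2 := norm_sub_norm_le (-(((1 - τ) * (1 + lam * τ) : ℝ) : ℂ) * (b - a))
    (I * ((mu * ‖b - a‖ * (τ * (1 - τ)) : ℝ) : ℂ))
  rw [e1, e2] at h2
  refine le_trans ?_ h2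
  have h3 : mu * ‖b - a‖ * (τ * (1 - τ)) ≤ lam * ‖b - a‖ * (τ * (1 - τ)) := by gcongr
  have h4 : ‖b - a‖ * (τ * (1 - τ)) ≤ ‖b - a‖ * (1 * (1 - τ)) := by gcongr; exact hτ.2.le
  nlinarith

lemma avoids_eta {a b s : ℂ} (ha : a.im ≤ 0) (hb : b.im ≤ 0) (hs : 0 ≤ s.im ∨ s = b) :
    Avoids 1 a b (pth a b 1 1) s := by
  rcases hs with hs | rfl
  · refine avoids_of_im hs fun τ hτ => ?_
    simpa using pth_im_le ha hb (lam := 1) (mu := 1) (by simp) hτ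
  · exact avoids_end zero_le_one le_rfl zero_le_one

lemma avoids_path {a b s : ℂ} (ha : a.im ≤ 0) (hb : b.im ≤ 0) (hs : 0 ≤ s.im) {r : ℝ}
    (hr : r ∈ Icc (0 : ℝ) 1) : Avoids 1 a b (pth a b r 1) s := by
  refine avoids_of_im hs fun τ hτ => ?_
  have := pth_im_le ha hb (lam := r) (mu := 1) hr hτ
  have h2 : 0 ≤ (1 - r) * τ * (-b.im) :=
    mul_nonneg (mul_nonneg (by linarith [hr.2]) hτ.1.le) (by linarith)
  linarith

lemma kerInt_path_eq_etaInt {a b s : ℂ} {l : List ℂ} (ha : a.im ≤ 0) (hb : b.im ≤ 0)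
    (hl : ∀ s' ∈ s :: l, 0 ≤ s'.im) (hlast : ∀ s' ∈ (s :: l).getLast?, s' ≠ a) (hsb : s ≠ b) :
    kerInt (wordKer (path a b) (s :: l)) 1 = etaInt a (s :: l) b := by
  rw [path_eq_pth]
  rcases eq_or_ne a b with rfl | hab
  · rw [etaInt, kerInt_pth_self, kerInt_pth_self]
  refine kerInt_pth_deform (m := ‖b - a‖) (by simp) (norm_pos_iff.2 (sub_ne_zero.2 hab.symm))
    (fun r hr τ hτ => ?_) one_pos le_rfl (fun s' hs' => Or.inl (hl s' hs'))
    (fun r hr s' hs' => ?_) hlast hsb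
  · have := pth_im_le ha hb (lam := r) (mu := 1) hr hτ
    have h2 : 0 ≤ (1 - r) * τ * (-b.im) :=
      mul_nonneg (mul_nonneg (by linarith [hr.2]) hτ.1.le) (by linarith)
    simp only [sub_self, zero_mul, add_zero]
    linarith
  · simpa using avoids_path ha hb (hl s' hs') hr

lemma pth_diag_im_le {a b : ℂ} (ha : a.im ≤ 0) (hb : b.im < 0) {r τ : ℝ}
    (hr : r ∈ Icc (0 : ℝ) 1) (hτ : τ ∈ Ioo (0 : ℝ) 1) :
    min (-b.im) ‖b - a‖ * (τ * (1 - τ)) ≤ -(pth a b r r τ).im := by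
  have := pth_im_le ha hb.le (lam := r) (mu := r) hr hτ
  have h0 := hτ.1
  have h1 : 0 < 1 - τ := by linarith [hτ.2]
  have h2 : 0 ≤ 1 - r := by linarith [hr.2]
  have hm : 0 ≤ min (-b.im) ‖b - a‖ := le_min (by linarith) (norm_nonneg _)
  have h3 : r * min (-b.im) ‖b - a‖ * (τ * (1 - τ)) ≤ r * ‖b - a‖ * (τ * (1 - τ)) := by
    have := hr.1
    gcongr
    exact min_le_right _ _
  have h4 : (1 - r) * τ * (min (-b.im) ‖b - a‖ * (1 - τ)) ≤ (1 - r) * τ * (-b.im * 1) := by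
    gcongr
    · linarith
    · exact min_le_left _ _
    · linarith
  nlinarith

lemma avoids_diag {a b s : ℂ} (ha : a.im ≤ 0) (hb : b.im < 0) (hs : 0 ≤ s.im ∨ s = b) {r : ℝ}
    (hr : r ∈ Icc (0 : ℝ) 1) :
    Avoids (min 1 (-b.im / (‖b - a‖ + 1))) a b (pth a b r r) s := by
  have hb' : 0 < -b.im := by linarith
  rcases hs with hs | rfl
  · refine avoids_of_im hs fun τ hτ => ?_
    have h0 := hτ.1
    have h1 : 0 < 1 - τ := by linarith [hτ.2]
    refine le_trans ?_ (pth_diag_im_le ha hb hr hτ)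
    gcongr
    refine le_min ?_ ?_
    · calc _ ≤ -b.im / (‖b - a‖ + 1) * (‖b - a‖ + 1) := by
            gcongr
            · exact min_le_right _ _
            · linarith
        _ = -b.im := by field_simp
    · calc _ ≤ 1 * ‖b - a‖ := by gcongr; exact min_le_left _ _
        _ = _ := one_mul _
  · intro τ hτ
    have h0 := hτ.1
    have h1 : 0 < 1 - τ := by linarith [hτ.2]
    refine le_trans ?_ (avoids_end hr.1 le_rfl hr.1 τ hτ)
    gcongr
    exact min_le_left _ _

/-- With `b` strictly below the axis the segment leaves the axis at once, and the depth along all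
paths `pth a b r r` is controlled by the smaller of `-b.im` and `‖b - a‖`. For `b` on the axis the
segment could run through the letters. -/
lemma segInt_eq_etaInt {a b : ℂ} {l : List ℂ} (ha : a.im ≤ 0) (hb : b.im < 0)
    (hl : ∀ s' ∈ l, 0 ≤ s'.im ∨ s' = b) (hlast : ∀ s' ∈ l.getLast?, s' ≠ a)
    (hsb : ∀ s ∈ l.head?, s ≠ b) :
    segInt a l b = etaInt a l b := by
  cases l with
  | nil => rfl
  | cons s l =>
    rcases eq_or_ne a b with rfl | hab
    · rw [segInt_self, etaInt, kerInt_pth_self]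
    have hρ : 0 < ‖b - a‖ := norm_pos_iff.2 (sub_ne_zero.2 hab.symm)
    have hb' : 0 < -b.im := by linarith
    refine kerInt_pth_deform (m := min (-b.im) ‖b - a‖) (by simp) (lt_min hb' hρ)
      (fun r hr τ hτ => ?_) (c := min 1 (-b.im / (‖b - a‖ + 1))) (by positivity) (min_le_left _ _)
      hl (fun r hr s' hs' => ?_) hlast (hsb s (by simp))
    · simpa using pth_diag_im_le ha hb hr hτ
    · simpa using avoids_diag ha hb (hl s' hs') hr

/-! ### Words with a moving letter -/

/-- The reflection of the upper half plane onto the lower half plane. -/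
def fold (p : ℂ) : ℂ := if 0 ≤ p.im then (starRingEnd ℂ) p else p

lemma fold_of_nonneg {p : ℂ} (h : 0 ≤ p.im) : fold p = (starRingEnd ℂ) p := if_pos h

lemma fold_of_neg {p : ℂ} (h : p.im < 0) : fold p = p := if_neg (not_le.2 h)

lemma continuous_fold : Continuous fold :=
  Continuous.if_le Complex.continuous_conj continuous_id continuous_const Complex.continuous_im
    fun _ h => Complex.conj_eq_iff_im.2 h.symm

lemma fold_im (p : ℂ) : (fold p).im = -|p.im| := by
  rcases le_or_gt 0 p.im with h | h
  · rw [fold_of_nonneg h, abs_of_nonneg h]; simp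
  · rw [fold_of_neg h, abs_of_neg h]; simp

lemma fold_re (p : ℂ) : (fold p).re = p.re := by
  rcases le_or_gt 0 p.im with h | h
  · rw [fold_of_nonneg h]; simp
  · rw [fold_of_neg h]

lemma fold_im_nonpos (p : ℂ) : (fold p).im ≤ 0 := by
  rw [fold_im]; linarith [abs_nonneg p.im]

lemma nonneg_or_eq_fold (p : ℂ) : 0 ≤ p.im ∨ p = fold p := by
  rcases le_or_gt 0 p.im with h | h
  · exact Or.inl h
  · exact Or.inr (fold_of_neg h).symm

lemma norm_le_norm_of_abs {x y : ℂ} (h1 : x.re = y.re) (h2 : |x.im| ≤ |y.im|) : ‖x‖ ≤ ‖y‖ := by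
  rw [← abs_of_nonneg (norm_nonneg x), ← abs_of_nonneg (norm_nonneg y), ← sq_le_sq,
    ← Complex.normSq_eq_norm_sq, ← Complex.normSq_eq_norm_sq, Complex.normSq_apply,
    Complex.normSq_apply, h1]
  have := sq_le_sq.2 h2
  nlinarith

lemma norm_fold_sub_le {a : ℂ} (ha : a.im ≤ 0) (p : ℂ) : ‖fold p - a‖ ≤ ‖a - p‖ := by
  rw [norm_sub_rev a p]
  refine norm_le_norm_of_abs (by simp [fold_re]) ?_
  rcases le_or_gt 0 p.im with h | h
  · rw [Complex.sub_im, Complex.sub_im, fold_im, abs_of_nonneg h, abs_of_nonneg (by linarith : 0 ≤ p.im - a.im),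
      abs_le]
    constructor <;> linarith
  · rw [fold_of_neg h]

/-- Reflecting a point into the lower half plane only increases its distance from the points above.
So estimates in terms of `fold p - s` turn into estimates in terms of `p - s`. -/
lemma norm_sub_le_fold {s : ℂ} (hs : 0 ≤ s.im) (p : ℂ) : ‖p - s‖ ≤ ‖fold p - s‖ := by
  refine norm_le_norm_of_abs (by simp [fold_re]) ?_
  rw [Complex.sub_im, Complex.sub_im, fold_im]
  have h1 := abs_nonneg p.im
  rw [abs_of_nonpos (by linarith : -|p.im| - s.im ≤ 0), abs_le]
  have := neg_abs_le p.im
  have := le_abs_self p.im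
  constructor <;> linarith

lemma abs_im_le_norm_fold_sub {s : ℂ} (hs : 0 ≤ s.im) (p : ℂ) : |p.im| ≤ ‖fold p - s‖ := by
  have h := (abs_le.1 (Complex.abs_im_le_norm (fold p - s))).1
  rw [Complex.sub_im, fold_im] at h
  linarith

/-- The base point `a` lies in the closed lower half plane and the constant letters of the word
`V` in the closed upper half plane; if the last letter is constant, its distance from `a` is at
least `d`. The letter `none` stands for the moving point. -/
structure GoodWord (a : ℂ) (d : ℝ) (V : List (Option ℂ)) : Prop where
  base : a.im ≤ 0
  pos : 0 < d
  im_nonneg : ∀ s, some s ∈ V → 0 ≤ s.im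
  last : ∀ s, some s ∈ V.getLast? → d ≤ ‖a - s‖

/-- The word `V` with the moving letter placed at `p`. -/
def place (p : ℂ) (V : List (Option ℂ)) : List ℂ := V.map fun o => o.getD p

/-- The iterated integral of the word `V` from `a` to `fold p`, with the moving letter at `p`. -/
def wordInt (a : ℂ) (V : List (Option ℂ)) (p : ℂ) : ℂ := etaInt a (place p V) (fold p)

lemma GoodWord.tail {a : ℂ} {d : ℝ} {o : Option ℂ} {V : List (Option ℂ)}
    (h : GoodWord a d (o :: V)) : GoodWord a d V where
  base := h.base
  pos := h.pos
  im_nonneg s hs := h.im_nonneg s (List.mem_cons_of_mem _ hs)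
  last s hs := by
    refine h.last s ?_
    cases V with
    | nil => simp at hs
    | cons b l => simpa [List.getLast?_cons_cons] using hs

lemma GoodWord.place_im {a : ℂ} {d : ℝ} {V : List (Option ℂ)} (h : GoodWord a d V) (p : ℂ) :
    ∀ s ∈ place p V, 0 ≤ s.im ∨ s = fold p := fun s hs => by
  obtain ⟨o, ho, rfl⟩ := List.mem_map.1 hs
  cases o with
  | none => exact nonneg_or_eq_fold p
  | some s => exact Or.inl (h.im_nonneg s ho)

/-- If the moving letter comes last, its distance from `a` can be small, but not smaller than the
length `‖fold p - a‖` of the chord; the quotient of the two stays bounded. -/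
lemma GoodWord.place_last {a : ℂ} {d : ℝ} {V : List (Option ℂ)} (h : GoodWord a d V) (p : ℂ) :
    ∀ s ∈ (place p V).getLast?, min d ‖fold p - a‖ ≤ ‖a - s‖ := fun s hs => by
  rw [place, List.getLast?_map] at hs
  obtain ⟨o, ho, rfl⟩ := Option.mem_map.1 hs
  cases o with
  | none => exact (min_le_right _ _).trans (norm_fold_sub_le h.base p)
  | some s => exact (min_le_left _ _).trans (h.last s ho)

lemma div_min_le {d ρ : ℝ} (hd : 0 < d) (hρ : 0 < ρ) : ρ / min d ρ ≤ 1 + ρ / d := by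
  rcases le_total d ρ with h | h
  · rw [min_eq_left h]; linarith
  · rw [min_eq_right h, div_self hρ.ne']
    have : 0 ≤ ρ / d := by positivity
    linarith

lemma pull_pth_self (lam mu : ℝ) (b : ℂ) (f : ℂ → ℂ) : pull (pth b b lam mu) f = 0 := by
  funext τ
  simp [pull, deriv_pth]

lemma GoodWord.tame {a : ℂ} {d δ : ℝ} {V : List (Option ℂ)} (h : GoodWord a d V) (hδ : 0 < δ)
    (hδ1 : δ ≤ 1) (p : ℂ) :
    Tame δ 4 ((1 + ‖fold p - a‖ / d) ^ δ) (wordKer (pth a (fold p) 1 1) (place p V)) := by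
  have hd := h.pos
  rcases eq_or_ne (fold p) a with he | hne
  · rw [he]
    have hz : ∀ k ∈ wordKer (pth a a 1 1) (place p V), k = 0 := fun k hk => by
      obtain ⟨s, -, rfl⟩ := List.mem_map.1 hk
      exact pull_pth_self 1 1 a _
    refine ⟨fun k hk => ?_, fun k hk τ hτ => ?_, fun k hk τ hτ => ?_⟩
    · rw [hz k hk]; exact continuousOn_const
    · rw [hz k hk]
      have : 0 < τ * (1 - τ) := mul_pos hτ.1 (by linarith [hτ.2])
      simp only [Pi.zero_apply, norm_zero]; positivity
    · rw [hz k (List.mem_of_mem_getLast? hk)]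
      have : 0 < τ * (1 - τ) := mul_pos hτ.1 (by linarith [hτ.2])
      have := ratioPow_nonneg (δ := δ) hτ
      simp only [Pi.zero_apply, norm_zero]; positivity
  · have hρ : 0 < ‖fold p - a‖ := norm_pos_iff.2 (sub_ne_zero.2 hne)
    have := tame_wordKer (d₁ := min d ‖fold p - a‖) hδ hδ1 one_pos le_rfl
      (isGoodPath_pth a (fold p) (by simp) (by simp))
      (fun s hs => avoids_eta h.base (fold_im_nonpos p) (h.place_im p s hs)) (by positivity)
      (h.place_last p)
    rw [div_one] at this
    refine this.mono (by norm_num) ?_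
    gcongr
    exact div_min_le hd hρ

lemma GoodWord.closedBound {a : ℂ} {d d₂ δ : ℝ} {o : Option ℂ} {V : List (Option ℂ)}
    (h : GoodWord a d (o :: V)) (hδ : 0 < δ) (hδ1 : 3 * δ ≤ 1) (p : ℂ) (hd₂ : 0 < d₂)
    (h₂ : d₂ ≤ ‖fold p - o.getD p‖) :
    ClosedBound δ (4 * (4 / δ) ^ V.length *
      ((1 + ‖fold p - a‖ / d) ^ δ * (‖fold p - a‖ / d₂) ^ (2 * δ)))
      (wordKer (pth a (fold p) 1 1) (place p (o :: V))) := by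
  have hd := h.pos
  rcases eq_or_ne (fold p) a with he | hne
  · rw [he]
    intro τ hτ
    have := betaKer_nonneg (δ := δ) hτ
    simp only [pull_pth_self, Pi.zero_apply, zero_mul, norm_zero]
    positivity
  · have hρ : 0 < ‖fold p - a‖ := norm_pos_iff.2 (sub_ne_zero.2 hne)
    have := closedBound_wordKer (d₁ := min d ‖fold p - a‖) hδ hδ1 one_pos le_rfl
      (isGoodPath_pth a (fold p) (lam := 1) (mu := 1) (by simp) (by simp))
      (fun s hs => avoids_eta h.base (fold_im_nonpos p) (h.place_im p s hs)) (by positivity)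
      (h.place_last p) hd₂ h₂
    rw [div_one, List.length_map] at this
    refine this.mono ?_
    gcongr
    exact div_min_le hd hρ

lemma integral_betaKer_nonneg (δ : ℝ) : 0 ≤ ∫ τ in (0 : ℝ)..1, betaKer δ τ := by
  refine intervalIntegral.integral_nonneg_of_ae_restrict zero_le_one ?_
  rw [← restrict_Ioo_eq_restrict_Icc]
  exact (ae_restrict_iff' measurableSet_Ioo).2 (Eventually.of_forall fun τ hτ => betaKer_nonneg hτ)

/-- The free parameter `d₂` serves all later needs: `‖p - s‖` near a pole, `p.im` for integrability,
half of `‖fold p - a‖` at infinity. -/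
lemma GoodWord.norm_wordInt_le {a : ℂ} {d δ : ℝ} {o : Option ℂ} {V : List (Option ℂ)}
    (h : GoodWord a d (o :: V)) (hδ : 0 < δ) (hδ1 : 3 * δ ≤ 1) :
    ∃ K : ℝ, 0 ≤ K ∧ ∀ (p : ℂ) (d₂ : ℝ), 0 < d₂ → d₂ ≤ ‖fold p - o.getD p‖ →
      ‖wordInt a (o :: V) p‖ ≤
        K * ((1 + ‖fold p - a‖) ^ δ * (‖fold p - a‖ / d₂) ^ (2 * δ)) := by
  have hd := h.pos
  have hb := integral_betaKer_nonneg δ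
  refine ⟨4 * (4 / δ) ^ V.length * (∫ τ in (0 : ℝ)..1, betaKer δ τ) * (1 + 1 / d) ^ δ,
    by positivity, fun p d₂ hd₂ h₂ => ?_⟩
  refine (norm_kerInt_one_le hδ (h.closedBound hδ hδ1 p hd₂ h₂)).trans ?_
  have h1 : (1 + ‖fold p - a‖ / d) ^ δ ≤ (1 + 1 / d) ^ δ * (1 + ‖fold p - a‖) ^ δ := by
    rw [← Real.mul_rpow (by positivity) (by positivity)]
    gcongr
    have : 0 ≤ 1 / d := by positivity
    have : 0 ≤ ‖fold p - a‖ := norm_nonneg _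
    have e : (1 + 1 / d) * (1 + ‖fold p - a‖) = 1 + ‖fold p - a‖ / d + (1 / d + ‖fold p - a‖) := by
      ring
    rw [e]
    linarith
  calc _ ≤ 4 * (4 / δ) ^ V.length * (((1 + 1 / d) ^ δ * (1 + ‖fold p - a‖) ^ δ) *
        (‖fold p - a‖ / d₂) ^ (2 * δ)) * ∫ τ in (0 : ℝ)..1, betaKer δ τ := by gcongr
    _ = _ := by ring

lemma wordInt_eq_zero {a p : ℂ} (o : Option ℂ) (V : List (Option ℂ)) (hp : fold p = a) :
    wordInt a (o :: V) p = 0 := by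
  rw [wordInt, hp]; exact kerInt_pth_self _ _ _ _ _

lemma continuous_pth_right (a : ℂ) (lam mu τ : ℝ) : Continuous fun b => pth a b lam mu τ := by
  unfold pth; fun_prop

lemma continuous_getD (o : Option ℂ) : Continuous fun p : ℂ => o.getD p := by
  cases o
  · exact continuous_id
  · exact continuous_const

lemma GoodWord.continuousAt_wordInt {a p₀ : ℂ} {d : ℝ} {o : Option ℂ} {V : List (Option ℂ)}
    (h : GoodWord a d (o :: V)) (hp : o.getD p₀ ≠ fold p₀) :
    ContinuousAt (wordInt a (o :: V)) p₀ := by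
  have hd₀ : 0 < ‖fold p₀ - o.getD p₀‖ := norm_pos_iff.2 (sub_ne_zero.2 hp.symm)
  set d₂ := ‖fold p₀ - o.getD p₀‖ / 2 with hd₂
  have hev : ∀ᶠ p in 𝓝 p₀, d₂ ≤ ‖fold p - o.getD p‖ :=
    ((continuous_fold.sub (continuous_getD o)).norm.continuousAt.eventually_const_le
      (by show d₂ < ‖fold p₀ - o.getD p₀‖; linarith))
  -- If the path shrinks to a point, dominated convergence does not apply, since the moving letter
  -- may run into the path; but the bound itself contains a positive power of `‖fold p - a‖`.
  rcases eq_or_ne (fold p₀) a with he | hne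
  · obtain ⟨K, hK, hb⟩ := h.norm_wordInt_le (δ := 1 / 8) (by norm_num) (by norm_num)
    rw [ContinuousAt, wordInt_eq_zero o V he]
    have hc : Continuous fun p => K * ((1 + ‖fold p - a‖) ^ (1 / 8 : ℝ) *
        (‖fold p - a‖ / d₂) ^ (2 * (1 / 8) : ℝ)) := by
      have := continuous_fold
      refine continuous_const.mul ((Continuous.rpow_const (by fun_prop) (by norm_num)).mul
        (Continuous.rpow_const (by fun_prop) (by norm_num)))
    have h0 := hc.tendsto p₀
    simp only [he, sub_self, norm_zero, zero_div] at h0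
    rw [Real.zero_rpow (by norm_num), mul_zero, mul_zero] at h0
    refine squeeze_zero_norm' ?_ h0
    filter_upwards [hev] with p hp'
    exact hb p d₂ (by positivity) hp'
  · have hρ : 0 < ‖fold p₀ - a‖ := norm_pos_iff.2 (sub_ne_zero.2 hne)
    have hd := h.pos
    set ρ₁ := ‖fold p₀ - a‖ + 1 with hρ₁
    have hev2 : ∀ᶠ p in 𝓝 p₀, ‖fold p - a‖ ≤ ρ₁ :=
      ((continuous_fold.sub continuous_const).norm.continuousAt.eventually_le_const
        (by simp [hρ₁]))
    have hmap : ∀ p, wordKer (pth a (fold p) 1 1) (place p (o :: V)) =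
      (o :: V).map fun s => pull (pth a (fold p) 1 1) (omega (s.getD p)) := fun p => by
      simp [wordKer, place, Function.comp_def]
    have key := tendsto_kerInt_one (F := 𝓝 p₀) (δ := 1 / 8) (C := 4) (θ := (1 + ρ₁ / d) ^ (1 / 8 : ℝ))
      (M := 4 * (4 / (1 / 8)) ^ V.length * ((1 + ρ₁ / d) ^ (1 / 8 : ℝ) *
        (ρ₁ / d₂) ^ (2 * (1 / 8) : ℝ))) (by norm_num) (by norm_num) (o :: V)
      (fun p s => pull (pth a (fold p) 1 1) (omega (s.getD p)))
      (fun s => pull (pth a (fold p₀) 1 1) (omega (s.getD p₀))) ?_ ?_ ?_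
    · simp only [← hmap] at key
      exact key
    · filter_upwards [hev2] with p hp2
      rw [← hmap]
      refine (h.tame (by norm_num) (by norm_num) p).mono (by norm_num) ?_
      gcongr
    · filter_upwards [hev, hev2] with p hp1 hp2
      rw [← hmap]
      refine (h.closedBound (by norm_num) (by norm_num) p (by positivity) hp1).mono ?_
      gcongr
    · intro s hs τ hτ
      have hav := avoids_eta h.base (fold_im_nonpos p₀)
        (h.place_im p₀ (s.getD p₀) (List.mem_map_of_mem hs)) τ hτ
      have h1 : 0 < 1 - τ := by linarith [hτ.2]
      have h0 := hτ.1
      have hnz : pth a (fold p₀) 1 1 τ - s.getD p₀ ≠ 0 :=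
        norm_pos_iff.1 (lt_of_lt_of_le (by positivity) hav)
      have hfold := continuous_fold
      have hc : ContinuousAt (fun p => pull (pth a (fold p) 1 1) (omega (s.getD p)) τ) p₀ := by
        simp only [pull, omega, deriv_pth]
        refine ContinuousAt.mul (continuousAt_const.mul (ContinuousAt.inv₀ ?_ hnz)) ?_
        · exact (((continuous_pth_right a 1 1 τ).comp continuous_fold).sub
            (continuous_getD s)).continuousAt
        · fun_prop
      exact hc

/-! ### The polylogarithms as iterated integrals along the standard path -/

lemma kerConverges_path {a b s : ℂ} {l : List ℂ} (ha : a.im ≤ 0) (hb : b.im ≤ 0)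
    (hl : ∀ s' ∈ s :: l, 0 ≤ s'.im) (hlast : a ≠ b → ∀ s' ∈ (s :: l).getLast?, s' ≠ a)
    (hsb : s ≠ b) : KerConverges (wordKer (path a b) (s :: l)) 1 := by
  rw [path_eq_pth]
  rcases eq_or_ne a b with rfl | hab
  · have hz : ∀ (l : List ℂ) (t : ℝ), KerConverges (wordKer (pth a a 0 1) l) t := by
      intro l
      induction l with
      | nil => exact fun t => trivial
      | cons s l ih =>
        intro t
        refine ⟨fun s _ => ih s, ?_⟩
        simp only [pull_pth_self, Pi.zero_apply, zero_mul]
        exact intervalIntegrable_const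
    exact hz _ 1
  · obtain ⟨d₁, hd₁, hd⟩ := exists_last_dist a (s :: l) (hlast hab)
    have hd₂ : 0 < ‖b - s‖ := norm_pos_iff.2 (sub_ne_zero.2 hsb.symm)
    have hg := isGoodPath_pth a b (lam := 0) (mu := 1) (by simp) (by simp)
    have hav : ∀ s' ∈ s :: l, Avoids 1 a b (pth a b 0 1) s' := fun s' hs' =>
      avoids_path ha hb (hl s' hs') (by simp)
    exact (tame_wordKer (δ := 1 / 8) (by norm_num) (by norm_num) one_pos le_rfl hg hav hd₁
      hd).kerConverges_one (by norm_num) (by norm_num)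
      (closedBound_wordKer (by norm_num) (by norm_num) one_pos le_rfl hg hav hd₁ hd hd₂ le_rfl)

lemma kerInt_path_eq_etaInt' {a b s : ℂ} {l : List ℂ} (ha : a.im ≤ 0) (hb : b.im ≤ 0)
    (hl : ∀ s' ∈ s :: l, 0 ≤ s'.im) (hlast : a ≠ b → ∀ s' ∈ (s :: l).getLast?, s' ≠ a)
    (hsb : s ≠ b) : kerInt (wordKer (path a b) (s :: l)) 1 = etaInt a (s :: l) b := by
  rcases eq_or_ne a b with rfl | hab
  · rw [path_eq_pth, etaInt, kerInt_pth_self, kerInt_pth_self]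
  · exact kerInt_path_eq_etaInt ha hb hl (hlast hab) hsb

/-! ### The Cauchy-Riemann operator -/

/-- The function `f` is real differentiable at `p`, and `g` is the value of
`∂f/∂x + i ∂f/∂y = 2 ∂f/∂p̄` at `p`. -/
def HasDbar (f : ℂ → ℂ) (g p : ℂ) : Prop :=
  ∃ f' : ℂ →L[ℝ] ℂ, HasFDerivAt f f' p ∧ f' 1 + I * f' I = g

lemma HasDbar.mul {f₁ f₂ : ℂ → ℂ} {g₁ g₂ p : ℂ} (h₁ : HasDbar f₁ g₁ p) (h₂ : HasDbar f₂ g₂ p) :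
    HasDbar (fun x => f₁ x * f₂ x) (g₁ * f₂ p + f₁ p * g₂) p := by
  obtain ⟨d₁, h₁, rfl⟩ := h₁
  obtain ⟨d₂, h₂, rfl⟩ := h₂
  refine ⟨_, h₁.mul h₂, ?_⟩
  simp only [add_apply, smul_apply, smul_eq_mul]
  ring

lemma HasDbar.add {f₁ f₂ : ℂ → ℂ} {g₁ g₂ p : ℂ} (h₁ : HasDbar f₁ g₁ p) (h₂ : HasDbar f₂ g₂ p) :
    HasDbar (fun x => f₁ x + f₂ x) (g₁ + g₂) p := by
  obtain ⟨d₁, h₁, rfl⟩ := h₁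
  obtain ⟨d₂, h₂, rfl⟩ := h₂
  refine ⟨_, h₁.add h₂, ?_⟩
  simp only [add_apply]
  ring

lemma HasDbar.neg {f : ℂ → ℂ} {g p : ℂ} (h : HasDbar f g p) : HasDbar (fun x => -f x) (-g) p := by
  obtain ⟨d, h, rfl⟩ := h
  refine ⟨_, h.neg, ?_⟩
  simp only [neg_apply]
  ring

lemma HasDbar.of_differentiableAt {f : ℂ → ℂ} {p : ℂ} (h : DifferentiableAt ℂ f p) :
    HasDbar f 0 p := by
  refine ⟨_, h.hasFDerivAt.restrictScalars ℝ, ?_⟩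
  have : (fderiv ℂ f p) I = I * fderiv ℂ f p 1 := by
    rw [← smul_eq_mul, ← map_smul, smul_eq_mul, mul_one]
  simp only [ContinuousLinearMap.coe_restrictScalars', this]
  rw [← mul_assoc, I_mul_I]; ring

lemma HasDbar.congr {f f₁ : ℂ → ℂ} {g p : ℂ} (h : HasDbar f g p) (he : f₁ =ᶠ[𝓝 p] f) :
    HasDbar f₁ g p := by
  obtain ⟨d, h, hg⟩ := h
  exact ⟨d, h.congr_of_eventuallyEq he, hg⟩

lemma HasDbar.continuousAt {f : ℂ → ℂ} {g p : ℂ} (h : HasDbar f g p) : ContinuousAt f p := by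
  obtain ⟨d, h, -⟩ := h
  exact h.continuousAt

/-! ### Derivatives with respect to the moving point -/

/-- The open lower half plane. -/
def lowerHalf : Set ℂ := {t | t.im < 0}

lemma isOpen_lowerHalf : IsOpen lowerHalf := isOpen_lt Complex.continuous_im continuous_const

lemma convex_lowerHalf : Convex ℝ lowerHalf := convex_halfSpace_im_lt 0

lemma mem_closure_lowerHalf {a : ℂ} (ha : a.im ≤ 0) : a ∈ closure lowerHalf := by
  have h : Tendsto (fun τ : ℝ => a - I * (τ : ℂ)) (𝓝[>] 0) (𝓝 a) := by
    have : Continuous fun τ : ℝ => a - I * (τ : ℂ) := by fun_prop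
    simpa using (this.tendsto 0).mono_left nhdsWithin_le_nhds
  refine mem_closure_of_tendsto h ?_
  filter_upwards [self_mem_nhdsWithin] with τ hτ
  have : (0 : ℝ) < τ := hτ
  simp [lowerHalf]
  linarith

lemma not_mem_lowerHalf {s : ℂ} (hs : 0 ≤ s.im) : s ∉ lowerHalf := not_lt.2 hs

lemma ball_subset_lowerHalf {t : ℂ} {r : ℝ} (h : t.im ≤ -r) : Metric.ball t r ⊆ lowerHalf := by
  intro x hx
  rw [mem_ball_iff_norm] at hx
  have := (abs_le.1 (Complex.abs_im_le_norm (x - t))).2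
  rw [Complex.sub_im] at this
  show x.im < 0
  linarith

lemma GoodWord.place_im_nonneg {a p : ℂ} {d : ℝ} {V : List (Option ℂ)} (h : GoodWord a d V)
    (hp : 0 ≤ p.im) : ∀ s ∈ place p V, 0 ≤ s.im := fun s hs => by
  obtain ⟨o, ho, rfl⟩ := List.mem_map.1 hs
  cases o with
  | none => exact hp
  | some s => exact h.im_nonneg s ho

lemma GoodWord.place_last_ne {a p : ℂ} {d : ℝ} {V : List (Option ℂ)} (h : GoodWord a d V)
    (hp : p ≠ a) : ∀ s ∈ (place p V).getLast?, s ≠ a := fun s hs => by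
  rw [place, List.getLast?_map] at hs
  obtain ⟨o, ho, rfl⟩ := Option.mem_map.1 hs
  cases o with
  | none => exact hp
  | some s =>
    have := h.pos.trans_le (h.last s ho)
    exact (sub_ne_zero.1 (norm_pos_iff.1 this)).symm

lemma GoodWord.wordInt_eq_segInt {a p : ℂ} {d : ℝ} {V : List (Option ℂ)} (h : GoodWord a d V)
    (hp : 0 < p.im) : wordInt a V p = segInt a (place p V) ((starRingEnd ℂ) p) := by
  have hb : ((starRingEnd ℂ) p).im < 0 := by simpa using hp
  rw [wordInt, fold_of_nonneg hp.le]
  refine (segInt_eq_etaInt h.base hb (fun s hs => Or.inl (h.place_im_nonneg hp.le s hs))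
    (h.place_last_ne fun e => ?_) fun s hs e => ?_).symm
  · have := h.base
    rw [← e] at this; linarith
  · have := h.place_im_nonneg hp.le s (List.mem_of_mem_head? hs)
    rw [e] at this; linarith

lemma GoodWord.wordInt_eq_segInt_of_neg {a p s : ℂ} {d : ℝ} {V : List (Option ℂ)}
    (h : GoodWord a d (some s :: V)) (hp : p.im < 0) (hpa : p ≠ a) :
    wordInt a (some s :: V) p = segInt a (place p (some s :: V)) p := by
  rw [wordInt, fold_of_neg hp]
  refine (segInt_eq_etaInt h.base hp (fun s hs => ?_) (h.place_last_ne hpa) fun s' hs' e => ?_).symm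
  · have := h.place_im p s hs
    rwa [fold_of_neg hp] at this
  · simp only [place, List.map_cons, List.head?_cons, Option.mem_some_iff, Option.getD_some] at hs'
    have := h.im_nonneg s (by simp)
    rw [hs', e] at this; linarith

/-- The position of the moving letter and the end point are decoupled into independent complex
variables; the actual function is the restriction to `(p, p̄)`. -/
lemma GoodWord.differentiableOn_segInt_joint {a : ℂ} {d : ℝ} {V : List (Option ℂ)}
    (h : GoodWord a d V) : DifferentiableOn ℂ (fun q : ℂ × ℂ => segInt a (place q.1 V) q.2)
      {q | 0 < q.1.im ∧ q.2.im < 0} := by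
  have hU : IsOpen {q : ℂ × ℂ | 0 < q.1.im ∧ q.2.im < 0} :=
    (isOpen_lt continuous_const (Complex.continuous_im.comp continuous_fst)).inter
      (isOpen_lt (Complex.continuous_im.comp continuous_snd) continuous_const)
  have := differentiableOn_segInt (δ := 1 / 8) (by norm_num) (by norm_num) hU a
    (V.map fun o => fun q : ℂ × ℂ => o.getD q.1) Prod.snd differentiableOn_snd ?_ ?_ ?_
  · simpa [place, Function.comp_def] using this
  · intro f hf
    obtain ⟨o, -, rfl⟩ := List.mem_map.1 hf
    cases o
    · exact differentiableOn_fst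
    · exact differentiableOn_const _
  · rintro ⟨ξ, t⟩ ⟨hξ, ht⟩ f hf τ hτ e
    obtain ⟨o, ho, rfl⟩ := List.mem_map.1 hf
    have h1 := h.place_im_nonneg hξ.le (o.getD ξ) (List.mem_map_of_mem ho)
    simp only at e ht
    rw [← e] at h1
    simp only [Complex.add_im, Complex.mul_im, Complex.ofReal_re, Complex.ofReal_im, zero_mul,
      add_zero, Complex.sub_im] at h1
    nlinarith [h.base, hτ.1, hτ.2, mul_pos hτ.1 (neg_pos.2 ht)]
  · rintro ⟨ξ₀, t₀⟩ ⟨hξ₀, ht₀⟩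
    simp only at hξ₀ ht₀
    set r := -t₀.im / 2 with hr
    have hr0 : 0 < r := by rw [hr]; linarith
    set R := ‖t₀ - a‖ + 1 with hR
    have hR0 : 0 < R := by positivity
    have hev : ∀ᶠ q : ℂ × ℂ in 𝓝 (ξ₀, t₀), ξ₀.im / 2 ≤ q.1.im ∧ q.2.im ≤ -r ∧ ‖q.2 - a‖ ≤ R := by
      refine Filter.Eventually.and ?_ (Filter.Eventually.and ?_ ?_)
      · exact (Complex.continuous_im.comp continuous_fst).continuousAt.eventually_const_le
          (by simpa using hξ₀)
      · exact (Complex.continuous_im.comp continuous_snd).continuousAt.eventually_le_const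
          (by simp [hr]; linarith)
      · exact (continuous_snd.sub continuous_const).norm.continuousAt.eventually_le_const
          (by simp [hR])
    have hd := h.pos
    refine ⟨_, hev, min 1 (r / R), min d (ξ₀.im / 2), r, by positivity, min_le_left _ _,
      by positivity, hr0, ?_⟩
    rintro ⟨ξ, t⟩ ⟨h1, h2, h3⟩
    simp only at h1 h2 h3
    have hξ : 0 ≤ ξ.im := by linarith
    have hb := ball_subset_lowerHalf h2
    refine ⟨fun f hf => ?_, fun f hf => ?_, fun f hf => ?_⟩
    · obtain ⟨o, ho, rfl⟩ := List.mem_map.1 hf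
      refine avoids_seg convex_lowerHalf (mem_closure_lowerHalf h.base) hr0.le hb
        (not_mem_lowerHalf (h.place_im_nonneg hξ (o.getD ξ) (List.mem_map_of_mem ho))) ?_
      calc min 1 (r / R) * ‖t - a‖ ≤ r / R * R := by gcongr; exact min_le_right _ _
        _ = r := by field_simp
    · rw [List.getLast?_map] at hf
      obtain ⟨o, ho, rfl⟩ := Option.mem_map.1 hf
      cases o with
      | none =>
        refine (min_le_right _ _).trans ?_
        have h4 := (abs_le.1 (Complex.abs_im_le_norm (a - ξ))).1
        rw [Complex.sub_im] at h4
        have := h.base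
        simp only [Option.getD_none]
        linarith
      | some s => exact (min_le_left _ _).trans (h.last s ho)
    · obtain ⟨o, ho, rfl⟩ := List.mem_map.1 (List.mem_of_mem_head? hf)
      exact dist_le_of_ball hb
        (not_mem_lowerHalf (h.place_im_nonneg hξ (o.getD ξ) (List.mem_map_of_mem ho)))

/-- On `(p, p̄)` the first variable contributes nothing to `∂/∂p̄`, while the derivative in the
second one, the end point, strips off the first letter. -/
lemma GoodWord.hasDbar_wordInt {a p s : ℂ} {d : ℝ} {V : List (Option ℂ)}
    (h : GoodWord a d (some s :: V)) (hp : 0 < p.im) :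
    HasDbar (wordInt a (some s :: V)) (2 * (omega s ((starRingEnd ℂ) p) * wordInt a V p)) p := by
  set S : ℂ × ℂ → ℂ := fun q => segInt a (place q.1 (some s :: V)) q.2 with hS
  have hU : IsOpen {q : ℂ × ℂ | 0 < q.1.im ∧ q.2.im < 0} :=
    (isOpen_lt continuous_const (Complex.continuous_im.comp continuous_fst)).inter
      (isOpen_lt (Complex.continuous_im.comp continuous_snd) continuous_const)
  have hb : ((starRingEnd ℂ) p).im < 0 := by simpa using hp
  have hd : HasFDerivAt S (fderiv ℂ S (p, (starRingEnd ℂ) p)) (p, (starRingEnd ℂ) p) :=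
    (h.differentiableOn_segInt_joint.differentiableAt (hU.mem_nhds ⟨hp, hb⟩)).hasFDerivAt
  set D := fderiv ℂ S (p, (starRingEnd ℂ) p) with hD
  have hpair : HasFDerivAt (fun x : ℂ => (x, (starRingEnd ℂ) x))
      ((ContinuousLinearMap.id ℝ ℂ).prod (Complex.conjCLE : ℂ →L[ℝ] ℂ)) p :=
    (hasFDerivAt_id p).prodMk (Complex.conjCLE : ℂ →L[ℝ] ℂ).hasFDerivAt
  have hcomp := (hd.restrictScalars ℝ).comp p hpair
  have ht : D (0, 1) = omega s ((starRingEnd ℂ) p) * wordInt a V p := by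
    have h1 : HasDerivAt (fun t : ℂ => S (p, t)) (D (0, 1)) ((starRingEnd ℂ) p) := by
      have := HasFDerivAt.comp_hasDerivAt ((starRingEnd ℂ) p) hd
        ((hasDerivAt_const ((starRingEnd ℂ) p) p).prodMk (hasDerivAt_id ((starRingEnd ℂ) p)))
      exact this
    have h2 := hasDerivAt_segInt_of_mem convex_lowerHalf isOpen_lowerHalf
      (mem_closure_lowerHalf h.base) hb (s := s) (l := place p V)
      (fun s' hs' => not_mem_lowerHalf (h.place_im_nonneg hp.le s' hs'))
      (h.place_last_ne fun e => by have := h.base; rw [← e] at this; linarith)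
    rw [h.tail.wordInt_eq_segInt hp]
    exact h1.unique h2
  have hI : D (I, -I) = I * D (1, 0) - I * D (0, 1) := by
    have : ((I, -I) : ℂ × ℂ) = I • (1, 0) - I • (0, 1) := by ext <;> simp
    rw [this, map_sub, map_smul, map_smul, smul_eq_mul, smul_eq_mul]
  have h1 : D (1, 1) = D (1, 0) + D (0, 1) := by
    rw [← map_add]; congr 1; ext <;> simp
  refine HasDbar.congr (f := fun x => S (x, (starRingEnd ℂ) x)) ⟨_, hcomp, ?_⟩ ?_
  · simp only [ContinuousLinearMap.comp_apply, ContinuousLinearMap.prod_apply,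
      ContinuousLinearMap.coe_restrictScalars', ContinuousLinearMap.id_apply,
      ContinuousLinearEquiv.coe_coe, Complex.conjCLE_apply, map_one, Complex.conj_I]
    rw [h1, hI, ← ht]
    linear_combination (D (1, 0) - D (0, 1)) * I_mul_I
  · filter_upwards [(isOpen_lt continuous_const Complex.continuous_im).mem_nhds hp] with x hx
    exact h.wordInt_eq_segInt hx

/-- Here letters and end point move together holomorphically. The first letter has to be constant,
for a moving letter in that place would sit at the end point and make the integral diverge. At `p =
a` the moving letter would meet the base point. -/
lemma GoodWord.differentiableAt_wordInt {a p s : ℂ} {d : ℝ} {V : List (Option ℂ)}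
    (h : GoodWord a d (some s :: V)) (hp : p.im < 0) (hpa : p ≠ a) :
    DifferentiableAt ℂ (wordInt a (some s :: V)) p := by
  set U : Set (ℂ × ℂ) := {q | q.2.im < 0 ∧ q.2 ≠ a} with hUdef
  have hU : IsOpen U := (isOpen_lt (Complex.continuous_im.comp continuous_snd)
    continuous_const).inter (isOpen_ne_fun continuous_snd continuous_const)
  have hs0 : 0 ≤ s.im := h.im_nonneg s (by simp)
  have key := differentiableOn_segInt (δ := 1 / 8) (by norm_num) (by norm_num) hU a
    ((some s :: V).map fun o => fun q : ℂ × ℂ => o.getD q.2) Prod.snd differentiableOn_snd ?_ ?_ ?_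
  · have hfun : (fun q : ℂ × ℂ => segInt a (((some s :: V).map fun o => fun q : ℂ × ℂ =>
        o.getD q.2).map fun s => s q) q.2) = fun q => segInt a (place q.2 (some s :: V)) q.2 := by
      simp [place, Function.comp_def]
    rw [hfun] at key
    have h1 := (key.differentiableAt (hU.mem_nhds (show (p, p) ∈ U from ⟨hp, hpa⟩)))
    have h2 : DifferentiableAt ℂ (fun x : ℂ => segInt a (place x (some s :: V)) x) p :=
      DifferentiableAt.comp (f := fun x : ℂ => (x, x)) p h1
        (differentiableAt_id.prodMk differentiableAt_id)
    refine h2.congr_of_eventuallyEq ?_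
    filter_upwards [(isOpen_lt Complex.continuous_im continuous_const).mem_nhds hp,
      isOpen_ne.mem_nhds hpa] with x hx hxa
    exact h.wordInt_eq_segInt_of_neg hx hxa
  · intro f hf
    obtain ⟨o, -, rfl⟩ := List.mem_map.1 hf
    cases o
    · exact differentiableOn_snd
    · exact differentiableOn_const _
  · rintro ⟨ξ, t⟩ ⟨ht, hta⟩ f hf τ hτ e
    obtain ⟨o, ho, rfl⟩ := List.mem_map.1 hf
    simp only at e ht hta
    cases o with
    | none =>
      simp only [Option.getD_none] at e
      have : ((1 - τ : ℝ) : ℂ) * (t - a) = 0 := by push_cast; linear_combination -e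
      rcases mul_eq_zero.1 this with h1 | h1
      · have := hτ.2
        have : (1 - τ : ℝ) = 0 := by exact_mod_cast h1
        linarith
      · exact hta (sub_eq_zero.1 h1)
    | some s' =>
      have h1 := h.im_nonneg s' ho
      simp only [Option.getD_some] at e
      rw [← e] at h1
      simp only [Complex.add_im, Complex.mul_im, Complex.ofReal_re, Complex.ofReal_im, zero_mul,
        add_zero, Complex.sub_im] at h1
      nlinarith [h.base, hτ.1, hτ.2, mul_pos hτ.1 (neg_pos.2 ht)]
  · rintro ⟨ξ₀, t₀⟩ ⟨ht₀, hta₀⟩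
    simp only at hta₀ ht₀
    have hρ : 0 < ‖t₀ - a‖ := norm_pos_iff.2 (sub_ne_zero.2 hta₀)
    set r := -t₀.im / 2 with hr
    have hr0 : 0 < r := by rw [hr]; linarith
    set R := ‖t₀ - a‖ + 1 with hR
    have hR0 : 0 < R := by positivity
    have hev : ∀ᶠ q : ℂ × ℂ in 𝓝 (ξ₀, t₀), ‖t₀ - a‖ / 2 ≤ ‖q.2 - a‖ ∧ q.2.im ≤ -r ∧
        ‖q.2 - a‖ ≤ R := by
      refine Filter.Eventually.and ?_ (Filter.Eventually.and ?_ ?_)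
      · exact (continuous_snd.sub continuous_const).norm.continuousAt.eventually_const_le
          (by simpa using sub_ne_zero.2 hta₀)
      · exact (Complex.continuous_im.comp continuous_snd).continuousAt.eventually_le_const
          (by simp [hr]; linarith)
      · exact (continuous_snd.sub continuous_const).norm.continuousAt.eventually_le_const
          (by simp [hR])
    have hd := h.pos
    refine ⟨_, hev, min 1 (r / R), min d (‖t₀ - a‖ / 2), r, by positivity, min_le_left _ _,
      by positivity, hr0, ?_⟩
    rintro ⟨ξ, t⟩ ⟨h1, h2, h3⟩
    simp only at h1 h2 h3
    have hb := ball_subset_lowerHalf h2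
    refine ⟨fun f hf => ?_, fun f hf => ?_, fun f hf => ?_⟩
    · obtain ⟨o, ho, rfl⟩ := List.mem_map.1 hf
      cases o with
      | none =>
        intro τ hτ
        have h1τ : 0 < 1 - τ := by linarith [hτ.2]
        have h0 := hτ.1
        have e1 : ‖pth a t 0 0 τ - t‖ = (1 - τ) * ‖t - a‖ := by
          rw [pth_seg, show a + τ * (t - a) - t = -(((1 - τ : ℝ) : ℂ) * (t - a)) by
            push_cast; ring, norm_neg, norm_mul, Complex.norm_real, Real.norm_of_nonneg h1τ.le]
        simp only [Option.getD_none]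
        rw [e1]
        calc min 1 (r / R) * ‖t - a‖ * (τ * (1 - τ)) ≤ 1 * ‖t - a‖ * (1 * (1 - τ)) := by
              gcongr
              · exact min_le_left _ _
              · exact hτ.2.le
          _ = _ := by ring
      | some s' =>
        refine avoids_seg convex_lowerHalf (mem_closure_lowerHalf h.base) hr0.le hb
          (not_mem_lowerHalf (h.im_nonneg s' ho)) ?_
        calc min 1 (r / R) * ‖t - a‖ ≤ r / R * R := by gcongr; exact min_le_right _ _
          _ = r := by field_simp
    · rw [List.getLast?_map] at hf
      obtain ⟨o, ho, rfl⟩ := Option.mem_map.1 hf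
      cases o with
      | none =>
        refine (min_le_right _ _).trans ?_
        rw [norm_sub_rev] at h1
        simpa [norm_sub_rev] using h1
      | some s => exact (min_le_left _ _).trans (h.last s ho)
    · simp only [List.map_cons, List.head?_cons, Option.mem_some_iff] at hf
      subst hf
      exact dist_le_of_ball hb (not_mem_lowerHalf hs0)

/-! ### Stokes' theorem in the plane -/

lemma integral_rect_eq_setIntegral {g : ℂ → ℂ} (hg : Integrable g) {a b c d : ℝ} (hab : a ≤ b)
    (hcd : c ≤ d) : ∫ x in a..b, ∫ y in c..d, g (x + y * I) = ∫ p in Ioc a b ×ℂ Ioc c d, g p := by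
  have hmp := Complex.volume_preserving_equiv_real_prod
  have hemb := Complex.measurableEquivRealProd.measurableEmbedding
  have h1 := hmp.setIntegral_preimage_emb hemb (fun q : ℝ × ℝ => g (q.1 + q.2 * I))
    (Ioc a b ×ˢ Ioc c d)
  have h2 : ∀ p : ℂ, g ((Complex.measurableEquivRealProd p).1 +
      (Complex.measurableEquivRealProd p).2 * I) = g p := fun p => by
    congr 1
    exact Complex.re_add_im p
  have h_int : Integrable (fun q : ℝ × ℝ => g (q.1 + q.2 * I)) := by
    rw [← hmp.integrable_comp_emb hemb]
    refine hg.congr (Eventually.of_forall fun p => ?_)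
    exact (h2 p).symm
  simp only [h2] at h1
  rw [intervalIntegral.integral_of_le hab]
  simp only [intervalIntegral.integral_of_le hcd]
  rw [← setIntegral_prod (fun q : ℝ × ℝ => g (q.1 + q.2 * I)) h_int.integrableOn]
  exact h1.symm

lemma integral_boundary_rect {E d : ℂ → ℂ} {N : Set ℂ} (hN : N.Countable) (hE : Continuous E)
    (hd : Integrable d) {a b c e : ℝ} (hab : a ≤ b) (hce : c ≤ e)
    (hdb : ∀ p : ℂ, p.im ∈ Ioo c e → p ∉ N → HasDbar E (d p) p) :
    (((∫ x in a..b, E (x + c * I)) - ∫ x in a..b, E (x + e * I)) + I • ∫ y in c..e, E (b + y * I))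
      - I • (∫ y in c..e, E (a + y * I)) = I * ∫ p in Ioc a b ×ℂ Ioc c e, d p := by
  classical
  -- The default is chosen such that `f' 1 + I * f' I = d p` holds everywhere, also at the
  -- exceptional points.
  set f' : ℂ → ℂ →L[ℝ] ℂ := fun p => if h : HasDbar E (d p) p then h.choose else
    Complex.reCLM.smulRight (d p) with hf'
  have hf'd : ∀ p, I • f' p 1 - f' p I = I * d p := fun p => by
    have : f' p 1 + I * f' p I = d p := by
      by_cases h : HasDbar E (d p) p
      · simp only [hf', dif_pos h]; exact h.choose_spec.2
      · simp [hf', dif_neg h]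
    rw [← this, smul_eq_mul]
    linear_combination -(f' p I) * I_mul_I
  have key := Complex.integral_boundary_rect_of_hasFDerivAt_real_off_countable E f'
    (a + c * I) (b + e * I) N hN hE.continuousOn ?_ ?_
  · simp only [Complex.add_re, Complex.ofReal_re, Complex.mul_re, Complex.I_re, mul_zero,
      Complex.ofReal_im, Complex.I_im, mul_one, sub_self, add_zero, Complex.add_im, Complex.mul_im,
      zero_add, hf'd] at key
    rw [key, integral_rect_eq_setIntegral (hd.const_mul I) hab hce, integral_const_mul]
  · rintro p ⟨⟨-, h2⟩, h3⟩
    simp only [Complex.add_im, Complex.ofReal_im, Complex.mul_im, Complex.ofReal_re, Complex.I_im,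
      mul_one, Complex.I_re, mul_zero, add_zero, zero_add, min_eq_left hce, max_eq_right hce] at h2
    have h := hdb p h2 h3
    simp only [hf', dif_pos h]
    exact h.choose_spec.1
  · simp only [hf'd]
    exact (hd.const_mul I).integrableOn

/-- Stokes on growing squares: the perimeter grows like `n` while `E` is `o(1 / n)` on it. -/
lemma integral_eq_zero_of_hasDbar {E d : ℂ → ℂ} {N : Set ℂ} (hN : N.Countable) (hE : Continuous E)
    (hd : Integrable d) (hdb : ∀ p : ℂ, p.im ≠ 0 → p ∉ N → HasDbar E (d p) p)
    (hinf : Tendsto (fun p => p * E p) (Bornology.cobounded ℂ) (𝓝 0)) : ∫ p, d p = 0 := by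
  set box : ℕ → Set ℂ := fun n => Ioc (-(n : ℝ)) n ×ℂ Ioc (-(n : ℝ)) n with hbox
  have hmeas : ∀ (a b c e : ℝ), MeasurableSet (Ioc a b ×ℂ Ioc c e) := fun a b c e =>
    (Complex.measurable_re measurableSet_Ioc).inter (Complex.measurable_im measurableSet_Ioc)
  have hmono : Monotone box := fun m n hmn p hp => by
    have : (m : ℝ) ≤ n := by exact_mod_cast hmn
    obtain ⟨⟨h1, h2⟩, h3, h4⟩ := hp
    exact ⟨⟨by linarith, by linarith⟩, ⟨by linarith, by linarith⟩⟩
  have hun : ⋃ n, box n = univ := by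
    refine eq_univ_of_forall fun p => mem_iUnion.2 ?_
    obtain ⟨n, hn⟩ := exists_nat_gt (max |p.re| |p.im|)
    have h1 := abs_lt.1 ((le_max_left _ _).trans_lt hn)
    have h2 := abs_lt.1 ((le_max_right _ _).trans_lt hn)
    exact ⟨n, ⟨h1.1, h1.2.le⟩, ⟨h2.1, h2.2.le⟩⟩
  have hlim : Tendsto (fun n => ∫ p in box n, d p) atTop (𝓝 (∫ p, d p)) := by
    have := tendsto_setIntegral_of_monotone (f := d) (μ := volume) (fun n => hmeas _ _ _ _) hmono
      hd.integrableOn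
    rwa [hun, setIntegral_univ] at this
  have hlim0 : Tendsto (fun n => ∫ p in box n, d p) atTop (𝓝 0) := by
    rw [Metric.tendsto_atTop]
    intro ε hε
    have h1 := mem_map.1 (hinf (Metric.ball_mem_nhds 0 (by positivity : 0 < ε / 16)))
    obtain ⟨R, -, hR⟩ := (Filter.HasBasis.mem_iff (Metric.hasBasis_cobounded_compl_closedBall
      (0 : ℂ))).1 h1
    obtain ⟨n₀, hn₀⟩ := exists_nat_gt (max R 0)
    refine ⟨n₀, fun n hn => ?_⟩
    have hnR : (n₀ : ℝ) ≤ n := by exact_mod_cast hn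
    have hn0 : (0 : ℝ) < n := by linarith [le_max_right R 0]
    have hRn : R < n := by linarith [le_max_left R 0]
    have hb : ∀ p : ℂ, (n : ℝ) ≤ ‖p‖ → ‖E p‖ ≤ ε / 16 / n := fun p hp => by
      have h2 : p ∈ (Metric.closedBall (0 : ℂ) R)ᶜ := by
        simp only [mem_compl_iff, mem_closedBall_zero_iff, not_le]; linarith
      have h3 : ‖p * E p‖ < ε / 16 := by simpa using hR h2
      rw [norm_mul] at h3
      rw [le_div_iff₀ hn0]
      nlinarith [norm_nonneg (E p)]
    -- The square is cut along the real axis, where `E` is only known to be continuous; the two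
    -- integrals along the cut cancel.
    have e1 := integral_boundary_rect hN hE hd (a := -n) (b := n) (c := -n) (e := 0)
      (by linarith) (by linarith) fun p hp hpN => hdb p hp.2.ne hpN
    have e2 := integral_boundary_rect hN hE hd (a := -n) (b := n) (c := 0) (e := n)
      (by linarith) (by linarith) fun p hp hpN => hdb p hp.1.ne' hpN
    have hsplit : ∫ p in box n, d p = (∫ p in Ioc (-(n : ℝ)) n ×ℂ Ioc (-(n : ℝ)) 0, d p) +
        ∫ p in Ioc (-(n : ℝ)) n ×ℂ Ioc (0 : ℝ) n, d p := by
      have hset : box n = Ioc (-(n : ℝ)) n ×ℂ Ioc (-(n : ℝ)) 0 ∪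
          Ioc (-(n : ℝ)) n ×ℂ Ioc (0 : ℝ) n := by
        rw [hbox]
        ext p
        simp only [mem_reProdIm, mem_union, mem_Ioc]
        constructor
        · rintro ⟨h1, h2⟩
          rcases le_or_gt p.im 0 with h | h
          · exact Or.inl ⟨h1, h2.1, h⟩
          · exact Or.inr ⟨h1, h, h2.2⟩
        · rintro (⟨h1, h2⟩ | ⟨h1, h2⟩)
          · exact ⟨h1, h2.1, by linarith⟩
          · exact ⟨h1, by linarith, h2.2⟩
      rw [hset]
      refine setIntegral_union ?_ (hmeas _ _ _ _) hd.integrableOn hd.integrableOn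
      rw [Set.disjoint_left]
      rintro p ⟨-, h1⟩ ⟨-, h2⟩
      exact absurd h1.2 (not_le.2 h2.1)
    set T1 := ∫ x in (-(n : ℝ))..n, E (x + ((-n : ℝ) : ℂ) * I) with hT1
    set T2 := ∫ x in (-(n : ℝ))..n, E (x + ((n : ℝ) : ℂ) * I) with hT2
    set T3 := ∫ y in (-(n : ℝ))..0, E (((n : ℝ) : ℂ) + y * I) with hT3
    set T4 := ∫ y in (-(n : ℝ))..0, E (((-n : ℝ) : ℂ) + y * I) with hT4
    set T5 := ∫ y in (0 : ℝ)..n, E (((n : ℝ) : ℂ) + y * I) with hT5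
    set T6 := ∫ y in (0 : ℝ)..n, E (((-n : ℝ) : ℂ) + y * I) with hT6
    have htot : I * ∫ p in box n, d p = T1 - T2 + I * T3 - I * T4 + I * T5 - I * T6 := by
      rw [hsplit, mul_add, ← e1, ← e2]
      simp only [smul_eq_mul]
      ring
    have him : ∀ p : ℂ, |p.im| = n → ‖E p‖ ≤ ε / 16 / n := fun p hp =>
      hb p (hp ▸ Complex.abs_im_le_norm p)
    have hre : ∀ p : ℂ, |p.re| = n → ‖E p‖ ≤ ε / 16 / n := fun p hp =>
      hb p (hp ▸ Complex.abs_re_le_norm p)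
    have hq : ε / 16 / n * n = ε / 16 := by field_simp
    have b1 : ‖T1‖ ≤ ε / 8 := by
      refine (intervalIntegral.norm_integral_le_of_norm_le_const (C := ε / 16 / n)
        fun x _ => him _ (by simp)).trans ?_
      rw [abs_of_nonneg (by linarith)]; linarith
    have b2 : ‖T2‖ ≤ ε / 8 := by
      refine (intervalIntegral.norm_integral_le_of_norm_le_const (C := ε / 16 / n)
        fun x _ => him _ (by simp)).trans ?_
      rw [abs_of_nonneg (by linarith)]; linarith
    have b3 : ‖T3‖ ≤ ε / 16 := by
      refine (intervalIntegral.norm_integral_le_of_norm_le_const (C := ε / 16 / n)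
        fun x _ => hre _ (by simp)).trans ?_
      rw [abs_of_nonneg (by linarith)]; linarith
    have b4 : ‖T4‖ ≤ ε / 16 := by
      refine (intervalIntegral.norm_integral_le_of_norm_le_const (C := ε / 16 / n)
        fun x _ => hre _ (by simp)).trans ?_
      rw [abs_of_nonneg (by linarith)]; linarith
    have b5 : ‖T5‖ ≤ ε / 16 := by
      refine (intervalIntegral.norm_integral_le_of_norm_le_const (C := ε / 16 / n)
        fun x _ => hre _ (by simp)).trans ?_
      rw [abs_of_nonneg (by linarith)]; linarith
    have b6 : ‖T6‖ ≤ ε / 16 := by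
      refine (intervalIntegral.norm_integral_le_of_norm_le_const (C := ε / 16 / n)
        fun x _ => hre _ (by simp)).trans ?_
      rw [abs_of_nonneg (by linarith)]; linarith
    have hI : ∀ x : ℂ, ‖I * x‖ = ‖x‖ := fun x => by rw [norm_mul, norm_I, one_mul]
    rw [dist_zero_right, ← hI, htot]
    have n1 := norm_sub_le (T1 - T2 + I * T3 - I * T4 + I * T5) (I * T6)
    have n2 := norm_add_le (T1 - T2 + I * T3 - I * T4) (I * T5)
    have n3 := norm_sub_le (T1 - T2 + I * T3) (I * T4)
    have n4 := norm_add_le (T1 - T2) (I * T3)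
    have n5 := norm_sub_le T1 T2
    rw [hI] at n1 n2 n3 n4
    linarith
  exact tendsto_nhds_unique hlim hlim0

/-! ### Removal of poles -/

/-- The chain rule has this simple form because `h` is real-valued, so that its derivative takes
real values. -/
lemma HasDbar.real_comp {h : ℂ → ℝ} {σ : ℝ → ℝ} {σ' : ℝ} {g p : ℂ}
    (hh : HasDbar (fun x => (h x : ℂ)) g p) (hσ : HasDerivAt σ σ' (h p)) :
    HasDbar (fun x => ((σ (h x) : ℝ) : ℂ)) (σ' * g) p := by
  obtain ⟨f', hf, rfl⟩ := hh
  have h1 : HasFDerivAt h (Complex.reCLM.comp f') p := by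
    have := Complex.reCLM.hasFDerivAt.comp p hf
    exact this
  have h2 : f' = Complex.ofRealCLM.comp (Complex.reCLM.comp f') :=
    hf.unique (Complex.ofRealCLM.hasFDerivAt.comp p h1)
  have h3 := Complex.ofRealCLM.hasFDerivAt.comp p (hσ.comp_hasFDerivAt p h1)
  refine ⟨_, h3, ?_⟩
  have e1 : f' 1 = ((f' 1).re : ℂ) := by conv_lhs => rw [h2]; simp
  have eI : f' I = ((f' I).re : ℂ) := by conv_lhs => rw [h2]; simp
  simp only [ContinuousLinearMap.comp_apply, smul_apply, smul_eq_mul,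
    Complex.ofRealCLM_apply, Complex.reCLM_apply, Complex.ofReal_mul]
  rw [← e1, ← eI]
  ring

lemma hasDbar_conj {m : ℂ → ℂ} {m' p : ℂ} (h : HasDerivAt m m' p) :
    HasDbar (fun x => (starRingEnd ℂ) (m x)) (2 * (starRingEnd ℂ) m') p := by
  have h1 := (Complex.conjCLE : ℂ →L[ℝ] ℂ).hasFDerivAt.comp p (h.hasFDerivAt.restrictScalars ℝ)
  refine ⟨_, h1, ?_⟩
  simp [mul_comm]
  linear_combination (-(starRingEnd ℂ) m') * I_mul_I

lemma hasDbar_normSq {m : ℂ → ℂ} {m' p : ℂ} (h : HasDerivAt m m' p) :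
    HasDbar (fun x => ((Complex.normSq (m x) : ℝ) : ℂ)) (2 * (m p * (starRingEnd ℂ) m')) p := by
  have := (HasDbar.of_differentiableAt h.differentiableAt).mul (hasDbar_conj h)
  simp only [Complex.mul_conj] at this
  have e : 2 * (m p * (starRingEnd ℂ) m') = 0 * (starRingEnd ℂ) (m p) +
    m p * (2 * (starRingEnd ℂ) m') := by ring
  rw [e]; exact this

/-- A smooth function that vanishes near the zeros of `(p - u) (p - v)` and is one away from
them. -/
def cutoff (u v : ℂ) (ε : ℝ) (p : ℂ) : ℝ :=
  Real.smoothTransition ((ε ^ 2)⁻¹ * Complex.normSq ((p - u) * (p - v)) - 1)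

/-- The value of `2 ∂/∂p̄` on the cut-off function. -/
def cutoffDbar (u v : ℂ) (ε : ℝ) (p : ℂ) : ℂ :=
  (deriv Real.smoothTransition ((ε ^ 2)⁻¹ * Complex.normSq ((p - u) * (p - v)) - 1) : ℝ) *
    ((((ε ^ 2)⁻¹ : ℝ) : ℂ) * (2 * ((p - u) * (p - v) * (starRingEnd ℂ) ((p - v) + (p - u)))))

lemma differentiable_smoothTransition : Differentiable ℝ Real.smoothTransition :=
  (Real.smoothTransition.contDiff (n := 1)).differentiable (by norm_num)

lemma continuous_deriv_smoothTransition : Continuous (deriv Real.smoothTransition) :=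
  (Real.smoothTransition.contDiff (n := 1)).continuous_deriv (by norm_num)

lemma deriv_smoothTransition_eq_zero {x : ℝ} (hx : x ∉ Icc (0 : ℝ) 1) :
    deriv Real.smoothTransition x = 0 := by
  rw [mem_Icc, not_and_or, not_le, not_le] at hx
  rcases hx with h | h
  · have : Real.smoothTransition =ᶠ[𝓝 x] fun _ => 0 := by
      filter_upwards [Iio_mem_nhds h] with t ht using Real.smoothTransition.zero_of_nonpos ht.le
    rw [this.deriv_eq, deriv_const]
  · have : Real.smoothTransition =ᶠ[𝓝 x] fun _ => 1 := by
      filter_upwards [Ioi_mem_nhds h] with t ht using Real.smoothTransition.one_of_one_le ht.le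
    rw [this.deriv_eq, deriv_const]

lemma exists_deriv_smoothTransition_le : ∃ M : ℝ, 0 ≤ M ∧ ∀ x, |deriv Real.smoothTransition x| ≤ M := by
  obtain ⟨M, hM⟩ := continuous_deriv_smoothTransition.bounded_above_of_compact_support
    (HasCompactSupport.intro isCompact_Icc fun x hx => deriv_smoothTransition_eq_zero hx)
  exact ⟨M, (norm_nonneg _).trans (hM 0), hM⟩

lemma continuous_cutoff (u v : ℂ) (ε : ℝ) : Continuous (cutoff u v ε) := by
  have := differentiable_smoothTransition.continuous
  unfold cutoff
  exact this.comp (by fun_prop)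

lemma continuous_cutoffDbar (u v : ℂ) (ε : ℝ) : Continuous (cutoffDbar u v ε) := by
  unfold cutoffDbar
  refine Continuous.mul ?_ (by fun_prop)
  exact Complex.continuous_ofReal.comp (continuous_deriv_smoothTransition.comp (by fun_prop))

lemma hasDbar_cutoff (u v : ℂ) (ε : ℝ) (p : ℂ) :
    HasDbar (fun x => (cutoff u v ε x : ℂ)) (cutoffDbar u v ε p) p := by
  have h1 : HasDerivAt (fun x : ℂ => (x - u) * (x - v)) ((p - v) + (p - u)) p := by
    have := ((hasDerivAt_id p).sub_const u).mul ((hasDerivAt_id p).sub_const v)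
    refine this.congr_deriv ?_
    simp
  have h2 : HasDerivAt (fun t : ℝ => (ε ^ 2)⁻¹ * t - 1) (ε ^ 2)⁻¹
      (Complex.normSq ((p - u) * (p - v))) := by
    simpa using ((hasDerivAt_id _).const_mul (ε ^ 2)⁻¹).sub_const (1 : ℝ)
  exact ((hasDbar_normSq h1).real_comp h2).real_comp
    (differentiable_smoothTransition _).hasDerivAt

lemma tendsto_cutoff {u v p : ℂ} (hu : p ≠ u) (hv : p ≠ v) :
    Tendsto (fun ε => (cutoff u v ε p : ℂ)) (𝓝[>] 0) (𝓝 1) := by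
  have hpos : 0 < Complex.normSq ((p - u) * (p - v)) :=
    Complex.normSq_pos.2 (mul_ne_zero (sub_ne_zero.2 hu) (sub_ne_zero.2 hv))
  have h : ∀ᶠ ε in 𝓝[>] (0 : ℝ), (cutoff u v ε p : ℂ) = 1 := by
    have hc : Continuous fun ε : ℝ => 2 * ε ^ 2 := by fun_prop
    have := (hc.continuousAt (x := 0)).eventually_lt_const
      (u := Complex.normSq ((p - u) * (p - v))) (by simpa only [zero_pow two_ne_zero, mul_zero] using hpos)
    filter_upwards [nhdsWithin_le_nhds this, self_mem_nhdsWithin] with ε h1 h2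
    have h2' : 0 < ε := h2
    have : 2 ≤ (ε ^ 2)⁻¹ * Complex.normSq ((p - u) * (p - v)) := by
      rw [inv_mul_eq_div, le_div_iff₀ (by positivity)]; exact h1.le
    rw [cutoff, Real.smoothTransition.one_of_one_le (by linarith), Complex.ofReal_one]
  exact tendsto_const_nhds.congr' (h.mono fun _ h => h.symm)

lemma cutoff_eventually_zero {u v q : ℂ} {ε : ℝ} (hε : 0 < ε) (hq : (q - u) * (q - v) = 0) :
    ∀ᶠ p in 𝓝 q, cutoff u v ε p = 0 := by
  have hc : Continuous fun p : ℂ => Complex.normSq ((p - u) * (p - v)) := by fun_prop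
  have := (hc.continuousAt (x := q)).eventually_lt_const (u := ε ^ 2) (by show Complex.normSq ((q - u) * (q - v)) < ε ^ 2; rw [hq, map_zero]; positivity)
  filter_upwards [this] with p hp
  refine Real.smoothTransition.zero_of_nonpos ?_
  have : (ε ^ 2)⁻¹ * Complex.normSq ((p - u) * (p - v)) ≤ 1 := by
    rw [inv_mul_eq_div, div_le_one (by positivity)]; exact hp.le
  linarith

lemma norm_cutoff_le (u v : ℂ) (ε : ℝ) (p : ℂ) : ‖(cutoff u v ε p : ℂ)‖ ≤ 1 := by
  rw [Complex.norm_real, cutoff, Real.norm_of_nonneg (Real.smoothTransition.nonneg _)]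
  exact Real.smoothTransition.le_one _

lemma norm_sub_le_of_cutoffDbar_ne_zero {u v p : ℂ} {ε : ℝ} (hε : 0 < ε)
    (h : cutoffDbar u v ε p ≠ 0) : ‖p - u‖ * ‖p - v‖ ≤ 2 * ε ∧ p ≠ u ∧ p ≠ v := by
  have h1 : (ε ^ 2)⁻¹ * Complex.normSq ((p - u) * (p - v)) - 1 ∈ Icc (0 : ℝ) 1 := by
    by_contra hx
    exact h (by rw [cutoffDbar, deriv_smoothTransition_eq_zero hx]; simp)
  have h2 : (ε ^ 2)⁻¹ * Complex.normSq ((p - u) * (p - v)) ≤ 2 := by linarith [h1.2]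
  rw [inv_mul_eq_div, div_le_iff₀ (by positivity), Complex.normSq_eq_norm_sq, norm_mul] at h2
  refine ⟨?_, ?_, ?_⟩
  · refine le_of_sq_le_sq ?_ (by positivity)
    nlinarith
  · rintro rfl; exact h (by simp [cutoffDbar])
  · rintro rfl; exact h (by simp [cutoffDbar])

lemma norm_mul_cutoffDbar_le {u v p : ℂ} {M ε r η : ℝ} {E : ℂ → ℂ}
    (hM : ∀ x, |deriv Real.smoothTransition x| ≤ M) (hM0 : 0 ≤ M) (hη : 0 ≤ η) (hε : 0 < ε)
    (hD : 0 < ‖u - v‖) (hr : 4 * ε / ‖u - v‖ ≤ r) (hrD : r ≤ ‖u - v‖)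
    (hu : ∀ p, ‖p - u‖ ≤ r → p ≠ u → ‖(p - u) * E p‖ ≤ η)
    (hsep : ‖u - v‖ / 2 ≤ ‖p - v‖) (h : cutoffDbar u v ε p ≠ 0) :
    ‖p - u‖ ≤ 4 * ε / ‖u - v‖ ∧ ‖E p * cutoffDbar u v ε p‖ ≤ 12 * M * ‖u - v‖ ^ 2 * η / ε ^ 2 := by
  obtain ⟨h1, hpu, -⟩ := norm_sub_le_of_cutoffDbar_ne_zero hε h
  set D := ‖u - v‖ with hDdef
  have h2 : ‖p - u‖ ≤ 4 * ε / D := by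
    rw [le_div_iff₀ hD]
    nlinarith [norm_nonneg (p - u)]
  refine ⟨h2, ?_⟩
  have h3 : ‖p - u‖ ≤ D := h2.trans (hr.trans hrD)
  have h4 : ‖p - v‖ ≤ 2 * D := by
    calc ‖p - v‖ = ‖(p - u) + (u - v)‖ := by congr 1; ring
      _ ≤ ‖p - u‖ + D := norm_add_le _ _
      _ ≤ _ := by linarith
  have h5 := hu p (h2.trans hr) hpu
  have h6 : ‖(p - v) + (p - u)‖ ≤ 3 * D := (norm_add_le _ _).trans (by linarith)
  have e : E p * cutoffDbar u v ε p = (deriv Real.smoothTransition ((ε ^ 2)⁻¹ *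
      Complex.normSq ((p - u) * (p - v)) - 1) : ℝ) * ((((ε ^ 2)⁻¹ : ℝ) : ℂ) *
      (2 * (((p - u) * E p) * (p - v) * (starRingEnd ℂ) ((p - v) + (p - u))))) := by
    rw [cutoffDbar]; ring
  rw [e, norm_mul, norm_mul, norm_mul, norm_mul, norm_mul ((p - u) * E p), Complex.norm_real,
    Complex.norm_real, Complex.norm_conj, Real.norm_eq_abs, Real.norm_of_nonneg (by positivity),
    Complex.norm_two]
  calc _ ≤ M * ((ε ^ 2)⁻¹ * (2 * (η * (2 * D) * (3 * D)))) := by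
        gcongr
        exact hM _
    _ = _ := by ring

/-- Multiplying `E` by the cut-off makes it continuous and adds the error `E * cutoffDbar`. That is
`o(ε⁻²)` and lives on discs of area `O(ε²)`, so its integral tends to zero. -/
lemma integral_eq_zero_of_poles {E d : ℂ → ℂ} {N : Set ℂ} {u v : ℂ} (huv : u ≠ v)
    (hN : N.Countable) (hE : ∀ p, p ≠ u → p ≠ v → ContinuousAt E p)
    (hd : Integrable d) (hdb : ∀ p : ℂ, p.im ≠ 0 → p ∉ N → HasDbar E (d p) p)
    (hinf : Tendsto (fun p => p * E p) (Bornology.cobounded ℂ) (𝓝 0))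
    (hu : Tendsto (fun p => (p - u) * E p) (𝓝[≠] u) (𝓝 0))
    (hv : Tendsto (fun p => (p - v) * E p) (𝓝[≠] v) (𝓝 0)) : ∫ p, d p = 0 := by
  obtain ⟨M, hM0, hM⟩ := exists_deriv_smoothTransition_le
  have hD : 0 < ‖u - v‖ := norm_pos_iff.2 (sub_ne_zero.2 huv)
  set D := ‖u - v‖ with hDdef
  have hmeasE : AEStronglyMeasurable E volume := by
    have h1 : ContinuousOn E ({u, v} : Set ℂ)ᶜ := fun p hp => by
      simp only [mem_compl_iff, mem_insert_iff, mem_singleton_iff, not_or] at hp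
      exact (hE p hp.1 hp.2).continuousWithinAt
    have h2 := h1.aestronglyMeasurable (μ := volume)
      (((finite_singleton v).insert u).measurableSet.compl)
    rwa [Measure.restrict_eq_self_of_ae_mem] at h2
    exact compl_mem_ae_iff.2 (((finite_singleton v).insert u).measure_zero _)
  -- the contribution of the cut-off function
  have hrem : ∀ η > 0, ∀ᶠ ε in 𝓝[>] (0 : ℝ), Integrable (fun p => E p * cutoffDbar u v ε p) ∧
      ‖∫ p, E p * cutoffDbar u v ε p‖ ≤ 384 * Real.pi * M * η := by
    intro η hη
    have hnear : ∀ q : ℂ, Tendsto (fun p => (p - q) * E p) (𝓝[≠] q) (𝓝 0) → ∃ r > 0,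
        ∀ p, ‖p - q‖ ≤ r → p ≠ q → ‖(p - q) * E p‖ ≤ η := fun q hq => by
      have := mem_map.1 (hq (Metric.ball_mem_nhds 0 hη))
      obtain ⟨r, hr, hsub⟩ := Metric.mem_nhdsWithin_iff.1 this
      refine ⟨r / 2, by positivity, fun p hp hpq => ?_⟩
      have : p ∈ Metric.ball q r ∩ {q}ᶜ := ⟨by rw [mem_ball_iff_norm]; linarith, hpq⟩
      have := hsub this
      simp only [mem_preimage, mem_ball_zero_iff] at this
      exact this.le
    obtain ⟨r₁, hr₁, hu'⟩ := hnear u hu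
    obtain ⟨r₂, hr₂, hv'⟩ := hnear v hv
    set r := min D (min r₁ r₂) with hr
    have hr0 : 0 < r := by positivity
    have hc : Continuous fun ε : ℝ => 4 * ε / D := by fun_prop
    have hev := (hc.continuousAt (x := 0)).eventually_le_const (u := r) (by simpa using hr0)
    filter_upwards [nhdsWithin_le_nhds hev, self_mem_nhdsWithin] with ε hε1 hε2
    have hε : 0 < ε := hε2
    set S : Set ℂ := Metric.closedBall u (4 * ε / D) ∪ Metric.closedBall v (4 * ε / D) with hS
    -- Two discs of radius `4 * ε / D` have total area `32 π ε² / D²`, so `B` times the area is `384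
    -- π M η`, independent of `ε`.
    set B := 12 * M * D ^ 2 * η / ε ^ 2 with hB
    have hB0 : 0 ≤ B := by positivity
    have hsymm : cutoffDbar v u ε = cutoffDbar u v ε := by
      funext p
      rw [cutoffDbar, cutoffDbar, mul_comm (p - v) (p - u), add_comm (p - u) (p - v)]
    have hbound : ∀ p, cutoffDbar u v ε p ≠ 0 → p ∈ S ∧ ‖E p * cutoffDbar u v ε p‖ ≤ B := by
      intro p hp
      rcases le_or_gt (D / 2) ‖p - v‖ with h | h
      · obtain ⟨h1, h2⟩ := norm_mul_cutoffDbar_le hM hM0 hη.le hε hD hε1 (min_le_left _ _)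
          (fun p hp => hu' p (hp.trans ((min_le_right _ _).trans (min_le_left _ _)))) h hp
        exact ⟨Or.inl (by rwa [mem_closedBall_iff_norm]), h2⟩
      · have hDs : D = ‖v - u‖ := norm_sub_rev _ _
        have h' : D / 2 ≤ ‖p - u‖ := by
          have : D ≤ ‖p - u‖ + ‖p - v‖ := by
            calc D = ‖(p - v) - (p - u)‖ := by rw [hDdef]; congr 1; ring
              _ ≤ ‖p - v‖ + ‖p - u‖ := norm_sub_le _ _
              _ = _ := add_comm _ _
          linarith
        rw [← hsymm] at hp ⊢
        obtain ⟨h1, h2⟩ := norm_mul_cutoffDbar_le hM hM0 hη.le hε (hDs ▸ hD) (hDs ▸ hε1)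
          (hDs ▸ min_le_left _ _)
          (fun p hp => hv' p (hp.trans ((min_le_right _ _).trans (min_le_right _ _))))
          (hDs ▸ h') hp
        rw [← hDs] at h1 h2
        exact ⟨Or.inr (by rwa [mem_closedBall_iff_norm]), h2⟩
    have hzero : ∀ p ∉ S, E p * cutoffDbar u v ε p = 0 := fun p hp => by
      by_contra hne
      exact hp (hbound p (right_ne_zero_of_mul hne)).1
    have hle : ∀ p, ‖E p * cutoffDbar u v ε p‖ ≤ B := fun p => by
      by_cases hp : cutoffDbar u v ε p = 0
      · rw [hp, mul_zero, norm_zero]; exact hB0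
      · exact (hbound p hp).2
    have hvol : volume.real S ≤ 2 * (Real.pi * (4 * ε / D) ^ 2) := by
      have h1 : ∀ q : ℂ, volume.real (Metric.closedBall q (4 * ε / D)) =
          Real.pi * (4 * ε / D) ^ 2 := fun q => by
        rw [Measure.real, Complex.volume_closedBall, ENNReal.toReal_mul, ENNReal.toReal_pow,
          ENNReal.toReal_ofReal (by positivity)]
        simp [mul_comm]
      refine (measureReal_union_le _ _).trans ?_
      rw [h1, h1]; linarith
    have hfin : volume S < ⊤ := by
      refine (measure_union_le _ _).trans_lt (ENNReal.add_lt_top.2 ⟨?_, ?_⟩) <;>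
      exact measure_closedBall_lt_top
    have hmS : MeasurableSet S := measurableSet_closedBall.union measurableSet_closedBall
    have hm : AEStronglyMeasurable (fun p => E p * cutoffDbar u v ε p) volume :=
      hmeasE.mul (continuous_cutoffDbar u v ε).aestronglyMeasurable
    have hion : IntegrableOn (fun p => E p * cutoffDbar u v ε p) S :=
      Measure.integrableOn_of_bounded hfin.ne hm (Eventually.of_forall hle)
    refine ⟨(integrableOn_iff_integrable_of_support_subset fun p hp => ?_).1 hion, ?_⟩
    · by_contra hpS
      exact hp (hzero p hpS)
    · rw [← setIntegral_eq_integral_of_forall_compl_eq_zero hzero]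
      refine (norm_setIntegral_le_of_norm_le_const hfin fun p _ => hle p).trans ?_
      calc B * volume.real S ≤ B * (2 * (Real.pi * (4 * ε / D) ^ 2)) := by gcongr
        _ = 384 * Real.pi * M * η := by rw [hB]; field_simp; ring
  have hchi : ∀ ε, Integrable fun p => d p * (cutoff u v ε p : ℂ) := fun ε =>
    hd.mul_bdd (c := 1) (Complex.continuous_ofReal.comp
      (continuous_cutoff u v ε)).aestronglyMeasurable (Eventually.of_forall (norm_cutoff_le u v ε))
  have hlim : Tendsto (fun ε => ∫ p, d p * (cutoff u v ε p : ℂ)) (𝓝[>] 0) (𝓝 (∫ p, d p)) := by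
    refine tendsto_integral_filter_of_dominated_convergence (fun p => ‖d p‖)
      (Eventually.of_forall fun ε => (hchi ε).aestronglyMeasurable)
      (Eventually.of_forall fun ε => Eventually.of_forall fun p => ?_) hd.norm ?_
    · rw [norm_mul]
      exact mul_le_of_le_one_right (norm_nonneg _) (norm_cutoff_le u v ε p)
    · have h0 : ∀ᵐ p : ℂ, p ∈ ({u, v} : Set ℂ)ᶜ :=
        compl_mem_ae_iff.2 (((finite_singleton v).insert u).measure_zero _)
      filter_upwards [h0] with p hp
      simp only [mem_compl_iff, mem_insert_iff, mem_singleton_iff, not_or] at hp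
      simpa using (tendsto_cutoff hp.1 hp.2).const_mul (d p)
  have hlim0 : Tendsto (fun ε => ∫ p, d p * (cutoff u v ε p : ℂ)) (𝓝[>] 0) (𝓝 0) := by
    rw [Metric.tendsto_nhds]
    intro η hη
    have hK : 0 < 384 * Real.pi * M + 1 := by positivity
    filter_upwards [hrem (η / (384 * Real.pi * M + 1) / 2) (by positivity), self_mem_nhdsWithin]
      with ε hε1 hε2
    have hε : 0 < ε := hε2
    have hcont : Continuous fun p => E p * (cutoff u v ε p : ℂ) := by
      rw [continuous_iff_continuousAt]
      intro p
      by_cases hp : (p - u) * (p - v) = 0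
      · refine ContinuousAt.congr (f := fun _ => (0 : ℂ)) continuousAt_const ?_
        filter_upwards [cutoff_eventually_zero hε hp] with x hx
        rw [hx]; simp
      · rw [mul_eq_zero, sub_eq_zero, sub_eq_zero, not_or] at hp
        exact (hE p hp.1 hp.2).mul
          (Complex.continuous_ofReal.comp (continuous_cutoff u v ε)).continuousAt
    have h0 := integral_eq_zero_of_hasDbar hN hcont ((hchi ε).add hε1.1)
      (fun p hp1 hp2 => (hdb p hp1 hp2).mul (hasDbar_cutoff u v ε p)) ?_
    · have h1 : ∫ p, d p * (cutoff u v ε p : ℂ) = -∫ p, E p * cutoffDbar u v ε p := by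
        rw [eq_neg_iff_add_eq_zero, ← integral_add (hchi ε) hε1.1]
        exact h0
      rw [dist_zero_right, h1, norm_neg]
      refine hε1.2.trans_lt ?_
      have : 384 * Real.pi * M * (η / (384 * Real.pi * M + 1) / 2) ≤
          (384 * Real.pi * M + 1) * (η / (384 * Real.pi * M + 1) / 2) := by
        gcongr; linarith
      have e : (384 * Real.pi * M + 1) * (η / (384 * Real.pi * M + 1) / 2) = η / 2 := by
        field_simp
      linarith
    · have hn : Tendsto (fun p => ‖p * E p‖) (Bornology.cobounded ℂ) (𝓝 0) := by
        simpa only [norm_zero] using hinf.norm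
      refine squeeze_zero_norm (fun p => ?_) hn
      rw [← mul_assoc, norm_mul]
      exact mul_le_of_le_one_right (norm_nonneg _) (norm_cutoff_le u v ε p)
  exact tendsto_nhds_unique hlim hlim0

/-! ### The residue formula, by comparison with a smooth function that carries the residue at
infinity -/

lemma integrableOn_Ioi_mul_inv_sq :
    IntegrableOn (fun y : ℝ => y * (2 / (1 + y ^ 2) ^ 2)) (Ioi 0) ∧
      ∫ y in Ioi (0 : ℝ), y * (2 / (1 + y ^ 2) ^ 2) = 1 := by
  have hderiv : ∀ x ∈ Ici (0 : ℝ),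
      HasDerivAt (fun y : ℝ => -(1 + y ^ 2)⁻¹) (x * (2 / (1 + x ^ 2) ^ 2)) x := fun x _ => by
    have h1 : HasDerivAt (fun y : ℝ => 1 + y ^ 2) (2 * x) x := by
      simpa using ((hasDerivAt_id x).pow 2).const_add 1
    refine (h1.inv (by positivity)).neg.congr_deriv ?_
    field_simp
  have hlim : Tendsto (fun y : ℝ => -(1 + y ^ 2)⁻¹) atTop (𝓝 0) := by
    have : Tendsto (fun y : ℝ => 1 + y ^ 2) atTop atTop :=
      tendsto_atTop_add_const_left _ _ (tendsto_pow_atTop two_ne_zero)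
    simpa using this.inv_tendsto_atTop.neg
  have h_int : IntegrableOn (fun y : ℝ => y * (2 / (1 + y ^ 2) ^ 2)) (Ioi 0) :=
    integrableOn_Ioi_deriv_of_nonneg' hderiv (fun x hx => by
      have : (0 : ℝ) < x := hx
      positivity) hlim
  refine ⟨h_int, ?_⟩
  rw [integral_Ioi_of_hasDerivAt_of_tendsto' hderiv h_int hlim]
  norm_num

lemma integral_poisson : Integrable (fun p : ℂ => (2 : ℂ) / (1 + (‖p‖ : ℂ) ^ 2) ^ 2) ∧
    ∫ p : ℂ, (2 : ℂ) / (1 + (‖p‖ : ℂ) ^ 2) ^ 2 = 2 * (Real.pi : ℂ) := by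
  obtain ⟨h1, h2⟩ := integrableOn_Ioi_mul_inv_sq
  have e : (fun p : ℂ => (2 : ℂ) / (1 + (‖p‖ : ℂ) ^ 2) ^ 2) =
      fun p : ℂ => ((2 / (1 + ‖p‖ ^ 2) ^ 2 : ℝ) : ℂ) := by
    funext p; push_cast; rfl
  have hvol : (volume : Measure ℂ).real (Metric.ball 0 1) = Real.pi := by
    rw [Measure.real, Complex.volume_ball]; simp
  rw [e]
  constructor
  · have h3 : Integrable (fun p : ℂ => 2 / (1 + ‖p‖ ^ 2) ^ 2 : ℂ → ℝ) := by
      rw [integrable_fun_norm_addHaar volume (f := fun y : ℝ => 2 / (1 + y ^ 2) ^ 2),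
        Complex.finrank_real_complex]
      simpa using h1
    exact h3.ofReal
  · rw [integral_complex_ofReal,
      integral_fun_norm_addHaar volume (fun y : ℝ => 2 / (1 + y ^ 2) ^ 2),
      Complex.finrank_real_complex, hvol]
    simp only [Nat.add_one_sub_one, pow_one, smul_eq_mul]
    rw [h2]
    simp

/-- The function `x̄ / (1 + |x|²)` behaves like `1 / x` at infinity but has no pole; its `2 ∂/∂x̄`
has total mass `2π`. It serves to correct the `1 / p` term at infinity. -/
lemma hasDbar_poisson (p : ℂ) : HasDbar (fun x : ℂ => (starRingEnd ℂ) x *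
    (((1 + Complex.normSq x)⁻¹ : ℝ) : ℂ)) ((2 : ℂ) / (1 + (‖p‖ : ℂ) ^ 2) ^ 2) p := by
  have hn := Complex.normSq_nonneg p
  have h1 : HasDerivAt (fun t : ℝ => (1 + t)⁻¹) (-1 / (1 + Complex.normSq p) ^ 2)
      (Complex.normSq p) :=
    ((hasDerivAt_id (Complex.normSq p)).const_add 1).fun_inv (by simp only [id]; positivity)
  have h2 := (hasDbar_conj (hasDerivAt_id p)).mul ((hasDbar_normSq (hasDerivAt_id p)).real_comp h1)
  have hc : (1 : ℂ) + (Complex.normSq p : ℂ) ≠ 0 := by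
    have : (1 + Complex.normSq p : ℝ) ≠ 0 := by positivity
    exact_mod_cast this
  have e : (‖p‖ : ℂ) ^ 2 = (Complex.normSq p : ℂ) := by
    rw [Complex.normSq_eq_norm_sq]; push_cast; rfl
  have e2 := Complex.mul_conj p
  have e3 : (2 : ℂ) / (1 + (‖p‖ : ℂ) ^ 2) ^ 2 = 2 * (starRingEnd ℂ) 1 *
      (((1 + Complex.normSq p)⁻¹ : ℝ) : ℂ) + (starRingEnd ℂ) p *
        (((-1 / (1 + Complex.normSq p) ^ 2 : ℝ) : ℂ) * (2 * (p * (starRingEnd ℂ) 1))) := by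
    rw [e, map_one]
    push_cast
    field_simp
    rw [← e2]
    ring
  rw [e3]
  exact h2

lemma tendsto_mul_inv_sub (q : ℂ) :
    Tendsto (fun p : ℂ => p * (p - q)⁻¹) (Bornology.cobounded ℂ) (𝓝 1) := by
  have h1 : Tendsto (fun p : ℂ => p - q) (Bornology.cobounded ℂ) (Bornology.cobounded ℂ) := by
    rw [← tendsto_norm_atTop_iff_cobounded]
    refine tendsto_atTop_mono (fun p => norm_sub_norm_le p q) ?_
    exact tendsto_atTop_add_const_right _ _ tendsto_norm_cobounded_atTop
  have h2 : Tendsto (fun p : ℂ => 1 + q * (p - q)⁻¹) (Bornology.cobounded ℂ) (𝓝 (1 + q * 0)) :=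
    ((tendsto_inv₀_cobounded.comp h1).const_mul q).const_add 1
  rw [mul_zero, add_zero] at h2
  refine h2.congr' ?_
  have : ∀ᶠ p : ℂ in Bornology.cobounded ℂ, p ≠ q := by
    exact Bornology.isBounded_singleton (x := q)
  filter_upwards [this] with p hp
  have : p - q ≠ 0 := sub_ne_zero.2 hp
  field_simp
  ring

lemma tendsto_mul_poisson : Tendsto (fun p : ℂ => p * ((starRingEnd ℂ) p *
    (((1 + Complex.normSq p)⁻¹ : ℝ) : ℂ))) (Bornology.cobounded ℂ) (𝓝 1) := by
  have h0 : Tendsto (fun p : ℂ => 1 + Complex.normSq p) (Bornology.cobounded ℂ) atTop := by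
    refine tendsto_atTop_add_const_left _ _ ?_
    have e : (Complex.normSq : ℂ → ℝ) = fun p => ‖p‖ ^ 2 := funext Complex.normSq_eq_norm_sq
    rw [e]
    exact (tendsto_pow_atTop two_ne_zero).comp tendsto_norm_cobounded_atTop
  have h1 : Tendsto (fun p : ℂ => ((1 - (1 + Complex.normSq p)⁻¹ : ℝ) : ℂ)) (Bornology.cobounded ℂ)
      (𝓝 ((1 - 0 : ℝ) : ℂ)) :=
    (Complex.continuous_ofReal.tendsto _).comp (h0.inv_tendsto_atTop.const_sub 1)
  rw [sub_zero, Complex.ofReal_one] at h1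
  refine h1.congr fun p => ?_
  rw [← mul_assoc, Complex.mul_conj, ← Complex.ofReal_mul]
  congr 1
  have : 1 + Complex.normSq p ≠ 0 := by linarith [Complex.normSq_nonneg p]
  field_simp
  ring

/-- Stokes' theorem for a function with two simple poles: the integral of `2 ∂A/∂p̄` is given by
the residues at the poles and at infinity. -/
lemma integral_eq_residues {A d : ℂ → ℂ} {N : Set ℂ} {u v eu ev c : ℂ} (huv : u ≠ v)
    (hN : N.Countable) (hA : ∀ p, p ≠ u → p ≠ v → ContinuousAt A p)
    (hd : Integrable d) (hdb : ∀ p : ℂ, p.im ≠ 0 → p ∉ N → HasDbar A (d p) p)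
    (hinf : Tendsto (fun p => p * A p) (Bornology.cobounded ℂ) (𝓝 c))
    (hu : Tendsto (fun p => (p - u) * A p) (𝓝[≠] u) (𝓝 eu))
    (hv : Tendsto (fun p => (p - v) * A p) (𝓝[≠] v) (𝓝 ev)) :
    ∫ p, d p = 2 * Real.pi * (c - eu - ev) := by
  set k := c - eu - ev with hk
  set P : ℂ → ℂ := fun p => (starRingEnd ℂ) p * (((1 + Complex.normSq p)⁻¹ : ℝ) : ℂ) with hP
  -- Both poles and the leading term at infinity are removed: the two fractions together contribute
  -- `eu + ev` to the limit of `p * A p`, and `k` is what remains of `c`.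
  set E : ℂ → ℂ := fun p => A p + -(eu * (p - u)⁻¹) + -(ev * (p - v)⁻¹) + -(k * P p) with hE
  have hPc : ∀ p, ContinuousAt P p := fun p => (hasDbar_poisson p).continuousAt
  have hinv : ∀ q p : ℂ, p ≠ q → DifferentiableAt ℂ (fun x : ℂ => (x - q)⁻¹) p := fun q p hp =>
    (differentiableAt_id.sub_const q).fun_inv (sub_ne_zero.2 hp)
  obtain ⟨hpi, hpv⟩ := integral_poisson
  have hdi := hd.add (hpi.const_mul k).neg
  have key := integral_eq_zero_of_poles (E := E)
    (d := fun p => d p + -(k * ((2 : ℂ) / (1 + (‖p‖ : ℂ) ^ 2) ^ 2))) (N := N ∪ {u, v}) huv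
    (hN.union ((finite_singleton v).insert u).countable) ?_ hdi ?_ ?_ ?_ ?_
  · rw [integral_add hd (hpi.const_mul k).fun_neg, integral_neg, integral_const_mul, hpv] at key
    linear_combination key
  · intro p hp1 hp2
    exact ((((hA p hp1 hp2).add ((hinv u p hp1).continuousAt.const_mul eu).neg).add
      ((hinv v p hp2).continuousAt.const_mul ev).neg)).add ((hPc p).const_mul k).neg
  · intro p hp1 hp2
    simp only [mem_union, mem_insert_iff, mem_singleton_iff, not_or] at hp2
    obtain ⟨h0, h1, h2⟩ := hp2
    have hconst : ∀ e : ℂ, HasDbar (fun _ => e) 0 p := fun e =>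
      HasDbar.of_differentiableAt (differentiableAt_const e)
    have := (((hdb p hp1 h0).add
      ((hconst eu).mul (HasDbar.of_differentiableAt (hinv u p h1))).neg).add
      ((hconst ev).mul (HasDbar.of_differentiableAt (hinv v p h2))).neg).add
      ((hconst k).mul (hasDbar_poisson p)).neg
    convert this using 1
    ring
  · have := ((hinf.sub ((tendsto_mul_inv_sub u).const_mul eu)).sub
      ((tendsto_mul_inv_sub v).const_mul ev)).sub (tendsto_mul_poisson.const_mul k)
    have e : c - eu * 1 - ev * 1 - k * 1 = 0 := by rw [hk]; ring
    rw [e] at this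
    refine this.congr fun p => ?_
    simp only [hE, hP]
    ring
  · have h1 : ContinuousAt (fun p => (p - u) * (-(ev * (p - v)⁻¹) + -(k * P p))) u :=
      (continuousAt_id.sub continuousAt_const).mul
        ((((hinv v u huv).continuousAt.const_mul ev).neg).add ((hPc u).const_mul k).neg)
    have h2 := (hu.sub_const eu).add (h1.tendsto.mono_left nhdsWithin_le_nhds)
    simp only [sub_self, zero_mul, add_zero] at h2
    refine h2.congr' ?_
    filter_upwards [self_mem_nhdsWithin] with p hp
    have : p - u ≠ 0 := sub_ne_zero.2 hp
    simp only [hE]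
    linear_combination eu * mul_inv_cancel₀ this
  · have h1 : ContinuousAt (fun p => (p - v) * (-(eu * (p - u)⁻¹) + -(k * P p))) v :=
      (continuousAt_id.sub continuousAt_const).mul
        ((((hinv u v huv.symm).continuousAt.const_mul eu).neg).add ((hPc v).const_mul k).neg)
    have h2 := (hv.sub_const ev).add (h1.tendsto.mono_left nhdsWithin_le_nhds)
    simp only [sub_self, zero_mul, add_zero] at h2
    refine h2.congr' ?_
    filter_upwards [self_mem_nhdsWithin] with p hp
    have : p - v ≠ 0 := sub_ne_zero.2 hp
    simp only [hE]
    linear_combination ev * mul_inv_cancel₀ this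

/-! ### Behaviour at infinity -/

lemma hasDerivAt_pathInf (a : ℂ) {t : ℝ} (ht : t ∈ Ioo (0 : ℝ) 1) :
    HasDerivAt (pathInf a) (-(I * ((((1 - t)⁻¹) ^ 2 : ℝ) : ℂ))) t := by
  have h1 : 1 - t ≠ 0 := by linarith [ht.2]
  have h2 : HasDerivAt (fun t : ℝ => t / (1 - t)) (((1 - t)⁻¹) ^ 2) t := by
    refine ((hasDerivAt_id t).div ((hasDerivAt_id t).const_sub 1) h1).congr_deriv ?_
    simp only [id]
    field_simp
    ring
  exact (h2.ofReal_comp.const_mul I).const_sub a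

lemma deriv_pathInf (a : ℂ) {t : ℝ} (ht : t ∈ Ioo (0 : ℝ) 1) :
    deriv (pathInf a) t = -(I * ((((1 - t)⁻¹) ^ 2 : ℝ) : ℂ)) := (hasDerivAt_pathInf a ht).deriv

lemma pathInf_im_neg {a : ℂ} (ha : a.im ≤ 0) {t : ℝ} (ht : t ∈ Ioo (0 : ℝ) 1) :
    (pathInf a t).im < 0 := by
  have h1 : 0 < t / (1 - t) := div_pos ht.1 (by linarith [ht.2])
  have : (pathInf a t).im = a.im - t / (1 - t) := by
    simp only [pathInf, Complex.sub_im, Complex.mul_im, Complex.I_re, Complex.I_im,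
      Complex.ofReal_re, Complex.ofReal_im]
    ring
  rw [this]; linarith

section RescaledPath

variable {ι : Type*} {F : Filter ι} {ρ : ι → ℝ}

lemma tendsto_den_inv (hρ : Tendsto ρ F atTop) {t : ℝ} (ht : t ∈ Ioo (0 : ℝ) 1) :
    Tendsto (fun i => (t + ρ i * (1 - t))⁻¹) F (𝓝 0) := by
  have h1 : 0 < 1 - t := by linarith [ht.2]
  exact (tendsto_atTop_add_const_left _ _ (hρ.atTop_mul_const h1)).inv_tendsto_atTop

lemma tendsto_div_den (hρ : Tendsto ρ F atTop) {t : ℝ} (ht : t ∈ Ioo (0 : ℝ) 1) :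
    Tendsto (fun i => ρ i * (t + ρ i * (1 - t))⁻¹) F (𝓝 (1 - t)⁻¹) := by
  have h1 : 0 < 1 - t := by linarith [ht.2]
  have h2 : Tendsto (fun i => (1 - t * (t + ρ i * (1 - t))⁻¹) * (1 - t)⁻¹) F
      (𝓝 ((1 - t * 0) * (1 - t)⁻¹)) :=
    (((tendsto_den_inv hρ ht).const_mul t).const_sub 1).mul_const _
  rw [mul_zero, sub_zero, one_mul] at h2
  refine h2.congr' ?_
  filter_upwards [hρ.eventually_gt_atTop 0] with i hi
  have := mobius_den_pos hi ht
  field_simp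
  ring

/-- After rescaling, `τ` is about `t / (ρ (1 - t))` with `ρ = ‖b - a‖`. For `lam = 1` the chord
enters only through `τ² (b - a)`, which disappears in the limit whatever the direction of `b`; the
bulge `ρ τ (1 - τ)` tends to `t / (1 - t)`. So the limit is the vertical path. -/
lemma tendsto_pth_mobius (a : ℂ) {b : ι → ℂ} (hb : Tendsto (fun i => ‖b i - a‖) F atTop) {t : ℝ}
    (ht : t ∈ Ioo (0 : ℝ) 1) :
    Tendsto (fun i => pth a (b i) 1 1 (mobius ‖b i - a‖ t)) F (𝓝 (pathInf a t)) := by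
  have h1t : 1 - t ≠ 0 := by linarith [ht.2]
  have hi := tendsto_den_inv hb ht
  have hq := tendsto_div_den hb ht
  have h1 : Tendsto (fun i => ((mobius ‖b i - a‖ t ^ 2 : ℝ) : ℂ) * (b i - a)) F (𝓝 0) := by
    rw [tendsto_zero_iff_norm_tendsto_zero]
    have := (hi.mul hq).const_mul (t ^ 2)
    rw [zero_mul, mul_zero] at this
    refine this.congr fun i => ?_
    rw [norm_mul, Complex.norm_real, Real.norm_of_nonneg (sq_nonneg _), mobius]
    ring
  have h2 : Tendsto (fun i => ‖b i - a‖ * (mobius ‖b i - a‖ t * (1 - mobius ‖b i - a‖ t))) F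
      (𝓝 (t / (1 - t))) := by
    have := (hq.mul hq).const_mul (t * (1 - t))
    have e : t * (1 - t) * ((1 - t)⁻¹ * (1 - t)⁻¹) = t / (1 - t) := by field_simp
    rw [e] at this
    refine this.congr' ?_
    filter_upwards [hb.eventually_gt_atTop 0] with i hi
    rw [one_sub_mobius hi ht, mobius]
    ring
  have h3 := (h1.const_add a).sub (((Complex.continuous_ofReal.tendsto _).comp h2).const_mul I)
  rw [add_zero] at h3
  refine h3.congr fun i => ?_
  simp [pth]

lemma tendsto_deriv_pth_mobius (a : ℂ) {b : ι → ℂ} (hb : Tendsto (fun i => ‖b i - a‖) F atTop)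
    {t : ℝ} (ht : t ∈ Ioo (0 : ℝ) 1) :
    Tendsto (fun i => deriv (pth a (b i) 1 1) (mobius ‖b i - a‖ t) *
      ((‖b i - a‖ / (t + ‖b i - a‖ * (1 - t)) ^ 2 : ℝ) : ℂ)) F (𝓝 (deriv (pathInf a) t)) := by
  have hi := tendsto_den_inv hb ht
  have hq := tendsto_div_den hb ht
  have h1 : Tendsto (fun i => ((2 * mobius ‖b i - a‖ t *
      (‖b i - a‖ / (t + ‖b i - a‖ * (1 - t)) ^ 2) : ℝ) : ℂ) * (b i - a)) F (𝓝 0) := by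
    rw [tendsto_zero_iff_norm_tendsto_zero]
    have := ((hi.mul (hq.mul hq)).const_mul (2 * t)).norm
    rw [zero_mul, mul_zero, norm_zero] at this
    refine this.congr fun i => ?_
    have e : 2 * t * ((t + ‖b i - a‖ * (1 - t))⁻¹ * (‖b i - a‖ * (t + ‖b i - a‖ * (1 - t))⁻¹ *
        (‖b i - a‖ * (t + ‖b i - a‖ * (1 - t))⁻¹))) = 2 * mobius ‖b i - a‖ t *
        (‖b i - a‖ / (t + ‖b i - a‖ * (1 - t)) ^ 2) * ‖b i - a‖ := by
      rw [mobius]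
      generalize t + ‖b i - a‖ * (1 - t) = D
      ring
    rw [e, norm_mul, norm_norm, norm_mul (((_ : ℝ)) : ℂ), Complex.norm_real]
  have h2 : Tendsto (fun i => ‖b i - a‖ * (1 - 2 * mobius ‖b i - a‖ t) *
      (‖b i - a‖ / (t + ‖b i - a‖ * (1 - t)) ^ 2)) F (𝓝 ((1 - t)⁻¹ ^ 2)) := by
    have := (hq.mul hq).mul ((hi.const_mul (2 * t)).const_sub 1)
    have e : (1 - t)⁻¹ * (1 - t)⁻¹ * (1 - 2 * t * 0) = (1 - t)⁻¹ ^ 2 := by ring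
    rw [e] at this
    refine this.congr fun i => ?_
    rw [mobius]
    generalize t + ‖b i - a‖ * (1 - t) = D
    ring
  have h3 := h1.sub (((Complex.continuous_ofReal.tendsto _).comp h2).const_mul I)
  rw [zero_sub] at h3
  rw [deriv_pathInf a ht]
  refine h3.congr fun i => ?_
  rw [deriv_pth]
  simp only [Function.comp]
  push_cast
  ring

end RescaledPath

/-- The limit at infinity of the kernel of a letter. -/
def limKer (a : ℂ) : Option ℂ → ℝ → ℂ
  | none => 0
  | some s => pull (pathInf a) (omega s)

lemma continuousOn_limKer {a : ℂ} (ha : a.im ≤ 0) {o : Option ℂ} (ho : ∀ s ∈ o, 0 ≤ s.im) :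
    ContinuousOn (limKer a o) (Ioo 0 1) := by
  cases o with
  | none => exact continuousOn_const
  | some s =>
    refine ContinuousOn.mul (continuousOn_const.mul (ContinuousOn.inv₀ ?_ fun t ht e => ?_)) ?_
    · exact ContinuousOn.sub (fun t ht =>
        (hasDerivAt_pathInf a ht).continuousAt.continuousWithinAt) continuousOn_const
    · have h1 := pathInf_im_neg ha ht
      rw [sub_eq_zero.1 e] at h1
      linarith [ho s rfl]
    · have : ContinuousOn (fun t : ℝ => -(I * ((((1 - t)⁻¹) ^ 2 : ℝ) : ℂ))) (Ioo 0 1) := by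
        refine ContinuousOn.neg (continuousOn_const.mul (Complex.continuous_ofReal.comp_continuousOn
          (ContinuousOn.pow (ContinuousOn.inv₀ (by fun_prop) fun t ht => ?_) 2)))
        linarith [ht.2]
      exact this.congr fun t ht => deriv_pathInf a ht

lemma fold_norm (p : ℂ) : ‖fold p‖ = ‖p‖ := by
  rcases le_or_gt 0 p.im with h | h
  · rw [fold_of_nonneg h, Complex.norm_conj]
  · rw [fold_of_neg h]

lemma tendsto_norm_fold_sub (a : ℂ) :
    Tendsto (fun p => ‖fold p - a‖) (Bornology.cobounded ℂ) atTop := by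
  refine tendsto_atTop_mono (fun p => ?_)
    (tendsto_atTop_add_const_right _ (-‖a‖) tendsto_norm_cobounded_atTop)
  have := norm_sub_norm_le (fold p) a
  rw [fold_norm] at this
  linarith

/-- At a fixed rescaled parameter the path stays bounded while the moving letter goes to infinity,
so its kernel tends to zero. This is why the correction term disappears when `x` occurs in the word.
-/
lemma tendsto_letter_ker {a : ℂ} (ha : a.im ≤ 0) {o : Option ℂ} (ho : ∀ s ∈ o, 0 ≤ s.im) {t : ℝ}
    (ht : t ∈ Ioo (0 : ℝ) 1) :
    Tendsto (fun p => reparam ‖fold p - a‖ (pull (pth a (fold p) 1 1) (omega (o.getD p))) t)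
      (Bornology.cobounded ℂ) (𝓝 (limKer a o t)) := by
  have hX := tendsto_pth_mobius a (tendsto_norm_fold_sub a) ht
  have hY := tendsto_deriv_pth_mobius a (tendsto_norm_fold_sub a) ht
  cases o with
  | none =>
    have h1 : Tendsto (fun p : ℂ => pth a (fold p) 1 1 (mobius ‖fold p - a‖ t) - p)
        (Bornology.cobounded ℂ) (Bornology.cobounded ℂ) := by
      rw [← tendsto_norm_atTop_iff_cobounded]
      refine tendsto_atTop_mono' (f₁ := fun p : ℂ => ‖p‖ + -(‖pathInf a t‖ + 1)) _ ?_
        (tendsto_atTop_add_const_right _ _ tendsto_norm_cobounded_atTop)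
      filter_upwards [hX.norm.eventually_le_const (lt_add_one _)] with p hp
      have := norm_sub_norm_le p (pth a (fold p) 1 1 (mobius ‖fold p - a‖ t))
      rw [norm_sub_rev p] at this
      linarith
    have h2 := ((tendsto_inv₀_cobounded.comp h1).const_mul (2 * (Real.pi : ℂ) * I)⁻¹).mul hY
    rw [mul_zero, zero_mul] at h2
    refine h2.congr fun p => ?_
    simp only [reparam, pull, omega, Option.getD_none, Function.comp]
    ring
  | some s =>
    have hne : pathInf a t - s ≠ 0 := fun e => by
      have h1 := pathInf_im_neg ha ht
      rw [sub_eq_zero.1 e] at h1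
      linarith [ho s rfl]
    have h2 := (((hX.sub_const s).inv₀ hne).const_mul (2 * (Real.pi : ℂ) * I)⁻¹).mul hY
    refine h2.congr fun p => ?_
    simp only [reparam, pull, omega, Option.getD_some]
    ring

/-! ### Words that begin with a difference of two letters -/

lemma Tame.sub_head {δ C θ : ℝ} {k₁ k₂ : ℝ → ℂ} {l : List (ℝ → ℂ)} (hC : 0 ≤ C)
    (hθ : 0 ≤ θ) (h₁ : Tame δ C θ (k₁ :: l)) (h₂ : Tame δ C θ (k₂ :: l)) :
    Tame δ (2 * C) θ ((fun τ => k₁ τ - k₂ τ) :: l) where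
  cont k hk := by
    rcases List.mem_cons.1 hk with rfl | hk
    · exact (h₁.cont k₁ (by simp)).sub (h₂.cont k₂ (by simp))
    · exact h₁.cont k (by simp [hk])
  bound k hk τ hτ := by
    have h0 : 0 < τ * (1 - τ) := mul_pos hτ.1 (by linarith [hτ.2])
    rcases List.mem_cons.1 hk with rfl | hk
    · have e1 := h₁.bound k₁ (by simp) τ hτ
      have e2 := h₂.bound k₂ (by simp) τ hτ
      refine (norm_sub_le _ _).trans ((add_le_add e1 e2).trans (le_of_eq ?_))
      ring
    · refine (h₁.bound k (by simp [hk]) τ hτ).trans ?_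
      gcongr; linarith
  last k hk τ hτ := by
    have h0 : 0 < τ * (1 - τ) := mul_pos hτ.1 (by linarith [hτ.2])
    have hr := ratioPow_nonneg (δ := δ) hτ
    cases l with
    | nil =>
      simp only [List.getLast?_singleton, Option.mem_some_iff] at hk
      subst hk
      have e1 := h₁.last k₁ (by simp) τ hτ
      have e2 := h₂.last k₂ (by simp) τ hτ
      refine (norm_sub_le _ _).trans ((add_le_add e1 e2).trans (le_of_eq ?_))
      ring
    | cons k' l =>
      rw [List.getLast?_cons_cons] at hk
      refine (h₁.last k (by rwa [List.getLast?_cons_cons]) τ hτ).trans ?_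
      gcongr; linarith

lemma ClosedBound.sub_head {δ M₁ M₂ : ℝ} {k₁ k₂ : ℝ → ℂ} {l : List (ℝ → ℂ)}
    (h₁ : ClosedBound δ M₁ (k₁ :: l)) (h₂ : ClosedBound δ M₂ (k₂ :: l)) :
    ClosedBound δ (M₁ + M₂) ((fun τ => k₁ τ - k₂ τ) :: l) := fun τ hτ => by
  rw [sub_mul]
  refine (norm_sub_le _ _).trans ((add_le_add (h₁ τ hτ) (h₂ τ hτ)).trans (le_of_eq ?_))
  ring

/-- Rescaling multiplies `(1 + ρ / d) ^ δ` by `ρ ^ (-δ)`, which makes the bound uniform for large `ρ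
= ‖fold p - a‖`. -/
lemma GoodWord.tame_reparam {a : ℂ} {d δ : ℝ} {V : List (Option ℂ)} (h : GoodWord a d V)
    (hδ : 0 < δ) (hδ1 : δ ≤ 1) {p : ℂ} (hp : 1 ≤ ‖fold p - a‖) :
    Tame δ 4 ((1 + 1 / d) ^ δ) ((wordKer (pth a (fold p) 1 1) (place p V)).map
      (reparam ‖fold p - a‖)) := by
  have hd := h.pos
  have hρ : 0 < ‖fold p - a‖ := by linarith
  refine ((h.tame hδ hδ1 p).reparam hρ).mono (by norm_num) ?_
  rw [Real.rpow_neg hρ.le, ← Real.inv_rpow hρ.le, ← Real.mul_rpow (by positivity) (by positivity)]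
  refine Real.rpow_le_rpow (by positivity) ?_ hδ.le
  have h1 : ‖fold p - a‖⁻¹ ≤ 1 := inv_le_one_of_one_le₀ hp
  have e : (1 + ‖fold p - a‖ / d) * ‖fold p - a‖⁻¹ = ‖fold p - a‖⁻¹ + 1 / d := by field_simp
  rw [e]; linarith

lemma wordKer_place_reparam (a p : ℂ) (V : List (Option ℂ)) :
    (wordKer (pth a (fold p) 1 1) (place p V)).map (reparam ‖fold p - a‖) =
      V.map fun o => reparam ‖fold p - a‖ (pull (pth a (fold p) 1 1) (omega (o.getD p))) := by
  simp [wordKer, place, Function.comp_def]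

lemma GoodWord.tame_limKer {a : ℂ} {d δ : ℝ} {V : List (Option ℂ)} (h : GoodWord a d V)
    (hδ : 0 < δ) (hδ1 : δ ≤ 1) : Tame δ 4 ((1 + 1 / d) ^ δ) (V.map (limKer a)) := by
  have him : ∀ o ∈ V, ∀ s ∈ o, 0 ≤ s.im := fun o ho s hs => by
    cases hs; exact h.im_nonneg s ho
  have hev : ∀ᶠ p in Bornology.cobounded ℂ, 1 ≤ ‖fold p - a‖ :=
    (tendsto_norm_fold_sub a).eventually_ge_atTop 1
  have hne : (Bornology.cobounded ℂ).NeBot := inferInstance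
  refine ⟨fun k hk => ?_, fun k hk τ hτ => ?_, fun k hk τ hτ => ?_⟩
  · obtain ⟨o, ho, rfl⟩ := List.mem_map.1 hk
    exact continuousOn_limKer h.base (him o ho)
  · obtain ⟨o, ho, rfl⟩ := List.mem_map.1 hk
    refine le_of_tendsto (tendsto_letter_ker h.base (him o ho) hτ).norm ?_
    filter_upwards [hev] with p hp
    have := h.tame_reparam hδ hδ1 hp
    rw [wordKer_place_reparam] at this
    exact this.bound _ (List.mem_map_of_mem ho) τ hτ
  · rw [List.getLast?_map] at hk
    obtain ⟨o, ho, rfl⟩ := Option.mem_map.1 hk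
    refine le_of_tendsto (tendsto_letter_ker h.base (him o (List.mem_of_mem_getLast? ho)) hτ).norm ?_
    filter_upwards [hev] with p hp
    have := h.tame_reparam hδ hδ1 hp
    rw [wordKer_place_reparam] at this
    refine this.last _ ?_ τ hτ
    rw [List.getLast?_map]
    exact Option.mem_map_of_mem _ ho

/-- The bound is sharp enough near `t = 1`, as all the decay in `Avoids.quot_le` is spent on the end
point (`β = 1`). The companion below improves it near `t = 0` with `α = 1` if `s` is not the base
point. -/
lemma inv_norm_pth_mobius_le {a b s : ℂ} {t : ℝ} (ha : a.im ≤ 0) (hb : b.im ≤ 0) (hs : 0 ≤ s.im)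
    (hρ : 0 < ‖b - a‖) (h2 : ‖b - a‖ / 2 ≤ ‖b - s‖) (ht : t ∈ Ioo (0 : ℝ) 1) :
    ‖pth a b 1 1 (mobius ‖b - a‖ t) - s‖⁻¹ ≤ 8 / t * ((t + ‖b - a‖ * (1 - t)) / ‖b - a‖) := by
  have hD := mobius_den_pos hρ ht
  have hm := mobius_mem hρ ht
  have h0 := ht.1
  have hm1 : 0 < 1 - mobius ‖b - a‖ t := by linarith [hm.2]
  have hm0 := hm.1
  have := (avoids_eta ha hb (Or.inl hs)).quot_le one_pos le_rfl
    (isGoodPath_pth a b (lam := 1) (mu := 1) (by simp) (by simp)) one_pos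
    (by positivity : 0 < ‖b - a‖ / 2) (α := 0) (β := 1) (by simp) (fun _ => h2) le_rfl zero_le_one
    (by norm_num) hm
  rw [Real.rpow_zero, Real.rpow_one] at this
  have e : 4 / 1 * (1 * (‖b - a‖ * (1 - mobius ‖b - a‖ t) / (‖b - a‖ / 2)) /
      (mobius ‖b - a‖ t * (1 - mobius ‖b - a‖ t))) = 8 * (mobius ‖b - a‖ t)⁻¹ := by
    field_simp; norm_num
  rw [e, mobius, inv_div, mul_comm, ← le_div_iff₀ hρ] at this
  refine this.trans (le_of_eq ?_)
  ring

lemma inv_norm_pth_mobius_le' {a b s : ℂ} {t d : ℝ} (ha : a.im ≤ 0) (hb : b.im ≤ 0)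
    (hs : 0 ≤ s.im) (hρ : 0 < ‖b - a‖) (h2 : ‖b - a‖ / 2 ≤ ‖b - s‖) (hd : 0 < d)
    (h1 : d ≤ ‖a - s‖) (ht : t ∈ Ioo (0 : ℝ) 1) :
    ‖pth a b 1 1 (mobius ‖b - a‖ t) - s‖⁻¹ ≤
      (16 + 8 / d) * ((t + ‖b - a‖ * (1 - t)) / ‖b - a‖) := by
  have hD := mobius_den_pos hρ ht
  have hm := mobius_mem hρ ht
  have h0 := ht.1
  have h1t : 0 < 1 - t := by linarith [ht.2]
  have hm1 : 0 < 1 - mobius ‖b - a‖ t := by linarith [hm.2]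
  have hm0 := hm.1
  rcases le_or_gt (1 / 2) t with hh | hh
  · refine (inv_norm_pth_mobius_le ha hb hs hρ h2 ht).trans ?_
    gcongr
    have : 8 / t ≤ 16 := by rw [div_le_iff₀ h0]; linarith
    have : 0 ≤ 8 / d := by positivity
    linarith
  · have := (avoids_eta ha hb (Or.inl hs)).quot_le one_pos le_rfl
      (isGoodPath_pth a b (lam := 1) (mu := 1) (by simp) (by simp)) hd one_pos
      (α := 1) (β := 0) (fun _ => h1) (by simp) zero_le_one le_rfl
      (by norm_num) hm
    rw [Real.rpow_zero, Real.rpow_one] at this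
    have e : 4 / 1 * (‖b - a‖ * mobius ‖b - a‖ t / d * 1 /
        (mobius ‖b - a‖ t * (1 - mobius ‖b - a‖ t))) =
        ‖b - a‖ * (4 / d * (1 - mobius ‖b - a‖ t)⁻¹) := by
      field_simp
    rw [e, mul_le_mul_iff_right₀ hρ, one_sub_mobius hρ ht, inv_div] at this
    refine this.trans ?_
    have e2 : 4 / d * ((t + ‖b - a‖ * (1 - t)) / (‖b - a‖ * (1 - t))) =
      4 / d / (1 - t) * ((t + ‖b - a‖ * (1 - t)) / ‖b - a‖) := by field_simp
    rw [e2]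
    gcongr
    rw [div_le_iff₀ h1t]
    have : 0 < 4 / d := by positivity
    have e3 : 8 / d = 2 * (4 / d) := by ring
    rw [e3]
    nlinarith

/-- The difference `ω_u - ω_v` decays quadratically: it is `ω_u` times `(u - v) / (γ - v)`. With `D
= t + ρ (1 - t)`, the two factors `D / ρ` cancel the speed `3 ρ` and the Jacobian `ρ / D²`, leaving
a bound uniform in `b`. -/
lemma norm_reparam_sub_le {a b u v : ℂ} {t x y : ℝ} (ha : a.im ≤ 0) (hb : b.im ≤ 0)
    (hu : 0 ≤ u.im) (hv : 0 ≤ v.im) (hρ : 0 < ‖b - a‖) (ht : t ∈ Ioo (0 : ℝ) 1) (hy0 : 0 ≤ y)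
    (hx : ‖pth a b 1 1 (mobius ‖b - a‖ t) - u‖⁻¹ ≤ x * ((t + ‖b - a‖ * (1 - t)) / ‖b - a‖))
    (hy : ‖pth a b 1 1 (mobius ‖b - a‖ t) - v‖⁻¹ ≤ y * ((t + ‖b - a‖ * (1 - t)) / ‖b - a‖)) :
    ‖reparam ‖b - a‖ (fun τ => pull (pth a b 1 1) (omega u) τ - pull (pth a b 1 1) (omega v) τ) t‖
      ≤ ‖u - v‖ * (x * y) := by
  have hD := mobius_den_pos hρ ht
  have hm := mobius_mem hρ ht
  have hg := isGoodPath_pth a b (lam := 1) (mu := 1) (by simp) (by simp)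
  have hm1 : 0 < 1 - mobius ‖b - a‖ t := by linarith [hm.2]
  have hm0 := hm.1
  set γ := pth a b 1 1 (mobius ‖b - a‖ t) with hγ
  have hne : ∀ s : ℂ, 0 ≤ s.im → γ - s ≠ 0 := fun s hs => by
    have := avoids_eta ha hb (Or.inl hs) _ hm
    exact norm_pos_iff.1 (lt_of_lt_of_le (by positivity) this)
  have e : omega u γ - omega v γ = omega u γ * ((u - v) * (γ - v)⁻¹) := by
    have h1 := hne u hu
    have h2 := hne v hv
    have h3 : (γ - u)⁻¹ - (γ - v)⁻¹ = (γ - u)⁻¹ * ((u - v) * (γ - v)⁻¹) := by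
      field_simp; ring
    simp only [omega]
    linear_combination (2 * (Real.pi : ℂ) * I)⁻¹ * h3
  rw [reparam, pull, pull, ← sub_mul, ← hγ, e, norm_mul, norm_mul, norm_mul, norm_mul, norm_inv,
    Complex.norm_real, Real.norm_of_nonneg (by positivity)]
  set D := t + ‖b - a‖ * (1 - t) with hDdef
  have hx0 : 0 ≤ x * (D / ‖b - a‖) := (inv_nonneg.2 (norm_nonneg _)).trans hx
  calc ‖omega u γ‖ * (‖u - v‖ * ‖γ - v‖⁻¹) * ‖deriv (pth a b 1 1) (mobius ‖b - a‖ t)‖ *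
        (‖b - a‖ / D ^ 2)
      ≤ (1 / 6 * (x * (D / ‖b - a‖))) * (‖u - v‖ * (y * (D / ‖b - a‖))) * (3 * ‖b - a‖) *
        (‖b - a‖ / D ^ 2) := by
        gcongr
        · exact (norm_omega_le _ _).trans (by gcongr)
        · exact hg.speed _ hm
    _ = 1 / 2 * (‖u - v‖ * (x * y)) := by field_simp; ring
    _ ≤ ‖u - v‖ * (x * y) := by
        have hx' : 0 ≤ x := by
          by_contra hneg
          push Not at hneg
          have : x * (D / ‖b - a‖) < 0 := mul_neg_of_neg_of_pos hneg (by positivity)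
          linarith
        have : 0 ≤ ‖u - v‖ * (x * y) := by positivity
        linarith

/-- The kernel of the difference `ω_u - ω_v` in the rescaled parameter. -/
def diffKer (a u v p : ℂ) : ℝ → ℂ := reparam ‖fold p - a‖ fun τ =>
  pull (pth a (fold p) 1 1) (omega u) τ - pull (pth a (fold p) 1 1) (omega v) τ

lemma eventually_half_le_norm_fold_sub (a s : ℂ) :
    ∀ᶠ p in Bornology.cobounded ℂ, ‖fold p - a‖ / 2 ≤ ‖fold p - s‖ := by
  filter_upwards [(tendsto_norm_fold_sub a).eventually_ge_atTop (2 * ‖a - s‖)] with p hp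
  have : ‖fold p - a‖ ≤ ‖fold p - s‖ + ‖a - s‖ := by
    calc ‖fold p - a‖ = ‖(fold p - s) - (a - s)‖ := by congr 1; ring
      _ ≤ _ := norm_sub_le _ _
  linarith

/-- At most one of `u` and `v` is the base point, so at most one factor `1 / t` occurs. -/
lemma exists_diffKer_le {a u v : ℂ} (ha : a.im ≤ 0) (hu : 0 ≤ u.im) (hv : 0 ≤ v.im) (huv : u ≠ v) :
    ∃ B : ℝ, 0 ≤ B ∧ ∀ᶠ p in Bornology.cobounded ℂ, ∀ t ∈ Ioo (0 : ℝ) 1,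
      ‖diffKer a u v p t‖ ≤ B / t ∧ (u ≠ a → v ≠ a → ‖diffKer a u v p t‖ ≤ B) := by
  set cu := 16 + 8 / ‖a - u‖ with hcu
  set cv := 16 + 8 / ‖a - v‖ with hcv
  refine ⟨‖u - v‖ * (cu * cv), by positivity, ?_⟩
  have hev := (tendsto_norm_fold_sub a).eventually_gt_atTop 0
  filter_upwards [hev, eventually_half_le_norm_fold_sub a u,
    eventually_half_le_norm_fold_sub a v] with p hρ hpu hpv t ht
  have hb := fold_im_nonpos p
  have h0 := ht.1
  have near_u := inv_norm_pth_mobius_le ha hb hu hρ hpu ht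
  have near_v := inv_norm_pth_mobius_le ha hb hv hρ hpv ht
  have pos : ∀ s : ℂ, s ≠ a → 0 < ‖a - s‖ := fun s hs => norm_pos_iff.2 (sub_ne_zero.2 hs.symm)
  have far_u := fun h : u ≠ a => inv_norm_pth_mobius_le' ha hb hu hρ hpu (pos u h) le_rfl ht
  have far_v := fun h : v ≠ a => inv_norm_pth_mobius_le' ha hb hv hρ hpv (pos v h) le_rfl ht
  have hcu16 : 8 ≤ cu := by
    have : 0 ≤ 8 / ‖a - u‖ := by positivity
    rw [hcu]; linarith
  have hcv16 : 8 ≤ cv := by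
    have : 0 ≤ 8 / ‖a - v‖ := by positivity
    rw [hcv]; linarith
  refine ⟨?_, fun h1 h2 => norm_reparam_sub_le ha hb hu hv hρ ht (by positivity) (far_u h1)
    (far_v h2)⟩
  rcases eq_or_ne u a with h1 | h1
  · have h2 : v ≠ a := fun h => huv (h1.trans h.symm)
    refine (norm_reparam_sub_le ha hb hu hv hρ ht (by positivity) near_u (far_v h2)).trans ?_
    calc ‖u - v‖ * (8 / t * cv) ≤ ‖u - v‖ * (cu / t * cv) := by gcongr
      _ = _ := by ring
  · refine (norm_reparam_sub_le ha hb hu hv hρ ht (by positivity) (far_u h1) near_v).trans ?_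
    calc ‖u - v‖ * (cu * (8 / t)) ≤ ‖u - v‖ * (cu * (cv / t)) := by gcongr
      _ = _ := by ring

lemma one_le_betaKer {δ τ : ℝ} (hδ1 : δ ≤ 1) (hτ : τ ∈ Ioo (0 : ℝ) 1) : 1 ≤ betaKer δ τ := by
  have h1 : 0 < 1 - τ := by linarith [hτ.2]
  exact one_le_mul_of_one_le_of_one_le
    (Real.one_le_rpow_of_pos_of_le_one_of_nonpos hτ.1 hτ.2.le (by linarith))
    (Real.one_le_rpow_of_pos_of_le_one_of_nonpos h1 (by linarith [hτ.1]) (by linarith))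

/-- A singularity `1 / t` of the head is harmless if an inner integral with its weight follows; for
a single kernel boundedness is required. -/
lemma closedBound_of_head_le {δ C θ B : ℝ} {k : ℝ → ℂ} {l : List (ℝ → ℂ)} (hδ : 0 < δ)
    (hδ1 : 2 * δ ≤ 1) (hC : 0 ≤ C) (hθ : 0 ≤ θ) (hB : 0 ≤ B) (h : Tame δ C θ (k :: l))
    (h1 : ∀ t ∈ Ioo (0 : ℝ) 1, ‖k t‖ ≤ B / t) (h2 : l = [] → ∀ t ∈ Ioo (0 : ℝ) 1, ‖k t‖ ≤ B) :
    ClosedBound δ (B + B * ((C / δ) ^ l.length * θ)) (k :: l) := by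
  refine closedBound_cons hδ hC h hB (fun t ht => ?_) (fun hl t ht => ?_) (by linarith)
  · have h0 := ht.1
    have h1t : 0 < 1 - t := by linarith [ht.2]
    refine (h1 t ht).trans ?_
    rw [div_eq_mul_inv]
    gcongr
    rw [le_div_iff₀ (by positivity), show t⁻¹ * (t * (1 - t)) = 1 - t by field_simp]
    conv_lhs => rw [← Real.rpow_one (1 - t)]
    exact Real.rpow_le_rpow_of_exponent_ge h1t (by linarith) hδ1
  · have hb := one_le_betaKer (δ := δ) (by linarith) ht
    refine (h2 hl t ht).trans ?_
    have : 0 ≤ B * ((C / δ) ^ l.length * θ) := by positivity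
    nlinarith

lemma GoodWord.head_ne {a s : ℂ} {d : ℝ} (h : GoodWord a d [some s]) : s ≠ a := by
  have := h.pos.trans_le (h.last s (by simp))
  exact (sub_ne_zero.1 (norm_pos_iff.1 this)).symm

/-- The limit of the difference kernels. -/
def limDiffKer (a u v : ℂ) : ℝ → ℂ := fun τ => limKer a (some u) τ - limKer a (some v) τ

lemma tendsto_diffKer {a u v : ℂ} (ha : a.im ≤ 0) (hu : 0 ≤ u.im) (hv : 0 ≤ v.im) {t : ℝ}
    (ht : t ∈ Ioo (0 : ℝ) 1) :
    Tendsto (fun p => diffKer a u v p t) (Bornology.cobounded ℂ) (𝓝 (limDiffKer a u v t)) := by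
  have h1 := (tendsto_letter_ker (o := some u) ha (by simpa using hu) ht).sub
    (tendsto_letter_ker (o := some v) ha (by simpa using hv) ht)
  refine h1.congr fun p => ?_
  simp only [diffKer, reparam, Option.getD_some]
  ring

lemma GoodWord.kerConverges_limDiffKer {a u v : ℂ} {d : ℝ} {W : List (Option ℂ)}
    (hu : GoodWord a d (some u :: W)) (hv : GoodWord a d (some v :: W)) :
    KerConverges (limDiffKer a u v :: W.map (limKer a)) 1 := by
  have hd := hu.pos
  have ht := Tame.sub_head (by norm_num) (by positivity)
    (hu.tame_limKer (δ := 1 / 8) (by norm_num) (by norm_num))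
    (hv.tame_limKer (δ := 1 / 8) (by norm_num) (by norm_num))
  have hui := hu.im_nonneg u (by simp)
  have hvi := hv.im_nonneg v (by simp)
  rcases eq_or_ne u v with rfl | huv
  · refine ⟨fun s hs => ht.tail.kerConverges (by norm_num) (by norm_num) hs, ?_⟩
    simp only [limDiffKer, sub_self, zero_mul]
    exact intervalIntegrable_const
  · obtain ⟨B, hB, hev⟩ := exists_diffKer_le hu.base hui hvi huv
    refine ht.kerConverges_one (by norm_num) (by norm_num) (closedBound_of_head_le (B := B)
      (by norm_num) (by norm_num) (by norm_num) (by positivity) hB ht (fun t ht' => ?_)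
      fun hl t ht' => ?_)
    · refine le_of_tendsto (tendsto_diffKer hu.base hui hvi ht').norm ?_
      filter_upwards [hev] with p hp using (hp t ht').1
    · have hW : W = [] := by simpa using hl
      subst hW
      refine le_of_tendsto (tendsto_diffKer hu.base hui hvi ht').norm ?_
      filter_upwards [hev] with p hp using (hp t ht').2 hu.head_ne hv.head_ne

/-- The two integrals need not converge separately. Their heads are subtracted first, then the
parameter is rescaled, which does not change the integral, and dominated convergence applies. -/
lemma GoodWord.tendsto_wordInt_sub {a u v : ℂ} {d : ℝ} {W : List (Option ℂ)}
    (hu : GoodWord a d (some u :: W)) (hv : GoodWord a d (some v :: W)) (huv : u ≠ v) :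
    Tendsto (fun p => wordInt a (some u :: W) p - wordInt a (some v :: W) p)
      (Bornology.cobounded ℂ) (𝓝 (kerInt (limDiffKer a u v :: W.map (limKer a)) 1)) := by
  have hd := hu.pos
  have hui := hu.im_nonneg u (by simp)
  have hvi := hv.im_nonneg v (by simp)
  obtain ⟨B, hB, hev⟩ := exists_diffKer_le hu.base hui hvi huv
  have hcg : (Bornology.cobounded ℂ).IsCountablyGenerated := by
    rw [← comap_norm_atTop]; infer_instance
  -- In this alphabet the outer `none` is the difference `u - v`, and `some none` is the moving
  -- letter.
  set κ : ℂ → Option (Option ℂ) → ℝ → ℂ := fun p o => o.elim (diffKer a u v p) fun o =>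
    reparam ‖fold p - a‖ (pull (pth a (fold p) 1 1) (omega (o.getD p))) with hκ
  set κ₀ : Option (Option ℂ) → ℝ → ℂ := fun o => o.elim (limDiffKer a u v) (limKer a) with hκ₀
  have hev1 : ∀ᶠ p in Bornology.cobounded ℂ, 1 ≤ ‖fold p - a‖ :=
    (tendsto_norm_fold_sub a).eventually_ge_atTop 1
  -- the kernels before rescaling
  set l : ℂ → List (ℝ → ℂ) := fun p => (fun τ => pull (pth a (fold p) 1 1) (omega u) τ -
    pull (pth a (fold p) 1 1) (omega v) τ) :: wordKer (pth a (fold p) 1 1) (place p W) with hl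
  have hmap : ∀ p, (none :: W.map some).map (κ p) = (l p).map (reparam ‖fold p - a‖) := fun p => by
    simp only [hl, List.map_cons, wordKer_place_reparam]
    simp [hκ, diffKer, Function.comp_def]
  have htl : ∀ p, Tame (1 / 8) (2 * 4) ((1 + ‖fold p - a‖ / d) ^ (1 / 8 : ℝ)) (l p) := fun p =>
    Tame.sub_head (by norm_num) (by positivity)
      (hu.tame (by norm_num) (by norm_num) p) (hv.tame (by norm_num) (by norm_num) p)
  have ht : ∀ p, 1 ≤ ‖fold p - a‖ → Tame (1 / 8) (2 * 4) ((1 + 1 / d) ^ (1 / 8 : ℝ))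
      ((none :: W.map some).map (κ p)) := fun p hp => by
    have := Tame.sub_head (by norm_num) (by positivity)
      (hu.tame_reparam (δ := 1 / 8) (by norm_num) (by norm_num) hp)
      (hv.tame_reparam (δ := 1 / 8) (by norm_num) (by norm_num) hp)
    rw [hmap]
    have e : (l p).map (reparam ‖fold p - a‖) = _ :: _ := List.map_cons
    rw [e]
    convert this using 2
    · funext t
      simp only [reparam]
      exact sub_mul _ _ _
    · rfl
  set M := B + B * ((2 * 4 / (1 / 8)) ^ ((W.map some).map (κ 0)).length *
    (1 + 1 / d) ^ (1 / 8 : ℝ)) with hM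
  have hcl : ∀ᶠ p in Bornology.cobounded ℂ,
      ClosedBound (1 / 8) M ((none :: W.map some).map (κ p)) := by
    filter_upwards [hev, hev1] with p hp hp1
    have := closedBound_of_head_le (by norm_num) (by norm_num) (by norm_num) (by positivity) hB
      (ht p hp1) (fun t ht' => (hp t ht').1) (fun hl t ht' => by
        have hW : W = [] := by simpa using hl
        subst hW
        exact (hp t ht').2 hu.head_ne hv.head_ne)
    simpa [hM] using this
  have key := tendsto_kerInt_one (F := Bornology.cobounded ℂ) (by norm_num) (by norm_num)
    (none :: W.map some) κ κ₀ (hev1.mono ht) hcl ?_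
  · have e0 : (none :: W.map some).map κ₀ = limDiffKer a u v :: W.map (limKer a) := by
      simp [hκ₀, Function.comp_def]
    rw [e0] at key
    refine key.congr' ?_
    have hfar : ∀ s : ℂ, ∀ᶠ p in Bornology.cobounded ℂ, 1 ≤ ‖fold p - s‖ := fun s =>
      (tendsto_norm_fold_sub s).eventually_ge_atTop 1
    filter_upwards [hcl, hev1, hfar u, hfar v] with p hp hp1 hpu hpv
    have cu := hu.closedBound (δ := 1 / 8) (by norm_num) (by norm_num) p one_pos hpu
    have cv := hv.closedBound (δ := 1 / 8) (by norm_num) (by norm_num) p one_pos hpv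
    rw [hmap] at hp
    rw [hmap, kerInt_reparam_one (by norm_num) (by norm_num) (by linarith) (htl p)
      (ClosedBound.sub_head cu cv) hp]
    simp only [hl, kerInt, sub_mul]
    exact intervalIntegral.integral_sub
      ((hu.tame (by norm_num) (by norm_num) p).intervalIntegrable (by norm_num) (by norm_num) cu)
      ((hv.tame (by norm_num) (by norm_num) p).intervalIntegrable (by norm_num) (by norm_num) cv)
  · intro o ho t ht
    rcases List.mem_cons.1 ho with rfl | ho
    · exact tendsto_diffKer hu.base hui hvi ht
    · obtain ⟨o', ho', rfl⟩ := List.mem_map.1 ho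
      exact tendsto_letter_ker hu.base (fun s hs => by cases hs; exact hu.tail.im_nonneg s ho') ht

lemma kerInt_eq_zero_of_mem (l : List (ℝ → ℂ)) (h : (0 : ℝ → ℂ) ∈ l) (t : ℝ) : kerInt l t = 0 := by
  induction l generalizing t with
  | nil => simp at h
  | cons k l ih =>
    rcases List.mem_cons.1 h with rfl | h
    · simp [kerInt]
    · simp [kerInt, ih h]

/-- With `d₂` half of `‖fold p - a‖` the integral grows at most like `‖p‖ ^ (1 / 8)`. -/
lemma GoodWord.tendsto_wordInt_mul_inv {a s : ℂ} {d : ℝ} {W : List (Option ℂ)}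
    (h : GoodWord a d (some s :: W)) :
    Tendsto (fun p => wordInt a (some s :: W) p * (p - s)⁻¹) (Bornology.cobounded ℂ) (𝓝 0) := by
  obtain ⟨K, hK, hb⟩ := h.norm_wordInt_le (δ := 1 / 8) (by norm_num) (by norm_num)
  have hx : Tendsto (fun p => ‖p - s‖) (Bornology.cobounded ℂ) atTop := by
    refine tendsto_atTop_mono (fun p => norm_sub_norm_le p s) ?_
    exact tendsto_atTop_add_const_right _ _ tendsto_norm_cobounded_atTop
  have hlim : Tendsto (fun p => K * (2 ^ (1 / 8 : ℝ) * 2 ^ (2 * (1 / 8) : ℝ)) *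
      ‖p - s‖ ^ (-(7 / 8) : ℝ)) (Bornology.cobounded ℂ) (𝓝 0) := by
    have := ((tendsto_rpow_neg_atTop (by norm_num : (0 : ℝ) < 7 / 8)).comp hx).const_mul
      (K * (2 ^ (1 / 8 : ℝ) * 2 ^ (2 * (1 / 8) : ℝ)))
    simpa using this
  refine squeeze_zero_norm' ?_ hlim
  set c := 1 + ‖s‖ + ‖a‖ with hc
  filter_upwards [hx.eventually_ge_atTop c, eventually_half_le_norm_fold_sub a s,
    (tendsto_norm_fold_sub a).eventually_gt_atTop 0] with p h1 h2 h3
  have hc1 : 1 ≤ c := by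
    have := norm_nonneg s
    have := norm_nonneg a
    rw [hc]; linarith
  have hX : 0 < ‖p - s‖ := by linarith
  have h4 : 1 + ‖fold p - a‖ ≤ 2 * ‖p - s‖ := by
    have e1 := norm_sub_le (fold p) a
    rw [fold_norm] at e1
    have e2 : ‖p‖ ≤ ‖p - s‖ + ‖s‖ := by
      calc ‖p‖ = ‖(p - s) + s‖ := by congr 1; ring
        _ ≤ _ := norm_add_le _ _
    linarith
  have h5 := hb p (‖fold p - a‖ / 2) (by positivity) h2
  have e : ‖fold p - a‖ / (‖fold p - a‖ / 2) = 2 := by field_simp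
  rw [e] at h5
  rw [norm_mul, norm_inv]
  calc _ ≤ K * ((2 * ‖p - s‖) ^ (1 / 8 : ℝ) * 2 ^ (2 * (1 / 8) : ℝ)) * ‖p - s‖⁻¹ := by
        gcongr
        exact h5.trans (by gcongr)
    _ = _ := by
        rw [Real.mul_rpow (by norm_num) hX.le, show (-(7 / 8) : ℝ) = 1 / 8 + -1 by norm_num,
          Real.rpow_add hX, Real.rpow_neg_one]
        ring

/-! ### The primitive of the integrand -/

/-- The two-variable antisymmetric product of the forms of `u` and `v`. -/
def wedgeKer (u v p : ℂ) : ℂ :=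
  omega v ((starRingEnd ℂ) p) * omega u p - omega u ((starRingEnd ℂ) p) * omega v p

/-- The upper half plane without the points `u` and `v`. -/
def punctured (u v : ℂ) : Set ℂ := {p | 0 < p.im ∧ p ≠ u ∧ p ≠ v}

/-- The density on the plane that is supported in the upper half plane. -/
def density (a u v : ℂ) (W : List (Option ℂ)) : ℂ → ℂ :=
  (punctured u v).indicator fun p => 2 * (wordInt a W p * wedgeKer u v p)

/-- A primitive of the density with respect to `2 ∂/∂p̄`. -/
def primitive (a u v : ℂ) (W : List (Option ℂ)) (p : ℂ) : ℂ :=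
  -(wordInt a (some u :: W) p * omega v p) + wordInt a (some v :: W) p * omega u p

lemma differentiableAt_omega {s p : ℂ} (h : p ≠ s) : DifferentiableAt ℂ (omega s) p :=
  ((differentiableAt_id.sub_const s).fun_inv (sub_ne_zero.2 h)).const_mul _

lemma ne_fold_of_ne {s p : ℂ} (hs : 0 ≤ s.im) (h : p ≠ s) : s ≠ fold p := fun e => by
  have h1 : 0 < ‖p - s‖ := norm_pos_iff.2 (sub_ne_zero.2 h)
  have h2 := norm_sub_le_fold hs p
  rw [← e, sub_self, norm_zero] at h2
  linarith

section Primitive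

variable {a u v : ℂ} {d : ℝ} {W : List (Option ℂ)}

lemma GoodWord.continuousAt_wordInt_cons {s p : ℂ} (h : GoodWord a d (some s :: W)) (hp : p ≠ s) :
    ContinuousAt (wordInt a (some s :: W)) p :=
  h.continuousAt_wordInt (ne_fold_of_ne (h.im_nonneg s (by simp)) hp)

lemma continuousAt_primitive (hu : GoodWord a d (some u :: W)) (hv : GoodWord a d (some v :: W))
    {p : ℂ} (hpu : p ≠ u) (hpv : p ≠ v) : ContinuousAt (primitive a u v W) p :=
  ((hu.continuousAt_wordInt_cons hpu).mul (differentiableAt_omega hpv).continuousAt).neg.add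
    ((hv.continuousAt_wordInt_cons hpv).mul (differentiableAt_omega hpu).continuousAt)

/-- Above the axis each product loses its first letter and the two terms form `wedgeKer`; below the
axis everything is holomorphic and the density is zero. -/
lemma hasDbar_primitive (hu : GoodWord a d (some u :: W)) (hv : GoodWord a d (some v :: W))
    {p : ℂ} (hp : p.im ≠ 0) (hpu : p ≠ u) (hpv : p ≠ v) (hpa : p ≠ a) :
    HasDbar (primitive a u v W) (density a u v W p) p := by
  have ou := HasDbar.of_differentiableAt (differentiableAt_omega hpu)
  have ov := HasDbar.of_differentiableAt (differentiableAt_omega hpv)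
  rcases lt_or_gt_of_ne hp with h | h
  · have hnot : p ∉ punctured u v := fun hh => absurd hh.1 (not_lt.2 h.le)
    have := ((HasDbar.of_differentiableAt (hu.differentiableAt_wordInt h hpa)).mul ov).neg.add
      ((HasDbar.of_differentiableAt (hv.differentiableAt_wordInt h hpa)).mul ou)
    rw [density, indicator_of_notMem hnot]
    convert this using 1
    · rfl
    · ring
  · have hmem : p ∈ punctured u v := ⟨h, hpu, hpv⟩
    have := ((hu.hasDbar_wordInt h).mul ov).neg.add ((hv.hasDbar_wordInt h).mul ou)
    rw [density, indicator_of_mem hmem, wedgeKer]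
    convert this using 1
    · rfl
    · ring

/-- With `d₂ = ‖p - s‖` the integral is at most of order `‖p - s‖ ^ (-1 / 4)`. This matters for real
`s`, where the end point of the path runs into the first letter. -/
lemma GoodWord.tendsto_sub_mul_wordInt {s : ℂ} (h : GoodWord a d (some s :: W)) :
    Tendsto (fun p => (p - s) * wordInt a (some s :: W) p) (𝓝[≠] s) (𝓝 0) := by
  obtain ⟨K, hK, hb⟩ := h.norm_wordInt_le (δ := 1 / 8) (by norm_num) (by norm_num)
  have hc : Continuous fun p => K * ((1 + ‖fold p - a‖) ^ (1 / 8 : ℝ) *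
      ‖fold p - a‖ ^ (2 * (1 / 8) : ℝ)) * ‖p - s‖ ^ (3 / 4 : ℝ) := by
    have := continuous_fold
    refine (continuous_const.mul ((Continuous.rpow_const (by fun_prop) (by norm_num)).mul
      (Continuous.rpow_const (by fun_prop) (by norm_num)))).mul
      (Continuous.rpow_const (by fun_prop) (by norm_num))
  have h0 := hc.tendsto s
  rw [sub_self, norm_zero, Real.zero_rpow (by norm_num), mul_zero] at h0
  refine squeeze_zero_norm' ?_ (h0.mono_left nhdsWithin_le_nhds)
  filter_upwards [self_mem_nhdsWithin] with p hp
  have hpos : 0 < ‖p - s‖ := norm_pos_iff.2 (sub_ne_zero.2 hp)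
  have h1 := hb p ‖p - s‖ hpos (norm_sub_le_fold (h.im_nonneg s (by simp)) p)
  rw [norm_mul]
  calc ‖p - s‖ * ‖wordInt a (some s :: W) p‖ ≤ ‖p - s‖ * (K * ((1 + ‖fold p - a‖) ^ (1 / 8 : ℝ) *
        (‖fold p - a‖ / ‖p - s‖) ^ (2 * (1 / 8) : ℝ))) := by gcongr
    _ = K * ((1 + ‖fold p - a‖) ^ (1 / 8 : ℝ) * ‖fold p - a‖ ^ (2 * (1 / 8) : ℝ)) *
        (‖p - s‖ / ‖p - s‖ ^ (2 * (1 / 8) : ℝ)) := by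
        rw [Real.div_rpow (norm_nonneg _) hpos.le]; ring
    _ = _ := by
        congr 1
        rw [show (3 / 4 : ℝ) = 1 - 2 * (1 / 8) by norm_num, Real.rpow_sub hpos, Real.rpow_one]

lemma tendsto_sub_mul_primitive_left (hu : GoodWord a d (some u :: W))
    (hv : GoodWord a d (some v :: W)) (huv : u ≠ v) :
    Tendsto (fun p => (p - u) * primitive a u v W p) (𝓝[≠] u)
      (𝓝 ((2 * (Real.pi : ℂ) * I)⁻¹ * wordInt a (some v :: W) u)) := by
  have h1 := hu.tendsto_sub_mul_wordInt.mul
    ((differentiableAt_omega huv).continuousAt.tendsto.mono_left nhdsWithin_le_nhds)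
  have h2 := ((hv.continuousAt_wordInt_cons huv).tendsto.mono_left
    (nhdsWithin_le_nhds (s := {u}ᶜ))).const_mul (2 * (Real.pi : ℂ) * I)⁻¹
  have h3 := h1.neg.add h2
  rw [zero_mul, neg_zero, zero_add] at h3
  refine h3.congr' ?_
  filter_upwards [self_mem_nhdsWithin] with p hp
  have : p - u ≠ 0 := sub_ne_zero.2 hp
  simp only [primitive, omega]
  field_simp

lemma tendsto_sub_mul_primitive_right (hu : GoodWord a d (some u :: W))
    (hv : GoodWord a d (some v :: W)) (huv : u ≠ v) :
    Tendsto (fun p => (p - v) * primitive a u v W p) (𝓝[≠] v)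
      (𝓝 (-((2 * (Real.pi : ℂ) * I)⁻¹ * wordInt a (some u :: W) v))) := by
  refine (tendsto_sub_mul_primitive_left hv hu huv.symm).neg.congr fun p => ?_
  simp only [primitive]
  ring

/-- Writing `F_u`, `F_v` for the two integrals, `2πi A` equals `-(F_u - F_v) / (p - v) + F_v (1 / (p
- u) - 1 / (p - v))`. The last bracket is `O(p⁻²)` and beats the sublinear growth of `F_v`. -/
lemma tendsto_mul_primitive (hu : GoodWord a d (some u :: W)) (hv : GoodWord a d (some v :: W))
    (huv : u ≠ v) :
    Tendsto (fun p => p * primitive a u v W p) (Bornology.cobounded ℂ)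
      (𝓝 (-((2 * (Real.pi : ℂ) * I)⁻¹ * kerInt (limDiffKer a u v :: W.map (limKer a)) 1))) := by
  have h1 := ((hu.tendsto_wordInt_sub hv huv).mul (tendsto_mul_inv_sub v)).const_mul
    (2 * (Real.pi : ℂ) * I)⁻¹
  have h2 := ((hv.tendsto_wordInt_mul_inv.mul (tendsto_mul_inv_sub u)).mul_const (u - v)).const_mul
    (2 * (Real.pi : ℂ) * I)⁻¹
  have h3 := h1.neg.add h2
  rw [mul_one, zero_mul, zero_mul, mul_zero, add_zero] at h3
  refine h3.congr' ?_
  have hne : ∀ s : ℂ, ∀ᶠ p : ℂ in Bornology.cobounded ℂ, p ≠ s := fun s =>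
    Bornology.isBounded_singleton (x := s)
  filter_upwards [hne u, hne v] with p hpu hpv
  have e : (p - u)⁻¹ - (p - v)⁻¹ = (p - v)⁻¹ * (p - u)⁻¹ * (u - v) := by
    have := sub_ne_zero.2 hpu
    have := sub_ne_zero.2 hpv
    field_simp
    ring
  simp only [primitive, omega]
  linear_combination (-(2 * (Real.pi : ℂ) * I)⁻¹ * p * wordInt a (some v :: W) p) * e

/-! ### Integrability of the density -/

/-- The radial majorant of the density near a puncture. -/
def majorant (r : ℝ) : ℝ := r ^ (-(13 / 8) : ℝ) * (1 + r) ^ (-(5 / 4) : ℝ)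

lemma majorant_nonneg {r : ℝ} (hr : 0 ≤ r) : 0 ≤ majorant r := by
  unfold majorant; positivity

lemma integrable_majorant (q : ℂ) : Integrable fun p : ℂ => majorant ‖p - q‖ := by
  have h0 : Integrable fun p : ℂ => majorant ‖p‖ := by
    rw [integrable_fun_norm_addHaar volume (f := majorant), Complex.finrank_real_complex]
    simp only [Nat.add_one_sub_one, pow_one, smul_eq_mul]
    have hm : Measurable fun y : ℝ => y * majorant y := by
      unfold majorant
      fun_prop
    rw [← Ioc_union_Ioi_eq_Ioi (zero_le_one' ℝ)]
    refine IntegrableOn.union ?_ ?_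
    · have h1 := (intervalIntegrable_iff_integrableOn_Ioc_of_le zero_le_one).1
        (intervalIntegral.intervalIntegrable_rpow' (a := 0) (b := 1)
          (by norm_num : (-1 : ℝ) < -(5 / 8)))
      refine Integrable.mono' h1 hm.aestronglyMeasurable ?_
      refine (ae_restrict_iff' measurableSet_Ioc).2 (Eventually.of_forall fun y hy => ?_)
      have hy0 := hy.1
      have hn := majorant_nonneg hy0.le
      rw [Real.norm_of_nonneg (by positivity), majorant, ← mul_assoc]
      have e : y * y ^ (-(13 / 8) : ℝ) = y ^ (-(5 / 8) : ℝ) := by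
        rw [← Real.rpow_one_add' hy0.le (by norm_num)]; norm_num
      rw [e]
      refine mul_le_of_le_one_right (by positivity) ?_
      exact Real.rpow_le_one_of_one_le_of_nonpos (by linarith) (by norm_num)
    · have h1 := integrableOn_Ioi_rpow_of_lt (by norm_num : (-(15 / 8) : ℝ) < -1) one_pos
      refine Integrable.mono' h1 hm.aestronglyMeasurable ?_
      refine (ae_restrict_iff' measurableSet_Ioi).2 (Eventually.of_forall fun y hy => ?_)
      have hy1 : (1 : ℝ) < y := hy
      have hy0 : 0 < y := by linarith
      have hn := majorant_nonneg hy0.le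
      rw [Real.norm_of_nonneg (by positivity), majorant, ← mul_assoc]
      have e : y ^ (-(15 / 8) : ℝ) = y * y ^ (-(13 / 8) : ℝ) * y ^ (-(5 / 4) : ℝ) := by
        rw [← Real.rpow_one_add' hy0.le (by norm_num), ← Real.rpow_add hy0]; norm_num
      rw [e]
      gcongr ?_ * ?_
      exact Real.rpow_le_rpow_of_nonpos hy0 (by linarith) (by norm_num)
  exact h0.comp_sub_right q

/-- The point `p` is closer to `u`, so `‖p - v‖` is bounded below by a multiple of `1 + ‖p - u‖`;
the exponents combine as `3 / 8 - 13 / 8 = -5 / 4`. The majorant is integrable since `13 / 8 < 2 <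
13 / 8 + 5 / 4`. -/
lemma rpow_mul_le_majorant {u v p : ℂ} (huv : u ≠ v) (hpu : p ≠ u)
    (hrs : ‖p - u‖ ≤ ‖p - v‖) :
    (1 + ‖p‖) ^ (3 / 8 : ℝ) * (‖p - u‖ * ‖p - v‖) ^ (-(13 / 8) : ℝ) ≤
      (1 + ‖u‖) ^ (3 / 8 : ℝ) * (1 + 2 / ‖u - v‖) ^ (13 / 8 : ℝ) * majorant ‖p - u‖ := by
  have hD : 0 < ‖u - v‖ := norm_pos_iff.2 (sub_ne_zero.2 huv)
  have hr : 0 < ‖p - u‖ := norm_pos_iff.2 (sub_ne_zero.2 hpu)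
  have hs : 0 < ‖p - v‖ := by linarith
  set r := ‖p - u‖ with hrdef
  set s := ‖p - v‖ with hsdef
  set D := ‖u - v‖ with hDdef
  have hDle : D ≤ 2 * s := by
    have : D ≤ s + r := by
      calc D = ‖(p - v) - (p - u)‖ := by rw [hDdef]; congr 1; ring
        _ ≤ _ := norm_sub_le _ _
    linarith
  have h1 : 1 + ‖p‖ ≤ (1 + ‖u‖) * (1 + r) := by
    have : ‖p‖ ≤ r + ‖u‖ := by
      calc ‖p‖ = ‖(p - u) + u‖ := by congr 1; ring
        _ ≤ _ := norm_add_le _ _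
    nlinarith [norm_nonneg u, mul_nonneg (norm_nonneg u) hr.le]
  have h2 : 1 + r ≤ (1 + 2 / D) * s := by
    have : 1 ≤ 2 / D * s := by
      rw [div_mul_eq_mul_div, le_div_iff₀ hD]; linarith
    nlinarith
  have h3 : s ^ (-(13 / 8) : ℝ) ≤ (1 + 2 / D) ^ (13 / 8 : ℝ) * (1 + r) ^ (-(13 / 8) : ℝ) := by
    have h4 : (1 + r) / (1 + 2 / D) ≤ s := by
      rw [div_le_iff₀ (by positivity)]; linarith
    have h5 := Real.rpow_le_rpow_of_nonpos (by positivity) h4 (by norm_num : (-(13 / 8) : ℝ) ≤ 0)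
    refine h5.trans (le_of_eq ?_)
    rw [Real.div_rpow (by positivity) (by positivity), Real.rpow_neg (by positivity : 0 ≤ 1 + 2 / D),
      div_inv_eq_mul, mul_comm]
  calc (1 + ‖p‖) ^ (3 / 8 : ℝ) * (r * s) ^ (-(13 / 8) : ℝ)
      ≤ ((1 + ‖u‖) * (1 + r)) ^ (3 / 8 : ℝ) * (r ^ (-(13 / 8) : ℝ) *
        ((1 + 2 / D) ^ (13 / 8 : ℝ) * (1 + r) ^ (-(13 / 8) : ℝ))) := by
        rw [Real.mul_rpow hr.le hs.le]
        gcongr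
    _ = (1 + ‖u‖) ^ (3 / 8 : ℝ) * (1 + 2 / D) ^ (13 / 8 : ℝ) * (r ^ (-(13 / 8) : ℝ) *
        ((1 + r) ^ (3 / 8 : ℝ) * (1 + r) ^ (-(13 / 8) : ℝ))) := by
        rw [Real.mul_rpow (by positivity) (by positivity)]; ring
    _ = _ := by
        rw [← Real.rpow_add (by positivity : 0 < 1 + r), majorant]; norm_num

/-- Antisymmetry yields a factor `p.im` in the numerator over all four linear factors. Against the
weight `p.im ^ (-1 / 4)` there remains `p.im ^ (3 / 4)`, which is shared equally between the
distances of `p̄` from `u` and `v`; then `1 + 5 / 8 = 13 / 8`. -/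
lemma norm_wedgeKer_le {p : ℂ} (hu : 0 ≤ u.im) (hv : 0 ≤ v.im) (hp : p ∈ punctured u v) :
    ‖wedgeKer u v p‖ * p.im ^ (-(1 / 4) : ℝ) ≤
      ‖u - v‖ * (‖p - u‖ * ‖p - v‖) ^ (-(13 / 8) : ℝ) := by
  obtain ⟨him, hpu, hpv⟩ := hp
  have hr : 0 < ‖p - u‖ := norm_pos_iff.2 (sub_ne_zero.2 hpu)
  have hs : 0 < ‖p - v‖ := norm_pos_iff.2 (sub_ne_zero.2 hpv)
  have hfold := fold_of_nonneg him.le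
  have hr1 := norm_sub_le_fold hu p
  have hs1 := norm_sub_le_fold hv p
  have hr2 := abs_im_le_norm_fold_sub hu p
  have hs2 := abs_im_le_norm_fold_sub hv p
  rw [hfold] at hr1 hs1 hr2 hs2
  rw [abs_of_pos him] at hr2 hs2
  set r := ‖p - u‖ with hrdef
  set s := ‖p - v‖ with hsdef
  set r' := ‖(starRingEnd ℂ) p - u‖ with hr'
  set s' := ‖(starRingEnd ℂ) p - v‖ with hs'
  have hr'0 : 0 < r' := by linarith
  have hs'0 : 0 < s' := by linarith
  have e : wedgeKer u v p = ((2 * (Real.pi : ℂ) * I)⁻¹) ^ 2 * ((u - v) * (-(2 * (p.im : ℂ) * I)) *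
      (((p - u)⁻¹ * (p - v)⁻¹) * (((starRingEnd ℂ) p - u)⁻¹ * ((starRingEnd ℂ) p - v)⁻¹))) := by
    have h1 : p - u ≠ 0 := sub_ne_zero.2 hpu
    have h2 : p - v ≠ 0 := sub_ne_zero.2 hpv
    have h3 : (starRingEnd ℂ) p - u ≠ 0 := norm_pos_iff.1 hr'0
    have h4 : (starRingEnd ℂ) p - v ≠ 0 := norm_pos_iff.1 hs'0
    have h5 : p - (starRingEnd ℂ) p = 2 * (p.im : ℂ) * I := by
      rw [Complex.sub_conj]; push_cast; ring
    have h6 : ((starRingEnd ℂ) p - v)⁻¹ * (p - u)⁻¹ - ((starRingEnd ℂ) p - u)⁻¹ * (p - v)⁻¹ =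
        (u - v) * (-(p - (starRingEnd ℂ) p)) *
      (((p - u)⁻¹ * (p - v)⁻¹) * (((starRingEnd ℂ) p - u)⁻¹ * ((starRingEnd ℂ) p - v)⁻¹)) := by
      field_simp
      ring
    rw [← h5, ← h6]
    simp only [wedgeKer, omega]
    ring
  have hpi : ‖(2 * (Real.pi : ℂ) * I)⁻¹‖ ≤ 1 / 6 := by
    simp only [norm_inv, norm_mul, Complex.norm_two, Complex.norm_real, norm_I, mul_one,
      Real.norm_of_nonneg Real.pi_pos.le]
    rw [inv_le_comm₀ (by positivity) (by norm_num)]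
    linarith [Real.pi_gt_three]
  have hle : ‖wedgeKer u v p‖ ≤ ‖u - v‖ * (p.im * ((r⁻¹ * s⁻¹) * (r'⁻¹ * s'⁻¹))) := by
    rw [e]
    simp only [norm_mul, norm_pow, norm_neg, norm_I, Complex.norm_two, mul_one,
      Complex.norm_real, Real.norm_of_nonneg him.le]
    rw [norm_inv (p - u), norm_inv (p - v), norm_inv (_ - u), norm_inv (_ - v), ← hrdef, ← hsdef,
      ← hr', ← hs']
    calc _ ≤ (1 / 6) ^ 2 * (‖u - v‖ * (2 * p.im) * (r⁻¹ * s⁻¹ * (r'⁻¹ * s'⁻¹))) := by gcongr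
      _ = 1 / 18 * (‖u - v‖ * (p.im * ((r⁻¹ * s⁻¹) * (r'⁻¹ * s'⁻¹)))) := by ring
      _ ≤ _ := by
        have : 0 ≤ ‖u - v‖ * (p.im * ((r⁻¹ * s⁻¹) * (r'⁻¹ * s'⁻¹))) := by positivity
        linarith
  have him1 : p.im * p.im ^ (-(1 / 4) : ℝ) ≤ r' ^ (3 / 8 : ℝ) * s' ^ (3 / 8 : ℝ) := by
    have e1 : p.im * p.im ^ (-(1 / 4) : ℝ) = p.im ^ (3 / 8 : ℝ) * p.im ^ (3 / 8 : ℝ) := by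
      rw [← Real.rpow_one_add' him.le (by norm_num), ← Real.rpow_add him]; norm_num
    rw [e1]
    gcongr
  have hq : ∀ x x' : ℝ, 0 < x → x ≤ x' → x⁻¹ * (x'⁻¹ * x' ^ (3 / 8 : ℝ)) ≤ x ^ (-(13 / 8) : ℝ) := by
    intro x x' hx hxx
    have hx' : 0 < x' := hx.trans_le hxx
    have e1 : x'⁻¹ * x' ^ (3 / 8 : ℝ) = x' ^ (-(5 / 8) : ℝ) := by
      rw [← Real.rpow_neg_one, ← Real.rpow_add hx']; norm_num
    have e2 : x ^ (-(13 / 8) : ℝ) = x⁻¹ * x ^ (-(5 / 8) : ℝ) := by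
      rw [← Real.rpow_neg_one, ← Real.rpow_add hx]; norm_num
    rw [e1, e2]
    gcongr ?_ * ?_
    exact Real.rpow_le_rpow_of_nonpos hx hxx (by norm_num)
  calc ‖wedgeKer u v p‖ * p.im ^ (-(1 / 4) : ℝ)
      ≤ ‖u - v‖ * (p.im * ((r⁻¹ * s⁻¹) * (r'⁻¹ * s'⁻¹))) * p.im ^ (-(1 / 4) : ℝ) := by gcongr
    _ = ‖u - v‖ * ((r⁻¹ * s⁻¹) * (r'⁻¹ * s'⁻¹)) * (p.im * p.im ^ (-(1 / 4) : ℝ)) := by ring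
    _ ≤ ‖u - v‖ * ((r⁻¹ * s⁻¹) * (r'⁻¹ * s'⁻¹)) * (r' ^ (3 / 8 : ℝ) * s' ^ (3 / 8 : ℝ)) := by gcongr
    _ = ‖u - v‖ * ((r⁻¹ * (r'⁻¹ * r' ^ (3 / 8 : ℝ))) * (s⁻¹ * (s'⁻¹ * s' ^ (3 / 8 : ℝ)))) := by ring
    _ ≤ ‖u - v‖ * (r ^ (-(13 / 8) : ℝ) * s ^ (-(13 / 8) : ℝ)) := by
        gcongr
        · exact hq r r' hr hr1
        · exact hq s s' hs hs1
    _ = _ := by rw [Real.mul_rpow hr.le hs.le]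

/-- The first letter of `W` is arbitrary, possibly the moving one; in any case its distance from
`p̄` is at least `p.im`. The exponent `3 / 8` is `1 / 8 + 1 / 4`. -/
lemma GoodWord.norm_wordInt_le_of_im_pos (h : GoodWord a d W) :
    ∃ K : ℝ, 0 ≤ K ∧ ∀ p : ℂ, 0 < p.im →
      ‖wordInt a W p‖ ≤ K * ((1 + ‖p‖) ^ (3 / 8 : ℝ) * p.im ^ (-(1 / 4) : ℝ)) := by
  set c := 2 + ‖a‖ with hc
  have hc0 : 0 < c := by positivity
  have hmain : ∃ K : ℝ, 0 ≤ K ∧ ∀ p : ℂ, 0 < p.im → ‖wordInt a W p‖ ≤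
      K * ((1 + ‖fold p - a‖) ^ (1 / 8 : ℝ) * (1 + ‖fold p - a‖ / p.im) ^ (1 / 4 : ℝ)) := by
    cases W with
    | nil =>
      refine ⟨1, zero_le_one, fun p hp => ?_⟩
      have e : wordInt a [] p = 1 := rfl
      rw [e, norm_one, one_mul]
      have h1 : 0 ≤ ‖fold p - a‖ := norm_nonneg _
      have h2 : 0 ≤ ‖fold p - a‖ / p.im := by positivity
      exact one_le_mul_of_one_le_of_one_le (Real.one_le_rpow (by linarith) (by norm_num))
        (Real.one_le_rpow (by linarith) (by norm_num))
    | cons o V =>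
      obtain ⟨K, hK, hb⟩ := h.norm_wordInt_le (δ := 1 / 8) (by norm_num) (by norm_num)
      refine ⟨K, hK, fun p hp => ?_⟩
      have h1 : p.im ≤ ‖fold p - o.getD p‖ := by
        have h2 := abs_im_le_norm_fold_sub
          (h.place_im_nonneg hp.le (o.getD p) (List.mem_map_of_mem (by simp))) p
        rwa [abs_of_pos hp] at h2
      refine (hb p p.im hp h1).trans ?_
      rw [show (2 * (1 / 8) : ℝ) = 1 / 4 by norm_num]
      gcongr
      linarith
  obtain ⟨K, hK, hb⟩ := hmain
  refine ⟨K * c ^ (3 / 8 : ℝ), by positivity, fun p hp => (hb p hp).trans ?_⟩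
  have h1 : ‖fold p - a‖ ≤ ‖p‖ + ‖a‖ := by
    have := norm_sub_le (fold p) a
    rwa [fold_norm] at this
  have h2 : p.im ≤ ‖p‖ := (le_abs_self _).trans (Complex.abs_im_le_norm p)
  have hn := norm_nonneg p
  have hna := norm_nonneg a
  have h3 : 1 + ‖fold p - a‖ ≤ c * (1 + ‖p‖) := by rw [hc]; nlinarith
  have h4 : p.im + ‖fold p - a‖ ≤ c * (1 + ‖p‖) := by rw [hc]; nlinarith
  have e1 : (1 + ‖fold p - a‖ / p.im) ^ (1 / 4 : ℝ) =
      (p.im + ‖fold p - a‖) ^ (1 / 4 : ℝ) * p.im ^ (-(1 / 4) : ℝ) := by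
    have : 1 + ‖fold p - a‖ / p.im = (p.im + ‖fold p - a‖) / p.im := by field_simp
    rw [this, Real.div_rpow (by positivity) hp.le, Real.rpow_neg hp.le, div_eq_mul_inv]
  have e2 : c ^ (3 / 8 : ℝ) * (1 + ‖p‖) ^ (3 / 8 : ℝ) =
      (c * (1 + ‖p‖)) ^ (1 / 8 : ℝ) * (c * (1 + ‖p‖)) ^ (1 / 4 : ℝ) := by
    rw [← Real.mul_rpow hc0.le (by positivity), ← Real.rpow_add (by positivity)]; norm_num
  rw [e1]
  calc _ ≤ K * ((c * (1 + ‖p‖)) ^ (1 / 8 : ℝ) * ((c * (1 + ‖p‖)) ^ (1 / 4 : ℝ) *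
        p.im ^ (-(1 / 4) : ℝ))) := by gcongr
    _ = K * (((c * (1 + ‖p‖)) ^ (1 / 8 : ℝ) * (c * (1 + ‖p‖)) ^ (1 / 4 : ℝ)) *
        p.im ^ (-(1 / 4) : ℝ)) := by ring
    _ = _ := by rw [← e2]; ring

lemma GoodWord.continuousAt_wordInt_of_im_pos (h : GoodWord a d W) {p : ℂ} (hp : 0 < p.im) :
    ContinuousAt (wordInt a W) p := by
  cases W with
  | nil => exact continuousAt_const
  | cons o V =>
    refine h.continuousAt_wordInt fun e => ?_
    have h1 := h.place_im_nonneg hp.le (o.getD p) (List.mem_map_of_mem (by simp))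
    rw [e, fold_of_nonneg hp.le, Complex.conj_im] at h1
    linarith

lemma isOpen_punctured (u v : ℂ) : IsOpen (punctured u v) :=
  (isOpen_lt continuous_const Complex.continuous_im).inter (isOpen_ne.inter isOpen_ne)

lemma integrable_density (h : GoodWord a d W) (hu : 0 ≤ u.im) (hv : 0 ≤ v.im) (huv : u ≠ v) :
    Integrable (density a u v W) := by
  obtain ⟨K, hK, hb⟩ := h.norm_wordInt_le_of_im_pos
  have hD : 0 < ‖u - v‖ := norm_pos_iff.2 (sub_ne_zero.2 huv)
  set Cu := (1 + ‖u‖) ^ (3 / 8 : ℝ) * (1 + 2 / ‖u - v‖) ^ (13 / 8 : ℝ) with hCu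
  set Cv := (1 + ‖v‖) ^ (3 / 8 : ℝ) * (1 + 2 / ‖v - u‖) ^ (13 / 8 : ℝ) with hCv
  have hmaj : Integrable fun p : ℂ => 2 * K * ‖u - v‖ *
      (Cu * majorant ‖p - u‖ + Cv * majorant ‖p - v‖) :=
    (((integrable_majorant u).const_mul Cu).add ((integrable_majorant v).const_mul Cv)).const_mul _
  have hmeas : MeasurableSet (punctured u v) := (isOpen_punctured u v).measurableSet
  refine (integrable_indicator_iff hmeas).2 ?_
  have hcont : ContinuousOn (fun p => 2 * (wordInt a W p * wedgeKer u v p)) (punctured u v) := by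
    rintro p ⟨h1, h2, h3⟩
    have hconj : ∀ s : ℂ, 0 ≤ s.im →
        ContinuousAt (fun p => omega s ((starRingEnd ℂ) p)) p := fun s hs => by
      refine ContinuousAt.comp (f := fun p : ℂ => (starRingEnd ℂ) p)
        (differentiableAt_omega fun e => ?_).continuousAt Complex.continuous_conj.continuousAt
      have := congrArg Complex.im e
      rw [Complex.conj_im] at this
      linarith
    refine (continuousAt_const.mul ((h.continuousAt_wordInt_of_im_pos h1).mul
      (((hconj v hv).mul (differentiableAt_omega h2).continuousAt).sub
      ((hconj u hu).mul (differentiableAt_omega h3).continuousAt)))).continuousWithinAt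
  refine Integrable.mono' hmaj.integrableOn (hcont.aestronglyMeasurable hmeas) ?_
  refine (ae_restrict_iff' hmeas).2 (Eventually.of_forall fun p hp => ?_)
  have h1 := hb p hp.1
  have h2 := norm_wedgeKer_le hu hv hp
  have hM : (1 + ‖p‖) ^ (3 / 8 : ℝ) * (‖p - u‖ * ‖p - v‖) ^ (-(13 / 8) : ℝ) ≤
      Cu * majorant ‖p - u‖ + Cv * majorant ‖p - v‖ := by
    have hmu := majorant_nonneg (norm_nonneg (p - u))
    have hmv := majorant_nonneg (norm_nonneg (p - v))
    rcases le_total ‖p - u‖ ‖p - v‖ with hle | hle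
    · refine (rpow_mul_le_majorant huv hp.2.1 hle).trans ?_
      have : 0 ≤ Cv * majorant ‖p - v‖ := by positivity
      linarith
    · rw [mul_comm ‖p - u‖]
      refine (rpow_mul_le_majorant huv.symm hp.2.2 hle).trans ?_
      have : 0 ≤ Cu * majorant ‖p - u‖ := by positivity
      linarith
  rw [norm_mul, Complex.norm_two, norm_mul]
  have him := hp.1
  calc 2 * (‖wordInt a W p‖ * ‖wedgeKer u v p‖)
      ≤ 2 * (K * ((1 + ‖p‖) ^ (3 / 8 : ℝ) * p.im ^ (-(1 / 4) : ℝ)) * ‖wedgeKer u v p‖) := by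
        gcongr
    _ = 2 * K * (1 + ‖p‖) ^ (3 / 8 : ℝ) * (‖wedgeKer u v p‖ * p.im ^ (-(1 / 4) : ℝ)) := by ring
    _ ≤ 2 * K * (1 + ‖p‖) ^ (3 / 8 : ℝ) *
        (‖u - v‖ * (‖p - u‖ * ‖p - v‖) ^ (-(13 / 8) : ℝ)) := by gcongr
    _ = 2 * K * ‖u - v‖ * ((1 + ‖p‖) ^ (3 / 8 : ℝ) *
        (‖p - u‖ * ‖p - v‖) ^ (-(13 / 8) : ℝ)) := by ring
    _ ≤ _ := by gcongr

lemma I_mul_integral_density (hu : GoodWord a d (some u :: W)) (hv : GoodWord a d (some v :: W))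
    (huv : u ≠ v) :
    I * ∫ p, density a u v W p = wordInt a (some u :: W) v - wordInt a (some v :: W) u -
      kerInt (limDiffKer a u v :: W.map (limKer a)) 1 := by
  have hui := hu.im_nonneg u (by simp)
  have hvi := hv.im_nonneg v (by simp)
  have key := integral_eq_residues (N := {u, v, a}) huv
    ((((finite_singleton a).insert v).insert u).countable)
    (fun p hpu hpv => continuousAt_primitive hu hv hpu hpv)
    (integrable_density hu.tail hui hvi huv)
    (fun p hp hN => by
      simp only [mem_insert_iff, mem_singleton_iff, not_or] at hN
      exact hasDbar_primitive hu hv hp hN.1 hN.2.1 hN.2.2)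
    (tendsto_mul_primitive hu hv huv) (tendsto_sub_mul_primitive_left hu hv huv)
    (tendsto_sub_mul_primitive_right hu hv huv)
  rw [key]
  have hpi : (Real.pi : ℂ) ≠ 0 := by exact_mod_cast Real.pi_ne_zero
  have hI := I_ne_zero
  field_simp
  ring

end Primitive

/-! ### The propagators -/

lemma propagator_apply {s p : ℂ} (hs : 0 ≤ s.im) (hp : 0 < p.im) (hps : p ≠ s) (x : ℂ) :
    propagator s p x = omega s p * x - omega s ((starRingEnd ℂ) p) * (starRingEnd ℂ) x := by
  have h1 : p - s ≠ 0 := sub_ne_zero.2 hps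
  have h2 : (starRingEnd ℂ) p - s ≠ 0 := fun e => by
    have := congrArg Complex.im (sub_eq_zero.1 e)
    rw [Complex.conj_im] at this
    linarith
  have hn : HasFDerivAt (fun x : ℂ => x - s) (ContinuousLinearMap.id ℝ ℂ) p :=
    (hasFDerivAt_id p).sub_const s
  have hd : HasFDerivAt (fun x : ℂ => ((starRingEnd ℂ) x - s)⁻¹)
      ((-ContinuousLinearMap.mulLeftRight ℝ ℂ ((starRingEnd ℂ) p - s)⁻¹
        ((starRingEnd ℂ) p - s)⁻¹).comp (Complex.conjCLE : ℂ →L[ℝ] ℂ)) p :=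
    (hasFDerivAt_inv' h2).comp p ((Complex.conjCLE : ℂ →L[ℝ] ℂ).hasFDerivAt.sub_const s)
  have e : (fun x : ℂ => (x - s) / ((starRingEnd ℂ) x - s)) =
      (fun x : ℂ => x - s) * fun x : ℂ => ((starRingEnd ℂ) x - s)⁻¹ :=
    funext fun x => div_eq_mul_inv _ _
  rw [propagator, dlog, e, (hn.mul hd).fderiv]
  simp only [smul_apply, add_apply, ContinuousLinearMap.comp_apply, neg_apply,
    ContinuousLinearMap.mulLeftRight_apply, ContinuousLinearEquiv.coe_coe, Complex.conjCLE_apply,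
    ContinuousLinearMap.id_apply, smul_eq_mul, omega]
  field_simp
  ring

lemma wedgeDensity_propagator {u v p : ℂ} (hu : 0 ≤ u.im) (hv : 0 ≤ v.im)
    (hp : p ∈ punctured u v) :
    wedgeDensity (propagator u p) (propagator v p) = I * (2 * wedgeKer u v p) := by
  rw [wedgeDensity, propagator_apply hu hp.1 hp.2.1, propagator_apply hu hp.1 hp.2.1,
    propagator_apply hv hp.1 hp.2.2, propagator_apply hv hp.1 hp.2.2, wedgeKer, map_one,
    Complex.conj_I]
  ring

/-! ### Words in labels -/

lemma forms_map_pull {S : Type*} (z : S → ℂ) (γ : ℝ → ℂ) (w : List S) :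
    (forms z w).map (pull γ) = wordKer γ (w.map z) := by
  simp [forms, wordKer, Function.comp_def]

section Labels

variable {T : Type*} {z : T → ℂ} {y u v : T} {w : List (Option T)}

/-- The word in points given by a word in labels. -/
def toPoints (z : T → ℂ) (w : List (Option T)) : List (Option ℂ) := w.map (Option.map z)

lemma map_extend (z : T → ℂ) (p : ℂ) (w : List (Option T)) :
    w.map (extend z p) = place p (toPoints z w) := by
  simp only [place, toPoints, List.map_map]
  refine List.map_congr_left fun o _ => ?_
  cases o <;> rfl

lemma map_subst (z : T → ℂ) (w : List (Option T)) (t : T) :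
    (subst w t).map z = place (z t) (toPoints z w) := by
  simp only [place, toPoints, subst, List.map_map]
  refine List.map_congr_left fun o _ => ?_
  cases o <;> rfl

/-- The point of `t` is in the closed upper, the conjugate of the point of `y` in the closed lower
half plane; they can coincide only on the real axis. -/
lemma ne_conj (hz : IsConfig z) {t : T} (h : IsInterior z y ∨ t ≠ y) :
    z t ≠ (starRingEnd ℂ) (z y) := fun e => by
  have h1 := congrArg Complex.im e
  rw [Complex.conj_im] at h1
  have h2 := hz.im_nonneg t
  have h3 := hz.im_nonneg y
  rcases h with h | h
  · have : 0 < (z y).im := h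
    linarith
  · rw [Complex.conj_eq_iff_im.2 (by linarith)] at e
    exact h (hz.injective e)

lemma exists_goodWord {a : ℂ} {V : List (Option ℂ)} (ha : a.im ≤ 0)
    (him : ∀ s, some s ∈ V → 0 ≤ s.im) (hlast : ∀ s, some s ∈ V.getLast? → s ≠ a) :
    ∃ d, GoodWord a d V := by
  rcases h : V.getLast? with _ | _ | s
  · exact ⟨1, ha, one_pos, him, by simp [h]⟩
  · exact ⟨1, ha, one_pos, him, by simp [h]⟩
  · refine ⟨‖a - s‖, ha, norm_pos_iff.2 (sub_ne_zero.2 (hlast s (by simp [h])).symm), him, ?_⟩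
    intro s' hs'
    have : s = s' := by simpa [h] using hs'
    rw [this]

lemma GoodWord.mono {a : ℂ} {d d' : ℝ} {V : List (Option ℂ)} (h : GoodWord a d V) (hd' : 0 < d')
    (hle : d' ≤ d) : GoodWord a d' V :=
  ⟨h.base, hd', h.im_nonneg, fun s hs => hle.trans (h.last s hs)⟩

lemma exists_goodWord_toPoints (hz : IsConfig z) (hw : IsInterior z y ∨ w.getLast? ≠ some (some y)) :
    ∃ d, GoodWord ((starRingEnd ℂ) (z y)) d (toPoints z w) := by
  refine exists_goodWord (by simpa using hz.im_nonneg y) (fun s hs => ?_) fun s hs => ?_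
  · obtain ⟨o, -, ho⟩ := List.mem_map.1 hs
    obtain ⟨t, -, rfl⟩ := Option.map_eq_some_iff.1 ho
    exact hz.im_nonneg t
  · rw [toPoints, List.getLast?_map] at hs
    obtain ⟨o, ho, ho'⟩ := Option.mem_map.1 hs
    obtain ⟨t, rfl, rfl⟩ := Option.map_eq_some_iff.1 ho'
    refine ne_conj hz (hw.imp_right fun h e => h ?_)
    rw [← e]; exact ho

lemma exists_mem_fibre [Finite T] (z : T → ℂ) : (fibre z).Nonempty := by
  have hinj : Function.Injective fun n : ℕ => ((n : ℂ) + 1) * I := fun m n h => by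
    simpa using h
  obtain ⟨_, ⟨n, rfl⟩, hn⟩ := (Set.infinite_range_of_injective hinj).exists_notMem_finite
    (Set.finite_range z)
  refine ⟨_, ?_, hn⟩
  simp
  positivity

lemma measurableSet_fibre [Finite T] (z : T → ℂ) : MeasurableSet (fibre z) :=
  (isOpen_lt continuous_const Complex.continuous_im).measurableSet.inter
    (Set.finite_range z).measurableSet.compl

/-! ### Polylogarithms on the fibre and at the marked points -/

lemma polylog_fibre {d : ℝ} (h : GoodWord ((starRingEnd ℂ) (z y)) d (toPoints z w)) {p : ℂ}
    (hp : 0 < p.im) : PolylogConverges (extend z p) (some y) none w ∧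
      polylog (extend z p) (some y) none w = wordInt ((starRingEnd ℂ) (z y)) (toPoints z w) p := by
  have hb : ((starRingEnd ℂ) p).im ≤ 0 := by simpa using hp.le
  have hpa : p ≠ (starRingEnd ℂ) (z y) := fun e => by
    have := h.base
    rw [← e] at this
    linarith
  rw [PolylogConverges, polylog, iterConverges_iff, iterInt_eq_kerInt, forms_map_pull, map_extend,
    wordInt, fold_of_nonneg hp.le]
  change KerConverges (wordKer (path ((starRingEnd ℂ) (z y)) ((starRingEnd ℂ) p)) _) 1 ∧
    kerInt (wordKer (path ((starRingEnd ℂ) (z y)) ((starRingEnd ℂ) p)) _) 1 = _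
  cases w with
  | nil => exact ⟨trivial, rfl⟩
  | cons o w =>
    have him := h.place_im_nonneg hp.le
    have hlast := h.place_last_ne hpa
    have hhead : (Option.map z o).getD p ≠ (starRingEnd ℂ) p := fun e => by
      have := him _ (List.mem_map_of_mem (List.mem_cons_self ..))
      rw [e, Complex.conj_im] at this
      linarith
    exact ⟨kerConverges_path h.base hb him (fun _ => hlast) hhead,
      kerInt_path_eq_etaInt' h.base hb him (fun _ => hlast) hhead⟩

lemma polylog_label (hz : IsConfig z) {d : ℝ}
    (h : GoodWord ((starRingEnd ℂ) (z y)) d (some (z u) :: toPoints z w))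
    (huv : u ≠ v ∨ IsInterior z v) : PolylogConverges z y v (u :: subst w v) ∧
      polylog z y v (u :: subst w v) =
        wordInt ((starRingEnd ℂ) (z y)) (some (z u) :: toPoints z w) (z v) := by
  have hv := hz.im_nonneg v
  have hb : ((starRingEnd ℂ) (z v)).im ≤ 0 := by simpa using hv
  rw [PolylogConverges, polylog, iterConverges_iff, iterInt_eq_kerInt, forms_map_pull,
    List.map_cons, map_subst, wordInt, fold_of_nonneg hv]
  have him := h.place_im_nonneg hv
  have hhead : z u ≠ (starRingEnd ℂ) (z v) := ne_conj hz huv.symm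
  -- If `y = v` is real and `w` ends with `x`, the substituted word does end with `y`; but then the
  -- path is constant and nothing has to be checked.
  have hlast : (starRingEnd ℂ) (z y) ≠ (starRingEnd ℂ) (z v) →
      ∀ s ∈ (place (z v) (some (z u) :: toPoints z w)).getLast?, s ≠ (starRingEnd ℂ) (z y) :=
    fun hne => h.place_last_ne (ne_conj hz (Or.inr fun e => hne (by rw [e])))
  exact ⟨kerConverges_path h.base hb him hlast hhead, kerInt_path_eq_etaInt' h.base hb him hlast hhead⟩

lemma diffForms_map_pull (z : T → ℂ) (y u v : T) {w : List (Option T)} (hw : none ∉ w) :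
    (diffForms z u v w.reduceOption).map (pull (pathInf ((starRingEnd ℂ) (z y)))) =
      limDiffKer ((starRingEnd ℂ) (z y)) (z u) (z v) ::
        (toPoints z w).map (limKer ((starRingEnd ℂ) (z y))) := by
  rw [diffForms, List.map_cons]
  congr 1
  · funext τ
    simp only [pull, limDiffKer, limKer]
    ring
  · induction w with
    | nil => rfl
    | cons o w ih =>
      cases o with
      | none => simp at hw
      | some t =>
        have := ih (fun h => hw (List.mem_cons_of_mem _ h))
        simp only [toPoints, List.map_cons, List.reduceOption_cons_of_some, forms] at this ⊢
        rw [this]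
        rfl

lemma wedgeIntegrand_self (z : T → ℂ) (y u : T) (w : List (Option T)) :
    wedgeIntegrand z y u u w = 0 := by
  funext p
  simp [wedgeIntegrand, wedgeDensity, mul_comm]

lemma polylogInf_self (z : T → ℂ) (y u : T) (w : List T) : polylogInf z y u u w = 0 := by
  simp [polylogInf, diffForms, iterInt]

lemma wedgeIntegrand_eq (hz : IsConfig z) {d : ℝ}
    (h : GoodWord ((starRingEnd ℂ) (z y)) d (toPoints z w)) {p : ℂ} (hp : p ∈ fibre z) :
    wedgeIntegrand z y u v w p =
      I * density ((starRingEnd ℂ) (z y)) (z u) (z v) (toPoints z w) p := by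
  have hmem : p ∈ punctured (z u) (z v) :=
    ⟨hp.1, fun e => hp.2 ⟨u, e.symm⟩, fun e => hp.2 ⟨v, e.symm⟩⟩
  rw [wedgeIntegrand, (polylog_fibre h hp.1).2,
    wedgeDensity_propagator (hz.im_nonneg u) (hz.im_nonneg v) hmem, density,
    indicator_of_mem hmem]
  ring

lemma setIntegral_fibre_density [Finite T] (z : T → ℂ) (a : ℂ) (W : List (Option ℂ)) :
    ∫ p in fibre z, density a (z u) (z v) W p = ∫ p, density a (z u) (z v) W p := by
  refine setIntegral_eq_integral_of_ae_compl_eq_zero ?_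
  have h0 : ∀ᵐ p : ℂ, p ∈ (range z)ᶜ := compl_mem_ae_iff.2 ((Set.finite_range z).measure_zero _)
  filter_upwards [h0] with p hp hpf
  refine indicator_of_notMem (fun h => hpf ⟨h.1, hp⟩) _

end Labels

end

end NauticalWedge

open NauticalWedge MeasureTheory in
theorem mainTheorem4 {T : Type*} [Finite T] (z : T → ℂ) (hz : IsConfig z)
    (y u v : T) (w : List (Option T))
    (hw : ∀ p ∈ fibre z, IsNautical (extend z p) (some y) none w)
    (hy : (y ≠ u ∧ y ≠ v) ∨ w ≠ [] ∨ IsInterior z y)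
    (huv : u ≠ v ∨ IsInterior z u) :
    (∀ p ∈ fibre z, PolylogConverges (extend z p) (some y) none w) ∧
    IntegrableOn (wedgeIntegrand z y u v w) (fibre z) ∧
    PolylogConverges z y v (u :: subst w v) ∧
    PolylogConverges z y u (v :: subst w u) ∧
    (none ∈ w →
      ∫ p in fibre z, wedgeIntegrand z y u v w p =
        polylog z y v (u :: subst w v) - polylog z y u (v :: subst w u)) ∧
    (none ∉ w →
      PolylogInfConverges z y u v w.reduceOption ∧
      ∫ p in fibre z, wedgeIntegrand z y u v w p =
        polylog z y v (u :: subst w v) - polylog z y u (v :: subst w u)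
          - polylogInf z y u v w.reduceOption) := by
  -- The condition at `y` does not depend on the position of `x`, so one point of the fibre gives
  -- it; the fibre is non-empty because `T` is finite.
  obtain ⟨p₀, hp₀⟩ := exists_mem_fibre z
  have hlast : IsInterior z y ∨ w.getLast? ≠ some (some y) := (hw p₀ hp₀).1
  have hcons : ∀ t : T, (y ≠ t ∨ w ≠ [] ∨ IsInterior z y) →
      ∃ d, GoodWord ((starRingEnd ℂ) (z y)) d (some (z t) :: toPoints z w) := fun t ht => by
    refine exists_goodWord_toPoints (w := some t :: w) hz ?_
    cases w with
    | nil =>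
      rcases ht with ht | ht | ht
      · exact Or.inr (by simpa using ht.symm)
      · exact absurd rfl ht
      · exact Or.inl ht
    | cons o w => simpa [List.getLast?_cons_cons] using hlast
  obtain ⟨d₁, hd₁⟩ := hcons u (hy.imp_left And.left)
  obtain ⟨d₂, hd₂⟩ := hcons v (hy.imp_left And.right)
  have hmin : 0 < min d₁ d₂ := lt_min hd₁.pos hd₂.pos
  have gu := hd₁.mono hmin (min_le_left _ _)
  have gv := hd₂.mono hmin (min_le_right _ _)
  have gw := gu.tail
  have huv' : u ≠ v ∨ IsInterior z v := by
    rcases eq_or_ne u v with rfl | h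
    · exact huv
    · exact Or.inl h
  obtain ⟨cv, ev⟩ := polylog_label hz gu huv'
  obtain ⟨cu, eu⟩ := polylog_label (u := v) (v := u) hz gv (huv.imp_left Ne.symm)
  have hinf : none ∉ w → PolylogInfConverges z y u v w.reduceOption := fun h => by
    rw [PolylogInfConverges, iterConverges_iff, diffForms_map_pull z y u v h]
    exact gu.kerConverges_limDiffKer gv
  refine ⟨fun p hp => (polylog_fibre gw hp.1).1, ?_, cv, cu, ?_⟩
  · rcases eq_or_ne u v with rfl | hne
    · rw [wedgeIntegrand_self]; exact integrableOn_zero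
    · have hi := (integrable_density gw (hz.im_nonneg u) (hz.im_nonneg v)
        (hz.injective.ne hne)).const_mul Complex.I
      exact hi.integrableOn.congr_fun (fun p hp => (wedgeIntegrand_eq hz gw hp).symm)
        (measurableSet_fibre z)
  · rcases eq_or_ne u v with rfl | hne
    -- For `u = v` both sides vanish: the wedge of a form with itself, and differences of equal
    -- terms.
    · rw [wedgeIntegrand_self]
      refine ⟨fun _ => by simp, fun h => ⟨hinf h, ?_⟩⟩
      rw [polylogInf_self]; simp
    · have key : ∫ p in fibre z, wedgeIntegrand z y u v w p =
          polylog z y v (u :: subst w v) - polylog z y u (v :: subst w u) -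
            kerInt (limDiffKer ((starRingEnd ℂ) (z y)) (z u) (z v) ::
              (toPoints z w).map (limKer ((starRingEnd ℂ) (z y)))) 1 := by
        rw [setIntegral_congr_fun (measurableSet_fibre z)
          (fun p hp => wedgeIntegrand_eq (u := u) (v := v) hz gw hp), integral_const_mul,
          setIntegral_fibre_density, I_mul_integral_density gu gv (hz.injective.ne hne), ← ev, ← eu]
      refine ⟨fun h => ?_, fun h => ⟨hinf h, ?_⟩⟩
      -- The limit kernel of the letter `x` is zero, so the whole contribution at infinity vanishes.
      · rw [key, kerInt_eq_zero_of_mem, sub_zero]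
        refine List.mem_cons_of_mem _ (List.mem_map.2 ⟨none, ?_, rfl⟩)
        exact List.mem_map.2 ⟨none, h, rfl⟩
      · rw [key, polylogInf, iterInt_eq_kerInt, diffForms_map_pull z y u v h]
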